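/- **Setting.** Let $\alpha>0$, $0<\sigma\le 1\le\Lambda<\infty$, $S=\{k\in\mathbb R^3:\ \sigma\le|k|<\Lambda\}$. The one-photon space is $\mathfrak h=\{f\in L^2(S;\mathbb C^3):\ k\cdot f(k)=0 \text{ a.e.}\}$, with the antiunitary involution $(Jf)(k)=\overline{f(-k)}$ and $\mathfrak h_{\mathbb R}=\{f\in\mathfrak h:\ Jf=f\}$. Let $\mathfrak F$ be the bosonic Fock space over $\mathfrak h$, $N$ its number operator, $a^*(f),a(f)$ the creation and annihilation operators, $H_{\rm ph}=\mathrm d\Gamma(|k|)$, and $A_\mu(x)=a^*(m_\mu(x))+a(m_\mu(x))$, $\mu=1,2,3$, with $$m_{\mu,\nu}(x,k)=(2\pi)^{-3/2}|k|^{-1/2}\Big(\delta_{\mu\nu}-\tfrac{k_\mu k_\nu}{|k|^2}\Big)e^{-ik\cdot x},\qquad k\in S.$$ For $\phi\in H^1(\mathbb R^3)$ and $\psi\in\mathcal D(N^{1/2})$ the Lieb–Loss functional is the quadratic form of the Pauli–Fierz Hamiltonian at $\phi\otimes\psi$, $$\mathcal E(\phi,\psi)=\tfrac12\big\|(i\nabla+\sqrt\alpha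 A(x))(\phi\otimes\psi)\big\|^2+\|\phi\|^2\langle\psi,H_{\rm ph}\psi\rangle ,\qquad \widehat{\mathcal E}(\phi)=\inf\{\mathcal E(\phi,\psi):\ \psi\in\mathcal D(N^{1/2}),\ \|\psi\|=1\}.$$ For $r\in L^2(\mathbb R^3)$ with unitary Fourier transform $\hat r$, let $\Phi_{r,\alpha}:\mathfrak h\to L^2(\mathbb R^3;\mathbb C^3)$, $(\Phi_{r,\alpha}f)(p)=\alpha^{1/2}(2\pi)^{-3/2}\int_S\hat r(p-k)f(k)\,dk$, $\Theta_{r,\alpha}=\Phi_{r,\alpha}^*\Phi_{r,\alpha}$, and $$T_{r,\alpha}=|k|^{-1/2}\begin{pmatrix}2|k|^2+\Theta_{r,\alpha}&\Theta_{r,\alpha}\\ \Theta_{r,\alpha}&\Theta_{r,\alpha}\end{pmatrix}|k|^{-1/2}\quad\text{on }\mathfrak h\oplus\mathfrak h .$$ Put $A_J(f\oplus Jg)=a(f)+a^*(g)$, $A_J^*(F)=A_J(F)^*$, $q(y)=y\oplus Jy$, $q^*(f\oplus g)=f+Jg$, and $$\mathrm d\Gamma_J[T,y]=\sum_{i,j}\langle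 F_i,TF_j\rangle A_J^*(F_i)A_J(F_j)+\sum_i\big\{\langle F_i,q(y)\rangle A_J^*(F_i)+\overline{\langle F_i,q(y)\rangle}A_J(F_i)\big\},$$ where $(F_i)$ is the orthonormal basis $\{e_i\oplus0\}\cup\{0\oplus e_i\}$ for an orthonormal basis $(e_i)$ of $\mathfrak h$; the series is understood as a quadratic form on $\mathcal D(N^{1/2})$, and $\mathrm d\Gamma_J[T,0]$ also denotes the operator associated with this form. A Weyl transformation with parameter $\eta\in\mathfrak h$ is a unitary $\mathbb W_\eta$ on $\mathfrak F$ which, together with its inverse, leaves $\mathcal D(N^{1/2})$ invariant and satisfies $\mathbb W_\eta a^*(f)\mathbb W_\eta^*=a^*(f)+\langle\eta,f\rangle$ for all $f\in\mathfrak h$. **Theorem.** Let $\phi\in H^1(\mathbb R^3;\mathbb C)$ with $\|\phi\|_2=1$. Then $|\phi|\in H^1(\mathbb R^3)$ and: 1. $\widehat{\mathcal E}(\phi)\ \ge\ \widehat{\mathcal E}(|\phi|)$. 2. $\mathrm d\Gamma_J[T_{|\phi|,\alpha},0]$ is self-adjoint, its spectrum is non-empty and bounded below, and $$\widehat{\mathcal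 E}(|\phi|)=\tfrac12\big\|\nabla|\phi|\big\|_2^2+\tfrac12\inf\sigma\big(\mathrm d\Gamma_J[T_{|\phi|,\alpha},0]\big).$$ 3. There is a Weyl transformation $\mathbb W_\phi$, depending on $\phi$ but not on $\psi$, such that $\mathcal E(\phi,\psi)\ge\mathcal E(|\phi|,\mathbb W_\phi\psi)$ for all $\psi\in\mathcal D(N^{1/2})$ with $\|\psi\|=1$. 4. Let $w=\mathrm{Im}(\overline\phi\,\nabla\phi)/|\phi|$ where $\phi\neq0$ and $w=0$ elsewhere (so $w=r\nabla\gamma$ if $\phi=re^{i\gamma}$ with $r=|\phi|$), and let $y=|k|^{-1/2}\Phi_{|\phi|,\alpha}^*\hat w\in\mathfrak h$. There is a unique $\eta\in\mathfrak h_{\mathbb R}$ with $y=\tfrac12q^*T_{|\phi|,\alpha}q(\eta)$, and for this $\eta$ there is a Weyl transformation $\mathbb W_\eta$ with, as quadratic forms on $\mathcal D(N^{1/2})$, $$\mathrm d\Gamma_J[T_{|\phi|,\alpha},y]\ \ge\ \mathbb W_\eta\,\mathrm d\Gamma_J[T_{|\phi|,\alpha},0]\,\mathbb W_\eta^*-\|w\|_2^2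 .$$ -/

import Mathlib

open MeasureTheory FourierTransform
open scoped InnerProductSpace ComplexConjugate ENNReal

noncomputable section

namespace LiebLoss

/-! ### Bosonic Fock space -/

section Fock

/-- The bosonic Fock space over a Hilbert space `H` with orthonormal basis `(e_i)_{i ∈ ι}`, in the
occupation number representation: `ψ n` is the coefficient of `ψ` at the normalized symmetric
tensor in which `e_i` occurs `n i` times. The `N`-particle sector consists of the `ψ` supported
on `{n | n.degree = N}`, and the vacuum is the unit vector at `n = 0`. -/
abbrev Fock (ι : Type*) : Type _ := lp (fun _ : ι →₀ ℕ => ℂ) 2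

variable {ι : Type*}

theorem Fock.summable_sq (ψ : Fock ι) : Summable fun n => ‖ψ n‖ ^ 2 := by
  have := (lp.memℓp ψ).summable (by norm_num)
  simpa using this

theorem memℓp_two {g : (ι →₀ ℕ) → ℂ} (h : Summable fun n => ‖g n‖ ^ 2) :
    Memℓp (E := fun _ : ι →₀ ℕ => ℂ) g 2 := by
  refine memℓp_gen ?_
  simpa using h

/-- The domain `D(N^{1/2})` of the square root of the number operator `N`, i.e. the vectors
with finite expected particle number. -/
def numDom (ι : Type*) : Submodule ℂ (Fock ι) where
  carrier := {ψ | Summable fun n : ι →₀ ℕ => (n.degree : ℝ) * ‖ψ n‖ ^ 2}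
  zero_mem' := by simp
  add_mem' := by
    intro ψ χ hψ hχ
    refine Summable.of_nonneg_of_le (fun n => by positivity) (fun n => ?_)
      ((hψ.mul_left 2).add (hχ.mul_left 2))
    have h1 : ‖(ψ + χ) n‖ ≤ ‖ψ n‖ + ‖χ n‖ := norm_add_le _ _
    have h2 : ‖(ψ + χ) n‖ ^ 2 ≤ 2 * ‖ψ n‖ ^ 2 + 2 * ‖χ n‖ ^ 2 := by
      nlinarith [norm_nonneg ((ψ + χ) n), sq_nonneg (‖ψ n‖ - ‖χ n‖)]
    calc (n.degree : ℝ) * ‖(ψ + χ) n‖ ^ 2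
        ≤ (n.degree : ℝ) * (2 * ‖ψ n‖ ^ 2 + 2 * ‖χ n‖ ^ 2) := by gcongr
      _ = _ := by ring
  smul_mem' := by
    intro c ψ hψ
    refine (hψ.mul_left (‖c‖ ^ 2)).congr (fun n => ?_)
    have : (c • ψ) n = c * ψ n := rfl
    rw [this, norm_mul]; ring

theorem Finsupp_add_single_injective :
    Function.Injective (fun p : (ι →₀ ℕ) × ι => (p.1 + Finsupp.single p.2 1, p.2)) := by
  rintro ⟨n, i⟩ ⟨m, j⟩ h
  simp only [Prod.mk.injEq] at h
  obtain ⟨h1, rfl⟩ := h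
  simpa using h1

theorem numDom.summable_add (ψ : numDom ι) : Summable fun p : (ι →₀ ℕ) × ι =>
    ((p.1 p.2 : ℝ) + 1) * ‖ψ.1 (p.1 + Finsupp.single p.2 1)‖ ^ 2 := by
  have key : Summable fun p : (ι →₀ ℕ) × ι => (p.1 p.2 : ℝ) * ‖ψ.1 p.1‖ ^ 2 := by
    refine (summable_prod_of_nonneg (fun p => by positivity)).2 ⟨fun n => ?_, ?_⟩
    · refine summable_of_ne_finset_zero (s := n.support) (fun i hi => ?_)
      simp [Finsupp.notMem_support_iff.1 hi]
    · refine ψ.2.congr (fun n => ?_)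
      rw [tsum_eq_sum (s := n.support)
        (fun i hi => by simp [Finsupp.notMem_support_iff.1 hi])]
      simp only [Finsupp.degree_apply, Nat.cast_sum, Finset.sum_mul]
  refine (key.comp_injective Finsupp_add_single_injective).congr (fun p => ?_)
  simp

variable {H : Type*} [NormedAddCommGroup H] [InnerProductSpace ℂ H]

theorem summable_coeff (b : HilbertBasis ι ℂ H) (f : H) : Summable fun i => ‖b.repr f i‖ ^ 2 := by
  have := (lp.memℓp (b.repr f)).summable (by norm_num)
  simpa using this

theorem annihilate_summable (b : HilbertBasis ι ℂ H) (f : H) (ψ : numDom ι) (n : ι →₀ ℕ) :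
    Summable fun i => conj (b.repr f i) *
      ((Real.sqrt (n i + 1) : ℂ) * ψ.1 (n + Finsupp.single i 1)) := by
  have h2 : Summable fun i => ((n i : ℝ) + 1) * ‖ψ.1 (n + Finsupp.single i 1)‖ ^ 2 :=
    (numDom.summable_add ψ).prod_factor n
  refine Summable.of_norm_bounded ((summable_coeff b f).add h2) (fun i => ?_)
  have h3 : ‖((Real.sqrt (n i + 1) : ℂ) * ψ.1 (n + Finsupp.single i 1))‖ ^ 2 =
      ((n i : ℝ) + 1) * ‖ψ.1 (n + Finsupp.single i 1)‖ ^ 2 := by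
    rw [norm_mul, mul_pow, Complex.norm_real, Real.norm_eq_abs, sq_abs,
      Real.sq_sqrt (by positivity)]
  rw [← h3, norm_mul, RCLike.norm_conj]
  nlinarith [sq_nonneg (‖b.repr f i‖ -
    ‖((Real.sqrt (n i + 1) : ℂ) * ψ.1 (n + Finsupp.single i 1))‖),
    sq_nonneg ‖b.repr f i‖,
    sq_nonneg ‖((Real.sqrt (n i + 1) : ℂ) * ψ.1 (n + Finsupp.single i 1))‖]

theorem annihilate_mem (b : HilbertBasis ι ℂ H) (f : H) (ψ : numDom ι) :
    Memℓp (E := fun _ : ι →₀ ℕ => ℂ) (fun n => ∑' i, conj (b.repr f i) *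
      ((Real.sqrt (n i + 1) : ℂ) * ψ.1 (n + Finsupp.single i 1))) 2 := by
  refine memℓp_two ?_
  have hs := numDom.summable_add ψ
  refine Summable.of_nonneg_of_le (fun n => by positivity) (fun n => ?_)
    ((hs.prod).mul_left (∑' i, ‖b.repr f i‖ ^ 2))
  have h2 : Summable fun i => ((n i : ℝ) + 1) * ‖ψ.1 (n + Finsupp.single i 1)‖ ^ 2 :=
    hs.prod_factor n
  have h3 : ∀ i, ‖((Real.sqrt (n i + 1) : ℂ) * ψ.1 (n + Finsupp.single i 1))‖ ^ 2 =
      ((n i : ℝ) + 1) * ‖ψ.1 (n + Finsupp.single i 1)‖ ^ 2 := fun i => by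
    rw [norm_mul, mul_pow, Complex.norm_real, Real.norm_eq_abs, sq_abs,
      Real.sq_sqrt (by positivity)]
  have h4 := (annihilate_summable b f ψ n)
  have h5 := h4.norm
  have h6 : ‖∑' i, conj (b.repr f i) *
      ((Real.sqrt (n i + 1) : ℂ) * ψ.1 (n + Finsupp.single i 1))‖ ≤
      Real.sqrt (∑' i, ‖b.repr f i‖ ^ 2) *
      Real.sqrt (∑' i, ((n i : ℝ) + 1) * ‖ψ.1 (n + Finsupp.single i 1)‖ ^ 2) := by
    refine (norm_tsum_le_tsum_norm h5).trans (h5.tsum_le_of_sum_le (fun s => ?_))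
    calc ∑ i ∈ s, ‖conj (b.repr f i) *
          ((Real.sqrt (n i + 1) : ℂ) * ψ.1 (n + Finsupp.single i 1))‖
        = ∑ i ∈ s, ‖b.repr f i‖ *
          ‖((Real.sqrt (n i + 1) : ℂ) * ψ.1 (n + Finsupp.single i 1))‖ := by
          refine Finset.sum_congr rfl fun i _ => ?_
          rw [norm_mul, RCLike.norm_conj]
      _ ≤ _ := Real.sum_mul_le_sqrt_mul_sqrt _ _ _
      _ ≤ _ := by
          simp only [h3]
          gcongr
          · exact (summable_coeff b f).sum_le_tsum _ (fun i _ => by positivity)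
          · exact h2.sum_le_tsum _ (fun i _ => by positivity)
  calc _ ≤ (Real.sqrt (∑' i, ‖b.repr f i‖ ^ 2) *
      Real.sqrt (∑' i, ((n i : ℝ) + 1) * ‖ψ.1 (n + Finsupp.single i 1)‖ ^ 2)) ^ 2 := by gcongr
    _ = _ := by
      rw [mul_pow, Real.sq_sqrt (tsum_nonneg fun i => by positivity),
        Real.sq_sqrt (tsum_nonneg fun i => by positivity)]

/-- The annihilation operator `a(f)` on `D(N^{1/2})`; it is antilinear in `f`. -/
def annihilate (b : HilbertBasis ι ℂ H) (f : H) : numDom ι →ₗ[ℂ] Fock ι where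
  toFun ψ := ⟨fun n => ∑' i, conj (b.repr f i) *
      ((Real.sqrt (n i + 1) : ℂ) * ψ.1 (n + Finsupp.single i 1)), annihilate_mem b f ψ⟩
  map_add' ψ χ := by
    ext n
    refine Eq.trans ?_ ((annihilate_summable b f ψ n).tsum_add (annihilate_summable b f χ n))
    refine tsum_congr fun i => ?_
    simp only [Submodule.coe_add, lp.coeFn_add, Pi.add_apply]
    ring
  map_smul' c ψ := by
    ext n
    refine Eq.trans ?_ (tsum_mul_left (a := c))
    refine tsum_congr fun i => ?_
    simp only [Submodule.coe_smul, lp.coeFn_smul, Pi.smul_apply, smul_eq_mul]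
    ring

theorem create_mem (b : HilbertBasis ι ℂ H) (f : H) (ψ : numDom ι) :
    Memℓp (E := fun _ : ι →₀ ℕ => ℂ) (fun n => ∑ i ∈ n.support, b.repr f i *
      ((Real.sqrt (n i) : ℂ) * ψ.1 (n - Finsupp.single i 1))) 2 := by
  refine memℓp_two ?_
  let G : (ι →₀ ℕ) × ι → ℝ := fun p =>
    (((p.1.degree : ℝ) + 1) * ‖ψ.1 p.1‖ ^ 2) * ‖b.repr f p.2‖ ^ 2
  have hG : Summable G := by
    have h1 : Summable fun n : ι →₀ ℕ => ((n.degree : ℝ) + 1) * ‖ψ.1 n‖ ^ 2 :=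
      (ψ.2.add (Fock.summable_sq ψ.1)).congr fun n => by ring
    exact h1.mul_of_nonneg (summable_coeff b f) (fun n => by positivity) (fun i => by positivity)
  let K : (ι →₀ ℕ) × ι → ℝ := fun p =>
    if p.1 p.2 = 0 then 0 else
      ((p.1.degree : ℝ) * ‖ψ.1 (p.1 - Finsupp.single p.2 1)‖ ^ 2) * ‖b.repr f p.2‖ ^ 2
  have hK0 : ∀ p, 0 ≤ K p := fun p => by
    simp only [K]; split_ifs <;> positivity
  have hK : Summable K := by
    refine (Finsupp_add_single_injective.summable_iff ?_).1 (hG.congr ?_)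
    · rintro ⟨n, i⟩ hp
      by_contra hne
      apply hp
      have hni : n i ≠ 0 := by
        intro h0; apply hne; simp [K, h0]
      refine ⟨(n - Finsupp.single i 1, i), ?_⟩
      simp only [Prod.mk.injEq, and_true]
      ext j
      by_cases hj : j = i
      · subst hj; simp; omega
      · simp [Ne.symm hj]
    · rintro ⟨n, i⟩
      simp [K, G, map_add]
  refine Summable.of_nonneg_of_le (fun n => by positivity) (fun n => ?_) hK.prod
  have e1 : ∑' i, K (n, i) = ∑ i ∈ n.support, K (n, i) :=
    tsum_eq_sum fun i hi => by simp [K, Finsupp.notMem_support_iff.1 hi]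
  rw [e1]
  calc ‖∑ i ∈ n.support, b.repr f i *
          ((Real.sqrt (n i) : ℂ) * ψ.1 (n - Finsupp.single i 1))‖ ^ 2
      ≤ (∑ i ∈ n.support, Real.sqrt (n i) *
          (‖b.repr f i‖ * ‖ψ.1 (n - Finsupp.single i 1)‖)) ^ 2 := by
        gcongr
        refine (norm_sum_le _ _).trans (Finset.sum_le_sum fun i _ => le_of_eq ?_)
        rw [norm_mul, norm_mul, Complex.norm_real, Real.norm_eq_abs,
          abs_of_nonneg (Real.sqrt_nonneg _)]
        ring
    _ ≤ (∑ i ∈ n.support, Real.sqrt (n i) ^ 2) *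
          ∑ i ∈ n.support, (‖b.repr f i‖ * ‖ψ.1 (n - Finsupp.single i 1)‖) ^ 2 :=
        Finset.sum_mul_sq_le_sq_mul_sq _ _ _
    _ = ∑ i ∈ n.support, K (n, i) := by
        have : ∑ i ∈ n.support, Real.sqrt (n i) ^ 2 = (n.degree : ℝ) := by
          rw [Finsupp.degree_apply]; push_cast
          exact Finset.sum_congr rfl fun i _ => Real.sq_sqrt (by positivity)
        rw [this, Finset.mul_sum]
        refine Finset.sum_congr rfl fun i hi => ?_
        simp only [K, if_neg (Finsupp.mem_support_iff.1 hi)]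
        ring

/-- The creation operator `a^*(f)` on `D(N^{1/2})`; it is linear in `f`. -/
def create (b : HilbertBasis ι ℂ H) (f : H) : numDom ι →ₗ[ℂ] Fock ι where
  toFun ψ := ⟨fun n => ∑ i ∈ n.support, b.repr f i *
      ((Real.sqrt (n i) : ℂ) * ψ.1 (n - Finsupp.single i 1)), create_mem b f ψ⟩
  map_add' ψ χ := by
    ext n
    refine Eq.trans ?_ Finset.sum_add_distrib
    refine Finset.sum_congr rfl fun i _ => ?_
    simp only [Submodule.coe_add, lp.coeFn_add, Pi.add_apply]
    ring
  map_smul' c ψ := by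
    ext n
    refine Eq.trans ?_ (Finset.mul_sum _ _ c).symm
    refine Finset.sum_congr rfl fun i _ => ?_
    simp only [Submodule.coe_smul, lp.coeFn_smul, Pi.smul_apply, smul_eq_mul]
    ring

/-- The quadratic form `⟨ψ, dΓ(ω) ψ⟩ = ∑_{i,j} ⟨e_i, ω e_j⟩ ⟨a(e_i) ψ, a(e_j) ψ⟩` on `D(N^{1/2})`
of the second quantization `dΓ(ω) = ∑_{i,j} ⟨e_i, ω e_j⟩ a^*(e_i) a(e_j)` of a bounded self-adjoint
operator `ω`. -/
def secondQuantForm (b : HilbertBasis ι ℂ H) (ω : H →L[ℂ] H) (ψ : numDom ι) : ℝ :=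
  (∑' i, ∑' j, ⟪b i, ω (b j)⟫_ℂ * ⟪annihilate b (b i) ψ, annihilate b (b j) ψ⟫_ℂ).re

/-- The field operator `a^*(f) + a(f)`. -/
def field (b : HilbertBasis ι ℂ H) (f : H) (ψ : numDom ι) : Fock ι :=
  create b f ψ + annihilate b f ψ

/-- The generalized annihilation operator `A_J(f ⊕ J g) = a(f) + a^*(g)`, where `J` is an
antiunitary involution, so that `A_J(f ⊕ h) = a(f) + a^*(J h)`. The generalized creation operator
is `A_J^*(F) = A_J(F)^*`. -/
def genAnnihilate (b : HilbertBasis ι ℂ H) (J : H → H) (F : WithLp 2 (H × H)) :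
    numDom ι →ₗ[ℂ] Fock ι :=
  annihilate b F.fst + create b (J F.snd)

/-- The real-linear map `q(y) = y ⊕ J y`. -/
def qMap (J : H → H) (y : H) : WithLp 2 (H × H) := WithLp.toLp 2 (y, J y)

/-- The map `q^*(f ⊕ g) = f + J g`. -/
def qStar (J : H → H) (F : WithLp 2 (H × H)) : H := F.fst + J F.snd

/-- The operator on `H ⊕ H` with block matrix `(A B; C D)`. -/
def blockOp (A B C D : H →L[ℂ] H) : WithLp 2 (H × H) →L[ℂ] WithLp 2 (H × H) :=
  (WithLp.prodContinuousLinearEquiv 2 ℂ H H).symm.toContinuousLinearMap ∘L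
    ((A.coprod B).prod (C.coprod D)) ∘L
    (WithLp.prodContinuousLinearEquiv 2 ℂ H H).toContinuousLinearMap

/-- The orthonormal basis of `H ⊕ H` consisting of all `e_i ⊕ 0` and all `0 ⊕ e_i`. -/
def pairBasis (b : HilbertBasis ι ℂ H) : ι ⊕ ι → WithLp 2 (H × H) :=
  Sum.elim (fun i => WithLp.toLp 2 (b i, 0)) (fun i => WithLp.toLp 2 (0, b i))

/-- The summand `⟨F_i, T F_j⟩ ⟨χ, A_J^*(F_i) A_J(F_j) ψ⟩`. -/
def quadTerm (b : HilbertBasis ι ℂ H) (J : H → H)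
    (T : WithLp 2 (H × H) →L[ℂ] WithLp 2 (H × H)) (χ ψ : numDom ι) (i j : ι ⊕ ι) : ℂ :=
  ⟪pairBasis b i, T (pairBasis b j)⟫_ℂ *
    ⟪genAnnihilate b J (pairBasis b i) χ, genAnnihilate b J (pairBasis b j) ψ⟫_ℂ

/-- The summand `⟨F_i, q(y)⟩ ⟨χ, A_J^*(F_i) ψ⟩ + conj ⟨F_i, q(y)⟩ ⟨χ, A_J(F_i) ψ⟩`. -/
def linTerm (b : HilbertBasis ι ℂ H) (J : H → H) (y : H) (χ ψ : numDom ι) (i : ι ⊕ ι) : ℂ :=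
  ⟪pairBasis b i, qMap J y⟫_ℂ * ⟪genAnnihilate b J (pairBasis b i) χ, ψ.1⟫_ℂ +
    conj ⟪pairBasis b i, qMap J y⟫_ℂ * ⟪χ.1, genAnnihilate b J (pairBasis b i) ψ⟫_ℂ

/-- The quadratic form `⟨ψ, dΓ_J[T, y] ψ⟩` on `D(N^{1/2})` of the second quantization
`dΓ_J[T, y] = ∑_{i,j} ⟨F_i, T F_j⟩ A_J^*(F_i) A_J(F_j)
  + ∑_i (⟨F_i, q(y)⟩ A_J^*(F_i) + conj ⟨F_i, q(y)⟩ A_J(F_i))`. -/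
def dGammaForm (b : HilbertBasis ι ℂ H) (J : H → H)
    (T : WithLp 2 (H × H) →L[ℂ] WithLp 2 (H × H)) (y : H) (ψ : numDom ι) : ℝ :=
  ((∑' i, ∑' j, quadTerm b J T ψ ψ i j) + ∑' i, linTerm b J y ψ ψ i).re

theorem quadTerm_add (b : HilbertBasis ι ℂ H) (J : H → H)
    (T : WithLp 2 (H × H) →L[ℂ] WithLp 2 (H × H)) (χ ψ ψ' : numDom ι) (i j : ι ⊕ ι) :
    quadTerm b J T χ (ψ + ψ') i j = quadTerm b J T χ ψ i j + quadTerm b J T χ ψ' i j := by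
  unfold quadTerm
  rw [map_add, inner_add_right, mul_add]

theorem quadTerm_smul (b : HilbertBasis ι ℂ H) (J : H → H)
    (T : WithLp 2 (H × H) →L[ℂ] WithLp 2 (H × H)) (c : ℂ) (χ ψ : numDom ι) (i j : ι ⊕ ι) :
    quadTerm b J T χ (c • ψ) i j = c * quadTerm b J T χ ψ i j := by
  unfold quadTerm
  rw [map_smul, inner_smul_right]
  ring

/-- `ψ` is mapped to `ξ` by the operator `dΓ_J[T, 0]`: the series
`∑_{i,j} ⟨F_i, T F_j⟩ ⟨χ, A_J^*(F_i) A_J(F_j) ψ⟩` converges to `⟨χ, ξ⟩` for all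
`χ ∈ D(N^{1/2})`. -/
def IsDGammaImage (b : HilbertBasis ι ℂ H) (J : H → H)
    (T : WithLp 2 (H × H) →L[ℂ] WithLp 2 (H × H)) (ψ : numDom ι) (ξ : Fock ι) : Prop :=
  ∀ χ : numDom ι, (∀ i, Summable fun j => quadTerm b J T χ ψ i j) ∧
    HasSum (fun i => ∑' j, quadTerm b J T χ ψ i j) ⟪χ.1, ξ⟫_ℂ

/-- The graph of the operator `dΓ_J[T, 0]`, with domain all `ψ ∈ D(N^{1/2})` for which the above
series represents a vector of the Fock space. -/
def dGammaGraph (b : HilbertBasis ι ℂ H) (J : H → H)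
    (T : WithLp 2 (H × H) →L[ℂ] WithLp 2 (H × H)) : Submodule ℂ (Fock ι × Fock ι) where
  carrier := {p | ∃ ψ : numDom ι, ψ.1 = p.1 ∧ IsDGammaImage b J T ψ p.2}
  zero_mem' := ⟨0, rfl, fun χ => by
    have e : ∀ i j, quadTerm b J T χ 0 i j = 0 := fun i j => by
      unfold quadTerm; rw [map_zero, inner_zero_right, mul_zero]
    simp only [e, Prod.snd_zero, inner_zero_right, tsum_zero]
    exact ⟨fun _ => summable_zero, hasSum_zero⟩⟩
  add_mem' := by
    rintro ⟨_, ξ⟩ ⟨_, ξ'⟩ ⟨ψ, rfl, h⟩ ⟨ψ', rfl, h'⟩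
    refine ⟨ψ + ψ', rfl, fun χ => ?_⟩
    simp only [quadTerm_add]
    refine ⟨fun i => ((h χ).1 i).add ((h' χ).1 i), ?_⟩
    have h2 := (h χ).2.add ((h' χ).2)
    rw [← inner_add_right] at h2
    exact (funext fun i => ((h χ).1 i).tsum_add ((h' χ).1 i)) ▸ h2
  smul_mem' := by
    rintro c ⟨_, ξ⟩ ⟨ψ, rfl, h⟩
    refine ⟨c • ψ, rfl, fun χ => ?_⟩
    simp only [quadTerm_smul]
    refine ⟨fun i => ((h χ).1 i).mul_left c, ?_⟩
    have h2 := (h χ).2.mul_left c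
    rw [← inner_smul_right] at h2
    exact (funext fun i => tsum_mul_left (a := c) (f := fun j => quadTerm b J T χ ψ i j)) ▸ h2

/-- The graph `dGammaGraph` is single-valued, so that it is the graph of a linear operator. -/
theorem dGammaGraph_functional (b : HilbertBasis ι ℂ H) (J : H → H)
    (T : WithLp 2 (H × H) →L[ℂ] WithLp 2 (H × H)) {ξ : Fock ι}
    (h : ((0 : Fock ι), ξ) ∈ dGammaGraph b J T) : ξ = 0 := by
  classical
  obtain ⟨ψ, hψ, hξ⟩ := h
  obtain rfl : ψ = 0 := Subtype.ext hψ
  ext n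
  have hmem : (lp.single 2 n (1 : ℂ) : Fock ι) ∈ numDom ι := by
    refine summable_of_ne_finset_zero (s := {n}) fun m hm => ?_
    have : m ≠ n := by simpa using hm
    simp [lp.single_apply, this]
  have h2 := (hξ ⟨_, hmem⟩).2
  have h3 : ⟪(lp.single 2 n (1 : ℂ) : Fock ι), ξ⟫_ℂ = 0 := by
    refine h2.unique ?_
    simp only [quadTerm, map_zero, inner_zero_right, mul_zero, tsum_zero]
    exact hasSum_zero
  rw [lp.inner_single_left] at h3
  simpa using h3

/-- The operator `dΓ_J[T, 0]` on Fock space. -/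
def dGamma (b : HilbertBasis ι ℂ H) (J : H → H)
    (T : WithLp 2 (H × H) →L[ℂ] WithLp 2 (H × H)) : Fock ι →ₗ.[ℂ] Fock ι :=
  (dGammaGraph b J T).toLinearPMap

/-- `W` is a Weyl transformation with parameter `η`: a unitary operator on Fock space with
`W a^*(f) W^* = a^*(f) + ⟨η, f⟩` for all `f`, as an identity of operators on `D(N^{1/2})`, which
is invariant under `W` and `W^*`. -/
structure IsWeyl (b : HilbertBasis ι ℂ H) (η : H) (W : Fock ι ≃ₗᵢ[ℂ] Fock ι) : Prop where
  map_mem : ∀ ψ ∈ numDom ι, W ψ ∈ numDom ι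
  symm_mem : ∀ ψ ∈ numDom ι, W.symm ψ ∈ numDom ι
  conj_create : ∀ (f : H) (ψ : Fock ι) (hψ : ψ ∈ numDom ι),
    W (create b f ⟨W.symm ψ, symm_mem ψ hψ⟩) = create b f ⟨ψ, hψ⟩ + ⟪η, f⟫_ℂ • ψ

end Fock

/-- The spectrum of an unbounded operator `A`: the complement of the set of all `z` for which
`A - z` is a bijection from the domain of `A` onto the whole space with bounded inverse. -/
def opSpectrum {V : Type*} [NormedAddCommGroup V] [NormedSpace ℂ V] (A : V →ₗ.[ℂ] V) : Set ℂ :=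
  {z | ¬ ∃ R : V →L[ℂ] V, (∀ v, ∃ h : R v ∈ A.domain, A ⟨R v, h⟩ - z • R v = v) ∧
    ∀ u : A.domain, R (A u - z • (u : V)) = u}

end LiebLoss

namespace LiebLoss

/-! ### Sobolev functions and the Fourier transform on `ℝ³` -/

/-- Physical space and momentum space `ℝ³`. -/
abbrev R3 : Type := EuclideanSpace ℝ (Fin 3)

/-- The space `ℂ³` with its Hermitian norm. -/
abbrev C3 : Type := EuclideanSpace ℂ (Fin 3)

/-- `g = (g_0, g_1, g_2)` is the weak gradient of `φ`. -/
def IsWeakGradient (φ : R3 → ℂ) (g : R3 → C3) : Prop :=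
  ∀ u : R3 → ℝ, ContDiff ℝ (⊤ : ℕ∞) u → HasCompactSupport u → ∀ μ : Fin 3,
    ∫ x, (u x : ℂ) * g x μ = -∫ x, (fderiv ℝ u x (EuclideanSpace.single μ 1) : ℂ) * φ x

/-- The Sobolev space `H¹(ℝ³)`. -/
def MemH1 (φ : R3 → ℂ) : Prop :=
  MemLp φ 2 volume ∧ ∃ g : R3 → C3, MemLp g 2 volume ∧ IsWeakGradient φ g

/-- The weak gradient of a function in `H¹(ℝ³)` (which is unique almost everywhere). -/
def weakGrad (φ : R3 → ℂ) : R3 → C3 :=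
  open Classical in
  if h : ∃ g : R3 → C3, MemLp g 2 volume ∧ IsWeakGradient φ g then h.choose else 0

/-- The Dirichlet integral `‖∇φ‖²`. -/
def gradNormSq (φ : R3 → ℂ) : ℝ := ∫ x, ‖weakGrad φ x‖ ^ 2

/-- The function `|φ|`. -/
def absFn (φ : R3 → ℂ) : R3 → ℂ := fun x => (‖φ x‖ : ℂ)

/-- The real vector field `Im(conj φ ∇φ) / |φ|`, set to zero where `φ = 0`. If `φ = r e^{iγ}` with
`r = |φ|`, this is `r ∇γ`. -/
def phaseGrad (φ : R3 → ℂ) : R3 → C3 := fun x =>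
  WithLp.toLp 2 fun μ => (((conj (φ x) * weakGrad φ x μ).im / ‖φ x‖ : ℝ) : ℂ)

/-- The class in `L²(ℝ³)` of a square-integrable function. -/
def toL2 {F : Type*} [NormedAddCommGroup F] (f : R3 → F) : Lp F 2 (volume : Measure R3) :=
  open Classical in if h : MemLp f 2 volume then h.toLp f else 0

section FourierTransform

variable {F : Type*} [NormedAddCommGroup F] [InnerProductSpace ℂ F] [CompleteSpace F]

/-- The unitary Fourier transform `f̂(p) = (2π)^{-3/2} ∫ e^{-i p·x} f(x) dx` on `L²(ℝ³)`, obtained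
by scaling from Mathlib's `𝓕 f(p) = ∫ e^{-2πi p·x} f(x) dx`. -/
def fhat (f : Lp F 2 (volume : Measure R3)) : R3 → F := fun p =>
  (((2 * Real.pi) ^ (-(3 / 2) : ℝ) : ℝ) : ℂ) •
    (𝓕 f : Lp F 2 (volume : Measure R3)) ((2 * Real.pi)⁻¹ • p)

theorem memLp_fhat (f : Lp F 2 (volume : Measure R3)) : MemLp (fhat f) 2 volume := by
  have h0 : (2 * Real.pi)⁻¹ ≠ 0 := by positivity
  refine MemLp.const_smul ?_ _
  have hm : MeasurableEmbedding (fun p : R3 => (2 * Real.pi)⁻¹ • p) :=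
    (Homeomorph.smulOfNeZero _ h0).measurableEmbedding
  have h1 : MemLp (𝓕 f : Lp F 2 (volume : Measure R3)) 2
      (Measure.map (fun p : R3 => (2 * Real.pi)⁻¹ • p) volume) := by
    rw [Measure.map_addHaar_smul _ h0]
    exact (Lp.memLp _).smul_measure ENNReal.ofReal_ne_top
  exact hm.memLp_map_measure_iff.1 h1

end FourierTransform

/-! ### The one-photon space -/

/-- Infrared cutoff `σ` and ultraviolet cutoff `Λ`. -/
structure Cutoff where
  σ : ℝ
  Λ : ℝ
  σ_pos : 0 < σ
  σ_le_one : σ ≤ 1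
  one_le_Λ : 1 ≤ Λ

namespace Cutoff

variable (c : Cutoff)

/-- The momentum shell `S_{σ,Λ}`. -/
def shell : Set R3 := {k | c.σ ≤ ‖k‖ ∧ ‖k‖ < c.Λ}

theorem measurableSet_shell : MeasurableSet c.shell :=
  (measurableSet_le measurable_const measurable_norm).inter
    (measurableSet_lt measurable_norm measurable_const)

/-- Lebesgue measure on the momentum shell. -/
abbrev meas : Measure R3 := volume.restrict c.shell

instance : IsFiniteMeasure c.meas := by
  refine ⟨?_⟩
  rw [Measure.restrict_apply_univ]
  refine lt_of_le_of_lt (measure_mono (t := Metric.ball 0 c.Λ) fun k hk => ?_)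
    Metric.isBounded_ball.measure_lt_top
  simpa using hk.2

/-- The one-photon space: square-integrable divergence-free vector fields `f` on the momentum
shell, i.e. `k · f(k) = 0` for almost all `k`. -/
def photonSpace : Submodule ℂ (Lp C3 2 c.meas) where
  carrier := {f | ∀ᵐ k ∂c.meas, ∑ ν, (k ν : ℂ) * f k ν = 0}
  zero_mem' := by
    filter_upwards [Lp.coeFn_zero C3 2 c.meas] with k hk
    rw [hk]
    simp
  add_mem' := by
    intro f g hf hg
    filter_upwards [hf, hg, Lp.coeFn_add f g] with k h1 h2 h3
    simp only [h3, Pi.add_apply, PiLp.add_apply, mul_add, Finset.sum_add_distrib, h1, h2, add_zero]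
  smul_mem' := by
    intro z f hf
    filter_upwards [hf, Lp.coeFn_smul z f] with k h1 h2
    have : ∑ ν, (k ν : ℂ) * (z • f) k ν = z * ∑ ν, (k ν : ℂ) * f k ν := by
      rw [Finset.mul_sum]
      refine Finset.sum_congr rfl fun ν _ => ?_
      simp only [h2, Pi.smul_apply, PiLp.smul_apply, smul_eq_mul]
      ring
    rw [this, h1, mul_zero]

theorem isClosed_photonSpace : IsClosed (c.photonSpace : Set (Lp C3 2 c.meas)) := by
  refine IsSeqClosed.isClosed fun f g hf hg => ?_
  obtain ⟨s, -, hs⟩ := (tendstoInMeasure_of_tendsto_Lp hg).exists_seq_tendsto_ae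
  have h1 : ∀ᵐ k ∂c.meas, ∀ n, ∑ ν, (k ν : ℂ) * f n k ν = 0 := ae_all_iff.2 hf
  show ∀ᵐ k ∂c.meas, ∑ ν, (k ν : ℂ) * g k ν = 0
  filter_upwards [hs, h1] with k h2 h3
  have h4 : Filter.Tendsto (fun n => ∑ ν, (k ν : ℂ) * f (s n) k ν) Filter.atTop
      (nhds (∑ ν, (k ν : ℂ) * g k ν)) := by
    have hc : Continuous fun v : C3 => ∑ ν, (k ν : ℂ) * v ν := by fun_prop
    exact (hc.tendsto _).comp h2
  simp only [h3] at h4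
  exact (tendsto_nhds_unique h4 tendsto_const_nhds)

instance : CompleteSpace c.photonSpace := c.isClosed_photonSpace.completeSpace_coe

/-- The element of the one-photon space represented by a divergence-free vector field. -/
def mkPhoton (g : R3 → C3) (hg : MemLp g 2 c.meas) (h : ∀ᵐ k ∂c.meas, ∑ ν, (k ν : ℂ) * g k ν = 0) :
    c.photonSpace :=
  ⟨hg.toLp g, by
    filter_upwards [hg.coeFn_toLp, h] with k h1 h2
    rw [h1, h2]⟩

theorem coeFn_mkPhoton (g : R3 → C3) (hg : MemLp g 2 c.meas)
    (h : ∀ᵐ k ∂c.meas, ∑ ν, (k ν : ℂ) * g k ν = 0) : (c.mkPhoton g hg h).1 =ᵐ[c.meas] g :=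
  hg.coeFn_toLp

theorem photon_ext {f g : c.photonSpace} (h : f.1 =ᵐ[c.meas] g.1) : f = g :=
  Subtype.ext (Lp.ext h)

theorem coeFn_add (f g : c.photonSpace) : (f + g).1 =ᵐ[c.meas] fun k => f.1 k + g.1 k :=
  Lp.coeFn_add f.1 g.1

theorem coeFn_smul (z : ℂ) (f : c.photonSpace) : (z • f).1 =ᵐ[c.meas] fun k => z • f.1 k :=
  Lp.coeFn_smul z f.1

theorem memLp_mul {g : R3 → ℝ} (hg : Measurable g) {C : ℝ} (hC : ∀ k ∈ c.shell, |g k| ≤ C)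
    (f : c.photonSpace) : MemLp (fun k => (g k : ℂ) • f.1 k) 2 c.meas := by
  refine (Lp.memLp f.1).of_le_mul (c := C)
    ((Complex.measurable_ofReal.comp hg).aestronglyMeasurable.smul
      (Lp.aestronglyMeasurable f.1)) ?_
  filter_upwards [ae_restrict_mem c.measurableSet_shell] with k hk
  rw [norm_smul, Complex.norm_real, Real.norm_eq_abs]
  exact mul_le_mul_of_nonneg_right (hC k hk) (norm_nonneg _)

theorem transversal_mul (g : R3 → ℝ) (f : c.photonSpace) :
    ∀ᵐ k ∂c.meas, ∑ ν, (k ν : ℂ) * ((g k : ℂ) • f.1 k) ν = 0 := by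
  have h : ∀ᵐ k ∂c.meas, ∑ ν, (k ν : ℂ) * f.1 k ν = 0 := f.2
  filter_upwards [h] with k h2
  have : ∑ ν, (k ν : ℂ) * ((g k : ℂ) • f.1 k) ν = (g k : ℂ) * ∑ ν, (k ν : ℂ) * f.1 k ν := by
    rw [Finset.mul_sum]
    refine Finset.sum_congr rfl fun ν _ => ?_
    simp only [PiLp.smul_apply, smul_eq_mul]
    ring
  rw [this, h2, mul_zero]

/-- Multiplication by a measurable function of `k` that is bounded on the momentum shell. -/
def mulOp (g : R3 → ℝ) (hg : Measurable g) (C : ℝ) (hC : ∀ k ∈ c.shell, |g k| ≤ C) :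
    c.photonSpace →L[ℂ] c.photonSpace :=
  LinearMap.mkContinuous
    { toFun := fun f => c.mkPhoton _ (c.memLp_mul hg hC f) (c.transversal_mul g f)
      map_add' := fun f₁ f₂ => by
        refine c.photon_ext ?_
        filter_upwards [c.coeFn_mkPhoton _ (c.memLp_mul hg hC (f₁ + f₂))
            (c.transversal_mul g (f₁ + f₂)),
          c.coeFn_mkPhoton _ (c.memLp_mul hg hC f₁) (c.transversal_mul g f₁),
          c.coeFn_mkPhoton _ (c.memLp_mul hg hC f₂) (c.transversal_mul g f₂),
          c.coeFn_add f₁ f₂, c.coeFn_add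
            (c.mkPhoton _ (c.memLp_mul hg hC f₁) (c.transversal_mul g f₁))
            (c.mkPhoton _ (c.memLp_mul hg hC f₂) (c.transversal_mul g f₂))] with k h1 h2 h3 h4 h5
        exact h1.trans ((congrArg _ h4).trans ((smul_add _ _ _).trans
          ((congrArg₂ _ h2.symm h3.symm).trans h5.symm)))
      map_smul' := fun z f => by
        refine c.photon_ext ?_
        filter_upwards [c.coeFn_mkPhoton _ (c.memLp_mul hg hC (z • f))
            (c.transversal_mul g (z • f)),
          c.coeFn_mkPhoton _ (c.memLp_mul hg hC f) (c.transversal_mul g f),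
          c.coeFn_smul z f, c.coeFn_smul z
            (c.mkPhoton _ (c.memLp_mul hg hC f) (c.transversal_mul g f))] with k h1 h2 h4 h5
        exact h1.trans ((congrArg _ h4).trans ((smul_comm _ _ _).trans
          ((congrArg _ h2.symm).trans h5.symm))) }
    C (fun f => by
      refine Lp.norm_le_mul_norm_of_ae_le_mul ?_
      filter_upwards [c.coeFn_mkPhoton _ (c.memLp_mul hg hC f) (c.transversal_mul g f),
        ae_restrict_mem c.measurableSet_shell] with k h1 hk
      refine (le_of_eq (congrArg norm h1)).trans ?_
      rw [norm_smul, Complex.norm_real, Real.norm_eq_abs]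
      exact mul_le_mul_of_nonneg_right (hC k hk) (norm_nonneg _))

theorem rpow_bound (s : ℝ) (k : R3) (hk : k ∈ c.shell) :
    |‖k‖ ^ s| ≤ c.σ ^ s + c.Λ ^ s := by
  have h1 : 0 < ‖k‖ := c.σ_pos.trans_le hk.1
  have h2 : 0 < c.Λ := one_pos.trans_le c.one_le_Λ
  have h3 := (Real.rpow_pos_of_pos c.σ_pos s).le
  have h4 := (Real.rpow_pos_of_pos h2 s).le
  rw [abs_of_pos (Real.rpow_pos_of_pos h1 s)]
  rcases le_total 0 s with hs | hs
  · have := Real.rpow_le_rpow h1.le hk.2.le hs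
    linarith
  · have := Real.rpow_le_rpow_of_nonpos c.σ_pos hk.1 hs
    linarith

/-- The multiplication operator `|k|^s` on the one-photon space. -/
def absPow (s : ℝ) : c.photonSpace →L[ℂ] c.photonSpace :=
  c.mulOp (fun k => ‖k‖ ^ s) (measurable_norm.pow_const s) _ (c.rpow_bound s)

/-- Complex conjugation on `ℂ³`. -/
def conj3 (v : C3) : C3 := WithLp.toLp 2 fun ν => conj (v ν)

theorem norm_conj3 (v : C3) : ‖conj3 v‖ = ‖v‖ := by
  simp [conj3, EuclideanSpace.norm_eq]

theorem continuous_conj3 : Continuous conj3 := by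
  unfold conj3
  exact (PiLp.continuous_toLp 2 _).comp
    (continuous_pi fun ν => Complex.continuous_conj.comp (by fun_prop))

theorem measurePreserving_neg_shell : MeasurePreserving (fun k : R3 => -k) c.meas c.meas := by
  have h := (Measure.measurePreserving_neg (volume : Measure R3)).restrict_preimage
    c.measurableSet_shell
  have e : (Neg.neg : R3 → R3) ⁻¹' c.shell = c.shell := by
    ext k; simp [shell]
  rw [e] at h
  exact h

theorem memLp_J (f : c.photonSpace) : MemLp (fun k => conj3 (f.1 (-k))) 2 c.meas := by
  have h1 : MemLp (fun k => f.1 (-k)) 2 c.meas :=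
    (Lp.memLp f.1).comp_measurePreserving c.measurePreserving_neg_shell
  refine h1.of_le (continuous_conj3.comp_aestronglyMeasurable h1.1) ?_
  exact Filter.Eventually.of_forall fun k => (norm_conj3 _).le

/-- The antiunitary involution `(J f)(k) = conj (f (-k))` of the one-photon space. -/
def J (f : c.photonSpace) : c.photonSpace :=
  c.mkPhoton (fun k => conj3 (f.1 (-k))) (c.memLp_J f) <| by
    have h2 : ∀ᵐ k ∂c.meas, ∑ ν, ((-k) ν : ℂ) * f.1 (-k) ν = 0 :=
      c.measurePreserving_neg_shell.quasiMeasurePreserving.ae f.2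
    filter_upwards [h2] with k h3
    have h4 : conj (∑ ν, ((-k) ν : ℂ) * f.1 (-k) ν) =
        -∑ ν, (k ν : ℂ) * conj3 (f.1 (-k)) ν := by
      rw [map_sum, ← Finset.sum_neg_distrib]
      refine Finset.sum_congr rfl fun ν _ => ?_
      simp [conj3]
    rw [h3, map_zero] at h4
    exact neg_eq_zero.1 h4.symm

/-- The function `k ↦ m_μ(x, k)` with components
`m_{μ,ν}(x, k) = (2π)^{-3/2} |k|^{-1/2} (δ_{μν} - k_μ k_ν / |k|²) e^{-i k·x}`. -/
def modeFun (x : R3) (μ : Fin 3) (k : R3) : C3 :=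
  WithLp.toLp 2 fun ν =>
    (((2 * Real.pi) ^ (-(3 / 2) : ℝ) * ‖k‖ ^ (-(1 / 2) : ℝ) *
      ((if μ = ν then 1 else 0) - k μ * k ν / ‖k‖ ^ 2) : ℝ) : ℂ) *
    Complex.exp (-Complex.I * (⟪k, x⟫_ℝ : ℂ))

theorem memLp_modeFun (x : R3) (μ : Fin 3) : MemLp (modeFun x μ) 2 c.meas := by
  have hmeas : Measurable (modeFun x μ) := by
    refine (PiLp.continuous_toLp 2 _).measurable.comp (measurable_pi_lambda _ fun ν => ?_)
    have h1 : ∀ i : Fin 3, Measurable fun k : R3 => k i := fun i =>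
      Continuous.measurable (by fun_prop)
    have h2 : Measurable fun k : R3 => ⟪k, x⟫_ℝ := Continuous.measurable (by fun_prop)
    have h3 := h1 μ
    have h4 := h1 ν
    fun_prop
  refine MemLp.of_bound hmeas.aestronglyMeasurable
    (Real.sqrt (∑ _ν : Fin 3, ((2 * Real.pi) ^ (-(3 / 2) : ℝ) *
      (c.σ ^ (-(1 / 2) : ℝ) + c.Λ ^ (-(1 / 2) : ℝ)) * 2) ^ 2)) ?_
  filter_upwards [ae_restrict_mem c.measurableSet_shell] with k hk
  rw [EuclideanSpace.norm_eq]
  refine Real.sqrt_le_sqrt (Finset.sum_le_sum fun ν _ => ?_)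
  have hk0 : 0 < ‖k‖ := c.σ_pos.trans_le hk.1
  have e1 : ‖Complex.exp (-Complex.I * (⟪k, x⟫_ℝ : ℂ))‖ = 1 := by
    rw [Complex.norm_exp]; simp
  have e2 : ∀ i : Fin 3, |k i| ≤ ‖k‖ := fun i => PiLp.norm_apply_le k i
  have e3 : |k μ * k ν / ‖k‖ ^ 2| ≤ 1 := by
    rw [abs_div, abs_mul, abs_of_pos (pow_pos hk0 2), div_le_one (pow_pos hk0 2), sq]
    exact mul_le_mul (e2 μ) (e2 ν) (abs_nonneg _) hk0.le
  have e4 : |(if μ = ν then (1 : ℝ) else 0) - k μ * k ν / ‖k‖ ^ 2| ≤ 2 := by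
    refine (abs_sub _ _).trans ?_
    have : |if μ = ν then (1 : ℝ) else 0| ≤ 1 := by split_ifs <;> simp
    linarith
  have e5 := c.rpow_bound (-(1 / 2)) k hk
  have e6 : 0 ≤ (2 * Real.pi) ^ (-(3 / 2) : ℝ) := by positivity
  show ‖_ * Complex.exp (-Complex.I * (⟪k, x⟫_ℝ : ℂ))‖ ^ 2 ≤ _
  rw [norm_mul, e1, mul_one, Complex.norm_real, Real.norm_eq_abs, abs_mul, abs_mul,
    abs_of_nonneg e6]
  have e7 := (abs_nonneg _).trans e5
  exact pow_le_pow_left₀ (by positivity) (mul_le_mul (mul_le_mul_of_nonneg_left e5 e6) e4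
    (abs_nonneg _) (mul_nonneg e6 e7)) 2

/-- The coupling function `m_μ(x)` as an element of the one-photon space. -/
def mode (x : R3) (μ : Fin 3) : c.photonSpace :=
  c.mkPhoton (modeFun x μ) (c.memLp_modeFun x μ) <| by
    filter_upwards [ae_restrict_mem c.measurableSet_shell] with k hk
    have hk0 : ‖k‖ ^ 2 ≠ 0 := (pow_pos (c.σ_pos.trans_le hk.1) 2).ne'
    have hk1 : ‖k‖ ^ 2 = ∑ ν, k ν ^ 2 := EuclideanSpace.real_norm_sq_eq k
    have e1 : ∑ ν, k ν * ((if μ = ν then (1 : ℝ) else 0) - k μ * k ν / ‖k‖ ^ 2) = 0 := by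
      simp only [mul_sub, Finset.sum_sub_distrib, mul_ite, mul_one, mul_zero,
        Finset.sum_ite_eq, Finset.mem_univ, if_true]
      have : ∑ ν, k ν * (k μ * k ν / ‖k‖ ^ 2) = k μ * (∑ ν, k ν ^ 2) / ‖k‖ ^ 2 := by
        rw [Finset.mul_sum, Finset.sum_div]
        exact Finset.sum_congr rfl fun ν _ => by ring
      rw [this, ← hk1, mul_div_assoc, div_self hk0, mul_one, sub_self]
    have e2 : ∑ ν, (k ν : ℂ) * modeFun x μ k ν =
        (((2 * Real.pi) ^ (-(3 / 2) : ℝ) * ‖k‖ ^ (-(1 / 2) : ℝ) : ℝ) : ℂ) *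
        Complex.exp (-Complex.I * (⟪k, x⟫_ℝ : ℂ)) *
        ((∑ ν, k ν * ((if μ = ν then (1 : ℝ) else 0) - k μ * k ν / ‖k‖ ^ 2) : ℝ) : ℂ) := by
      rw [Complex.ofReal_sum, Finset.mul_sum]
      refine Finset.sum_congr rfl fun ν _ => ?_
      simp only [modeFun, Complex.ofReal_mul]
      ring
    rw [e2, e1, Complex.ofReal_zero, mul_zero]

/-- The convolution integral `(Φ_{r,α} f)(p) = α^{1/2} (2π)^{-3/2} ∫ r̂(p - k) f(k) dk`. -/
def convFun (α : ℝ) (r : Lp ℂ 2 (volume : Measure R3)) (f : c.photonSpace) (p : R3) : C3 :=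
  ((Real.sqrt α * (2 * Real.pi) ^ (-(3 / 2) : ℝ) : ℝ) : ℂ) •
    ∫ k in c.shell, fhat r (p - k) • f.1 k

theorem aestronglyMeasurable_fhat_sub (r : Lp ℂ 2 (volume : Measure R3)) (p : R3) :
    AEStronglyMeasurable (fun k => fhat r (p - k)) c.meas :=
  ((memLp_fhat r).1.comp_quasiMeasurePreserving
    (Measure.measurePreserving_sub_left volume p).quasiMeasurePreserving).restrict

theorem memLp_fhat_sub (r : Lp ℂ 2 (volume : Measure R3)) (p : R3) :
    MemLp (fun k => fhat r (p - k)) 2 c.meas :=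
  ((memLp_fhat r).comp_measurePreserving (Measure.measurePreserving_sub_left volume p)).restrict _

theorem integrable_conv (r : Lp ℂ 2 (volume : Measure R3)) (f : c.photonSpace) (p : R3) :
    Integrable (fun k => fhat r (p - k) • f.1 k) c.meas :=
  memLp_one_iff_integrable.1 ((Lp.memLp f.1).smul (c.memLp_fhat_sub r p))

theorem aestronglyMeasurable_convFun (α : ℝ) (r : Lp ℂ 2 (volume : Measure R3))
    (f : c.photonSpace) : AEStronglyMeasurable (c.convFun α r f) volume := by
  have h1 : AEStronglyMeasurable (fun z : R3 × R3 => fhat r (z.1 - z.2)) (volume.prod c.meas) :=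
    (memLp_fhat r).1.comp_quasiMeasurePreserving
      (quasiMeasurePreserving_sub_of_right_invariant volume c.meas)
  have h2 : AEStronglyMeasurable (fun p => ∫ k in c.shell, fhat r (p - k) • f.1 k) volume :=
    (h1.smul (Lp.aestronglyMeasurable f.1).comp_snd).integral_prod_right'
  exact h2.const_smul ((Real.sqrt α * (2 * Real.pi) ^ (-(3 / 2) : ℝ) : ℝ) : ℂ)

theorem lintegral_convFun_le (α : ℝ) (r : Lp ℂ 2 (volume : Measure R3)) (f : c.photonSpace) :
    ∫⁻ p, ‖c.convFun α r f p‖ₑ ^ (2 : ℝ) ≤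
      (‖((Real.sqrt α * (2 * Real.pi) ^ (-(3 / 2) : ℝ) : ℝ) : ℂ)‖ₑ ^ (2 : ℝ) *
        ((∫⁻ p, ‖fhat r p‖ₑ ^ (2 : ℝ)) * c.meas Set.univ)) *
      ∫⁻ k, ‖f.1 k‖ₑ ^ (2 : ℝ) ∂c.meas := by
  have h1 : ∀ p, ‖c.convFun α r f p‖ₑ ^ (2 : ℝ) ≤
      ‖((Real.sqrt α * (2 * Real.pi) ^ (-(3 / 2) : ℝ) : ℝ) : ℂ)‖ₑ ^ (2 : ℝ) *
      ((∫⁻ k, ‖fhat r (p - k)‖ₑ ^ (2 : ℝ) ∂c.meas) * ∫⁻ k, ‖f.1 k‖ₑ ^ (2 : ℝ) ∂c.meas) := by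
    intro p
    rw [convFun, enorm_smul, ENNReal.mul_rpow_of_nonneg _ _ (by norm_num)]
    gcongr
    have h2 : ‖∫ k in c.shell, fhat r (p - k) • f.1 k‖ₑ ≤
        ∫⁻ k, ((fun k => ‖fhat r (p - k)‖ₑ) * fun k => ‖f.1 k‖ₑ) k ∂c.meas := by
      refine (enorm_integral_le_lintegral_enorm _).trans (le_of_eq ?_)
      refine lintegral_congr fun k => ?_
      rw [enorm_smul]; rfl
    have h3 := ENNReal.lintegral_mul_le_Lp_mul_Lq c.meas Real.HolderConjugate.two_two
      (c.aestronglyMeasurable_fhat_sub r p).enorm (Lp.aestronglyMeasurable f.1).enorm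
    calc _ ≤ _ := ENNReal.rpow_le_rpow (h2.trans h3) (by norm_num)
      _ = _ := by
        rw [ENNReal.mul_rpow_of_nonneg _ _ (by norm_num), ← ENNReal.rpow_mul,
          ← ENNReal.rpow_mul]
        norm_num
  refine (lintegral_mono h1).trans ?_
  have hfin : ‖((Real.sqrt α * (2 * Real.pi) ^ (-(3 / 2) : ℝ) : ℝ) : ℂ)‖ₑ ^ (2 : ℝ) ≠ ⊤ :=
    ENNReal.rpow_ne_top_of_nonneg (by norm_num) enorm_ne_top
  have h5 : AEMeasurable (fun z : R3 × R3 => ‖fhat r (z.1 - z.2)‖ₑ ^ (2 : ℝ))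
      (volume.prod c.meas) :=
    (((memLp_fhat r).1.comp_quasiMeasurePreserving
      (quasiMeasurePreserving_sub_of_right_invariant volume c.meas)).enorm).pow_const _
  have h6 : ∫⁻ p, ∫⁻ k, ‖fhat r (p - k)‖ₑ ^ (2 : ℝ) ∂c.meas =
      (∫⁻ p, ‖fhat r p‖ₑ ^ (2 : ℝ)) * c.meas Set.univ := by
    rw [lintegral_lintegral_swap h5]
    have : ∀ k : R3, ∫⁻ p, ‖fhat r (p - k)‖ₑ ^ (2 : ℝ) = ∫⁻ p, ‖fhat r p‖ₑ ^ (2 : ℝ) :=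
      fun k => lintegral_sub_right_eq_self (fun p => ‖fhat r p‖ₑ ^ (2 : ℝ)) k
    simp only [this, lintegral_const]
  have h7 : AEMeasurable (fun p => ∫⁻ k, ‖fhat r (p - k)‖ₑ ^ (2 : ℝ) ∂c.meas) volume :=
    h5.lintegral_prod_right'
  rw [lintegral_const_mul' _ _ hfin, lintegral_mul_const'' _ h7, h6, ← mul_assoc]

theorem eLpNorm_convFun_le (α : ℝ) (r : Lp ℂ 2 (volume : Measure R3)) :
    ∃ K : NNReal, ∀ f : c.photonSpace,
      eLpNorm (c.convFun α r f) 2 volume ≤ K * eLpNorm f.1 2 c.meas := by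
  have hr := (memLp_fhat r).2
  have hA : ‖((Real.sqrt α * (2 * Real.pi) ^ (-(3 / 2) : ℝ) : ℝ) : ℂ)‖ₑ ^ (2 : ℝ) *
        ((∫⁻ p, ‖fhat r p‖ₑ ^ (2 : ℝ)) * c.meas Set.univ) ≠ ⊤ := by
    refine ENNReal.mul_ne_top (ENNReal.rpow_ne_top_of_nonneg (by norm_num) enorm_ne_top)
      (ENNReal.mul_ne_top ?_ (measure_ne_top _ _))
    have := (eLpNorm_lt_top_iff_lintegral_rpow_enorm_lt_top (by norm_num) (by norm_num)).1 hr
    simpa using this.ne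
  obtain ⟨A, hA'⟩ : ∃ A : NNReal, (A : ENNReal) = _ := ⟨_, ENNReal.coe_toNNReal hA⟩
  refine ⟨A ^ (1 / 2 : ℝ), fun f => ?_⟩
  have h := c.lintegral_convFun_le α r f
  rw [← hA'] at h
  rw [eLpNorm_eq_lintegral_rpow_enorm_toReal (by norm_num) (by norm_num),
    eLpNorm_eq_lintegral_rpow_enorm_toReal (by norm_num) (by norm_num)]
  simp only [ENNReal.toReal_ofNat]
  rw [ENNReal.coe_rpow_of_nonneg _ (by norm_num),
    ← ENNReal.mul_rpow_of_nonneg _ _ (by norm_num)]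
  exact ENNReal.rpow_le_rpow h (by norm_num)

theorem memLp_convFun (α : ℝ) (r : Lp ℂ 2 (volume : Measure R3)) (f : c.photonSpace) :
    MemLp (c.convFun α r f) 2 volume := by
  obtain ⟨K, hK⟩ := c.eLpNorm_convFun_le α r
  exact ⟨c.aestronglyMeasurable_convFun α r f,
    (hK f).trans_lt (ENNReal.mul_lt_top ENNReal.coe_lt_top (Lp.memLp f.1).2)⟩

theorem convFun_add (α : ℝ) (r : Lp ℂ 2 (volume : Measure R3)) (f g : c.photonSpace) :
    c.convFun α r (f + g) = c.convFun α r f + c.convFun α r g := by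
  funext p
  simp only [convFun, Pi.add_apply]
  rw [← smul_add, ← integral_add (c.integrable_conv r f p) (c.integrable_conv r g p)]
  congr 1
  refine integral_congr_ae ?_
  filter_upwards [Lp.coeFn_add f.1 g.1] with k hk
  rw [← smul_add]
  exact congrArg _ hk

theorem convFun_smul (α : ℝ) (r : Lp ℂ 2 (volume : Measure R3)) (z : ℂ) (f : c.photonSpace) :
    c.convFun α r (z • f) = z • c.convFun α r f := by
  funext p
  simp only [convFun, Pi.smul_apply]
  rw [smul_comm z, ← integral_smul z]
  congr 1
  refine integral_congr_ae ?_
  filter_upwards [Lp.coeFn_smul z f.1] with k hk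
  show _ = z • fhat r (p - k) • f.1 k
  rw [smul_comm]
  exact congrArg _ hk

/-- The bounded operator `Φ_{r,α} = (r̂ *) P_C χ_{σ,Λ}`, with integral kernel
`α^{1/2} (2π)^{-3/2} r̂(p - k) P_k^⊥ χ_{σ,Λ}(k)`, from the one-photon space to `L²(ℝ³; ℂ³)`; here
`P_k^⊥` and `χ_{σ,Λ}` act as the identity on the one-photon space. -/
def Phi (α : ℝ) (r : Lp ℂ 2 (volume : Measure R3)) :
    c.photonSpace →L[ℂ] Lp C3 2 (volume : Measure R3) :=
  LinearMap.mkContinuousOfExistsBound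
    { toFun := fun f => (c.memLp_convFun α r f).toLp _
      map_add' := fun f g => by
        rw [← MemLp.toLp_add]
        exact MemLp.toLp_congr _ _ (by rw [convFun_add])
      map_smul' := fun z f => by
        rw [RingHom.id_apply, ← MemLp.toLp_const_smul]
        exact MemLp.toLp_congr _ _ (by rw [convFun_smul]) }
    (by
      obtain ⟨K, hK⟩ := c.eLpNorm_convFun_le α r
      refine ⟨K, fun f => ?_⟩
      show ‖(c.memLp_convFun α r f).toLp _‖ ≤ K * ‖f.1‖
      rw [Lp.norm_toLp, Lp.norm_def]
      have := ENNReal.toReal_mono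
        (ENNReal.mul_ne_top ENNReal.coe_ne_top (Lp.memLp f.1).2.ne) (hK f)
      simpa using this)

/-- The operator `Θ_{r,α} = Φ_{r,α}^* Φ_{r,α}` on the one-photon space. -/
def Theta (α : ℝ) (r : Lp ℂ 2 (volume : Measure R3)) : c.photonSpace →L[ℂ] c.photonSpace :=
  (c.Phi α r).adjoint ∘L c.Phi α r

/-- The operator `T_{r,α} = |k|^{-1/2} (2|k|² + Θ, Θ; Θ, Θ) |k|^{-1/2}` with `Θ = Θ_{r,α}`. -/
def T (α : ℝ) (r : Lp ℂ 2 (volume : Measure R3)) :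
    WithLp 2 (c.photonSpace × c.photonSpace) →L[ℂ] WithLp 2 (c.photonSpace × c.photonSpace) :=
  blockOp (c.absPow (-(1 / 2))) 0 0 (c.absPow (-(1 / 2))) ∘L
    blockOp ((2 : ℂ) • c.absPow 2 + c.Theta α r) (c.Theta α r) (c.Theta α r) (c.Theta α r) ∘L
    blockOp (c.absPow (-(1 / 2))) 0 0 (c.absPow (-(1 / 2)))

/-- The vector `y = |k|^{-1/2} Φ_{r,α}^* ŵ` of the one-photon space; for `w = r ∇γ` this is
`y_{r,γ,α}`. -/
def yVec (α : ℝ) (r : Lp ℂ 2 (volume : Measure R3)) (w : Lp C3 2 (volume : Measure R3)) :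
    c.photonSpace :=
  c.absPow (-(1 / 2)) ((c.Phi α r).adjoint ((memLp_fhat w).toLp (fhat w)))

/-! ### The Lieb-Loss functional -/

variable {ι : Type*} (b : HilbertBasis ι ℂ c.photonSpace)

/-- The component `A_μ(x) = a^*(m_μ(x)) + a(m_μ(x))` of the quantized vector potential. -/
def vecPot (x : R3) (μ : Fin 3) (ψ : numDom ι) : Fock ι := field b (c.mode x μ) ψ

/-- The Lieb-Loss functional, i.e. the quadratic form
`⟨φ ⊗ ψ, H (φ ⊗ ψ)⟩ = ½ ‖(i∇ + √α A(x)) (φ ⊗ ψ)‖² + ‖φ‖² ⟨ψ, dΓ(|k|) ψ⟩`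
of the Pauli-Fierz Hamiltonian `H = ½ (i∇ + √α A(x))² + dΓ(|k|)` at a product vector, where
`L²(ℝ³) ⊗ 𝔉` is identified with `L²(ℝ³; 𝔉)`. -/
def energy (α : ℝ) (φ : R3 → ℂ) (ψ : numDom ι) : ℝ :=
  (1 / 2) * (∫ x, ∑ μ, ‖(Complex.I * weakGrad φ x μ) • ψ.1 +
    ((Real.sqrt α : ℂ) * φ x) • c.vecPot b x μ ψ‖ ^ 2) +
  (∫ x, ‖φ x‖ ^ 2) * secondQuantForm b (c.absPow 1) ψ

/-- The energy minimized over all normalized photon states in `D(N^{1/2})`. -/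
def minEnergy (α : ℝ) (φ : R3 → ℂ) : ℝ :=
  sInf {E | ∃ ψ : numDom ι, ‖ψ.1‖ = 1 ∧ E = c.energy b α φ ψ}

end Cutoff

end LiebLoss

end

open LiebLoss

open MeasureTheory FourierTransform
open scoped InnerProductSpace ComplexConjugate ENNReal

noncomputable section

namespace LiebLoss

/-! ### Creation and annihilation operators on the form domain of the number operator -/

section FockBasics

variable {ι : Type*} {H : Type*} [NormedAddCommGroup H] [InnerProductSpace ℂ H]

/-! Write φ = r e^{iγ} and w = r∇γ. Multiplication by the phase e^{-iγ} turns (i∇ + √α A)(φ ⊗ ψ)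
pointwise into i∇r ψ + (√α r A − w)ψ. Field operators are symmetric, so the real part of the inner
product of the two summands vanishes. The energy splits into ½‖∇r‖² and ½(⟨dΓ(2|k|)⟩ + ∫ Σ_μ ‖(√α r
A_μ − w_μ)ψ‖² dx). Expanding the square yields ½(dΓ_J[T,−y] + ‖w‖²) (`le_energy`); for φ = r it
yields exactly ½ dΓ_J[T,0] (`energy_absFn`). Where φ = 0 there is no phase, but there the terms kept
on the smaller side vanish, so an inequality survives.

The algebra rests on one structural fact. Put v_{x,μ} = √α r(x) m_μ(x). By Plancherel, Φ|k|^{-1/2}g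
is the Fourier transform of the field x ↦ (⟨v_{x,μ}, g⟩)_μ (`convFun_ae_eq`). Hence T = 2|k| ⊕ 0 + ∫
Σ_μ |q(v)⟩⟨q(v)| dx and y = ∫ Σ_μ w_μ v_{x,μ} dx (`isFormKernel`, `inner_yVec_eq`). Since A_J(q(v))
is the field operator A(v), the double series defining dΓ_J[T,0] sums to dΓ(2|k|) + ∫ Σ_μ A(v)² dx
(`hasSum_tsum_quadTerm`).

A Weyl transformation adds constants to all fields, so it removes the linear term and leaves a
number (`fieldForm_shift`). For real η the requirement is Mη = y with M = |k| + 2∫ Σ_μ |v⟩⟨v| dx;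
the infrared cutoff gives M ≥ σ, so M is invertible, and M commutes with J (`existsUnique_shift`).
The number left over is 2⟨η,y⟩ ≤ ‖w‖², which follows from ∫ Σ_μ (2⟨v,η⟩ − w_μ)² dx ≥ 0
(`re_inner_shift_le`). Applied to −y, this loss is covered exactly by the ‖w‖² gained from
completing the square, which gives the energy comparison for every ψ and then for the infima.

For the spectral statement the form is transported by (N+1)^{-1/2} to a bounded form on Fock space.
The bound 2|k| ≥ 2σ makes it coercive after adding the squared norm, so a Lax–Milgram resolvent
exists, the operator is self-adjoint and the bottom of its spectrum is the infimum of the form on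
D(N^{1/2}) (`IsFormOperator`). Weyl transformations are built from exponential vectors, on which
annihilation and displacement are both explicit. That |φ| lies in H¹ with gradient Re(conj φ ∇φ)/|φ|
follows from the chain rule for mollifications. -/

theorem hasSum_congr {κ E : Type*} [AddCommMonoid E] [TopologicalSpace E] {f g : κ → E} {a : E}
    (h : ∀ i, f i = g i) : HasSum f a ↔ HasSum g a := by
  rw [funext h]

/-- The expected particle number `⟨ψ, N ψ⟩`. -/
def numExp (ψ : numDom ι) : ℝ := ∑' n : ι →₀ ℕ, (n.degree : ℝ) * ‖ψ.1 n‖ ^ 2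

theorem hasSum_numExp (ψ : numDom ι) :
    HasSum (fun n : ι →₀ ℕ => (n.degree : ℝ) * ‖ψ.1 n‖ ^ 2) (numExp ψ) :=
  Summable.hasSum ψ.2

theorem numExp_nonneg (ψ : numDom ι) : 0 ≤ numExp ψ := tsum_nonneg fun n => by positivity

theorem hasSum_lp_norm_sq {κ : Type*} (x : lp (fun _ : κ => ℂ) 2) :
    HasSum (fun i => ‖x i‖ ^ 2) (‖x‖ ^ 2) := by
  have h := lp.hasSum_norm (p := 2) (by norm_num) x
  simpa using h

theorem Fock.hasSum_norm_sq (ψ : Fock ι) : HasSum (fun n => ‖ψ n‖ ^ 2) (‖ψ‖ ^ 2) :=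
  hasSum_lp_norm_sq ψ

/-- The map (n, i) ↦ (n + e_i, i) is a bijection onto the pairs with n i ≠ 0, and K vanishes on all
other pairs. This reindexing passes between the sums of a creation and of an annihilation operator.
-/
theorem hasSum_of_support_add_single {E : Type*} [AddCommMonoid E] [TopologicalSpace E]
    {K : (ι →₀ ℕ) × ι → E} (hK : ∀ n i, n i = 0 → K (n, i) = 0) (s : E) :
    HasSum (fun p : (ι →₀ ℕ) × ι => K (p.1 + Finsupp.single p.2 1, p.2)) s ↔ HasSum K s := by
  refine Finsupp_add_single_injective.hasSum_iff (f := K) ?_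
  rintro ⟨n, i⟩ hp
  by_contra hne
  apply hp
  have hni : n i ≠ 0 := fun h0 => hne (hK n i h0)
  refine ⟨(n - Finsupp.single i 1, i), ?_⟩
  simp only [Prod.mk.injEq, and_true]
  ext j
  by_cases hj : j = i
  · subst hj; simp; omega
  · simp [Ne.symm hj]

/-- After reindexing, both sums are the sum of n_i F(n) over pairs, whose fibre over n adds up to
the degree. Nonnegativity gives the converse direction; the forward one is later used to prove
membership in D(N^{1/2}). -/
theorem hasSum_single_mul_sq_iff {F : (ι →₀ ℕ) → ℝ} (hF : ∀ n, 0 ≤ F n) (s : ℝ) :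
    HasSum (fun p : (ι →₀ ℕ) × ι => ((p.1 p.2 : ℝ) + 1) * F (p.1 + Finsupp.single p.2 1)) s ↔
      HasSum (fun n : ι →₀ ℕ => (n.degree : ℝ) * F n) s := by
  have key : ∀ n : ι →₀ ℕ, HasSum (fun i => (n i : ℝ) * F n) ((n.degree : ℝ) * F n) := by
    intro n
    have h : ((n.degree : ℝ) * F n) = ∑ i ∈ n.support, (n i : ℝ) * F n := by
      rw [Finsupp.degree_apply, Nat.cast_sum, Finset.sum_mul]
    rw [h]
    exact hasSum_sum_of_ne_finset_zero fun i hi => by simp [Finsupp.notMem_support_iff.1 hi]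
  have e1 := hasSum_of_support_add_single (K := fun p : (ι →₀ ℕ) × ι => (p.1 p.2 : ℝ) * F p.1)
    (fun n i h => by simp [h]) s
  simp only [Finsupp.coe_add, Pi.add_apply, Finsupp.single_eq_same, Nat.cast_add,
    Nat.cast_one] at e1
  rw [e1]
  refine ⟨fun h => h.prod_fiberwise key, fun h => ?_⟩
  have hs : Summable fun p : (ι →₀ ℕ) × ι => (p.1 p.2 : ℝ) * F p.1 := by
    refine (summable_prod_of_nonneg fun p => mul_nonneg (by positivity) (hF _)).2
      ⟨fun n => (key n).summable, ?_⟩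
    refine h.summable.congr fun n => ?_
    rw [(key n).tsum_eq]
  have := (hs.hasSum.prod_fiberwise key).unique h
  rw [← this]
  exact hs.hasSum

theorem hasSum_numExp_shift (ψ : numDom ι) : HasSum (fun p : (ι →₀ ℕ) × ι =>
    ((p.1 p.2 : ℝ) + 1) * ‖ψ.1 (p.1 + Finsupp.single p.2 1)‖ ^ 2) (numExp ψ) :=
  (hasSum_single_mul_sq_iff (F := fun n => ‖ψ.1 n‖ ^ 2) (fun n => by positivity) _).2
    (hasSum_numExp ψ)

theorem norm_sqrt_mul_sq (m : ℕ) (z : ℂ) :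
    ‖(Real.sqrt (m + 1) : ℂ) * z‖ ^ 2 = ((m : ℝ) + 1) * ‖z‖ ^ 2 := by
  rw [norm_mul, mul_pow, Complex.norm_real, Real.norm_eq_abs, sq_abs,
    Real.sq_sqrt (by positivity)]

/-- The coefficients of `annVec`. -/
def annCoeff (ψ : numDom ι) (n : ι →₀ ℕ) : lp (fun _ : ι => ℂ) 2 :=
  ⟨fun i => (Real.sqrt (n i + 1) : ℂ) * ψ.1 (n + Finsupp.single i 1), by
    refine memℓp_gen ?_
    have := (numDom.summable_add ψ).prod_factor n
    simpa only [ENNReal.toReal_ofNat, Real.rpow_ofNat, norm_sqrt_mul_sq] using this⟩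

/-- The vector `∑_i (a(e_i) ψ)(n) e_i`, so that `(a(f) ψ)(n) = ⟨f, annVec b ψ n⟩`. -/
def annVec (b : HilbertBasis ι ℂ H) (ψ : numDom ι) (n : ι →₀ ℕ) : H :=
  b.repr.symm (annCoeff ψ n)

theorem annVec_add (b : HilbertBasis ι ℂ H) (ψ χ : numDom ι) (n : ι →₀ ℕ) :
    annVec b (ψ + χ) n = annVec b ψ n + annVec b χ n := by
  unfold annVec
  rw [← map_add]
  congr 1
  ext i
  exact mul_add _ _ _

theorem annVec_smul (b : HilbertBasis ι ℂ H) (z : ℂ) (ψ : numDom ι) (n : ι →₀ ℕ) :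
    annVec b (z • ψ) n = z • annVec b ψ n := by
  unfold annVec
  rw [← map_smul]
  congr 1
  ext i
  exact mul_left_comm _ _ _

/-- All dependence on f sits in one inner product, so linearity and norm bounds for a(f) reduce to
one-particle Hilbert space facts. -/
theorem annihilate_apply (b : HilbertBasis ι ℂ H) (f : H) (ψ : numDom ι) (n : ι →₀ ℕ) :
    annihilate b f ψ n = ⟪f, annVec b ψ n⟫_ℂ := by
  rw [← b.repr.inner_map_map, annVec, LinearIsometryEquiv.apply_symm_apply, lp.inner_eq_tsum]
  refine tsum_congr fun i => ?_
  rw [RCLike.inner_apply]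
  exact mul_comm _ _

theorem norm_annVec_sq (b : HilbertBasis ι ℂ H) (ψ : numDom ι) (n : ι →₀ ℕ) :
    HasSum (fun i => ((n i : ℝ) + 1) * ‖ψ.1 (n + Finsupp.single i 1)‖ ^ 2)
      (‖annVec b ψ n‖ ^ 2) := by
  rw [annVec, LinearIsometryEquiv.norm_map]
  exact (hasSum_congr fun i => norm_sqrt_mul_sq _ _).1 (hasSum_lp_norm_sq (annCoeff ψ n))

theorem hasSum_norm_annVec_sq (b : HilbertBasis ι ℂ H) (ψ : numDom ι) :
    HasSum (fun n => ‖annVec b ψ n‖ ^ 2) (numExp ψ) :=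
  (hasSum_numExp_shift ψ).prod_fiberwise fun n => norm_annVec_sq b ψ n

theorem norm_annihilate_sq_le (b : HilbertBasis ι ℂ H) (f : H) (ψ : numDom ι) :
    ‖annihilate b f ψ‖ ^ 2 ≤ ‖f‖ ^ 2 * numExp ψ := by
  refine hasSum_le (fun n => ?_) (Fock.hasSum_norm_sq _)
    ((hasSum_norm_annVec_sq b ψ).mul_left (‖f‖ ^ 2))
  rw [annihilate_apply, ← mul_pow]
  gcongr
  exact norm_inner_le_norm _ _

theorem annihilate_add_left (b : HilbertBasis ι ℂ H) (f g : H) (ψ : numDom ι) :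
    annihilate b (f + g) ψ = annihilate b f ψ + annihilate b g ψ := by
  ext n
  rw [lp.coeFn_add, Pi.add_apply]
  simp only [annihilate_apply, inner_add_left]

theorem annihilate_smul_left (b : HilbertBasis ι ℂ H) (z : ℂ) (f : H) (ψ : numDom ι) :
    annihilate b (z • f) ψ = conj z • annihilate b f ψ := by
  ext n
  rw [lp.coeFn_smul, Pi.smul_apply]
  simp only [annihilate_apply, inner_smul_left, smul_eq_mul]

theorem create_apply (b : HilbertBasis ι ℂ H) (f : H) (ψ : numDom ι) (n : ι →₀ ℕ) :
    create b f ψ n = ∑ i ∈ n.support, b.repr f i *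
      ((Real.sqrt (n i) : ℂ) * ψ.1 (n - Finsupp.single i 1)) := rfl

theorem create_add_left (b : HilbertBasis ι ℂ H) (f g : H) (ψ : numDom ι) :
    create b (f + g) ψ = create b f ψ + create b g ψ := by
  ext n
  rw [lp.coeFn_add, Pi.add_apply]
  simp only [create_apply, ← Finset.sum_add_distrib, map_add, lp.coeFn_add, Pi.add_apply, add_mul]

theorem create_smul_left (b : HilbertBasis ι ℂ H) (z : ℂ) (f : H) (ψ : numDom ι) :
    create b (z • f) ψ = z • create b f ψ := by
  ext n
  rw [lp.coeFn_smul, Pi.smul_apply]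
  simp only [create_apply, smul_eq_mul, Finset.mul_sum, map_smul, lp.coeFn_smul, Pi.smul_apply,
    mul_assoc]

theorem hasSum_coeff_sq (b : HilbertBasis ι ℂ H) (f : H) :
    HasSum (fun i => ‖b.repr f i‖ ^ 2) (‖f‖ ^ 2) := by
  rw [← b.repr.norm_map]
  exact hasSum_lp_norm_sq (b.repr f)

/-- Cauchy–Schwarz with the weights √n_i produces the factor ∑ n_i = degree n; undoing the creation
of one particle turns it into degree + 1. -/
theorem norm_create_sq_le (b : HilbertBasis ι ℂ H) (f : H) (ψ : numDom ι) :
    ‖create b f ψ‖ ^ 2 ≤ ‖f‖ ^ 2 * (numExp ψ + ‖ψ.1‖ ^ 2) := by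
  let K : (ι →₀ ℕ) × ι → ℝ := fun p =>
    if p.1 p.2 = 0 then 0 else
      ((p.1.degree : ℝ) * ‖ψ.1 (p.1 - Finsupp.single p.2 1)‖ ^ 2) * ‖b.repr f p.2‖ ^ 2
  have hK : HasSum K ((numExp ψ + ‖ψ.1‖ ^ 2) * ‖f‖ ^ 2) := by
    refine (hasSum_of_support_add_single (fun n i h => if_pos h) _).1 ?_
    have h1 : HasSum (fun n : ι →₀ ℕ => ((n.degree : ℝ) + 1) * ‖ψ.1 n‖ ^ 2)
        (numExp ψ + ‖ψ.1‖ ^ 2) := by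
      simpa only [add_mul, one_mul] using (hasSum_numExp ψ).add (Fock.hasSum_norm_sq ψ.1)
    have h2 := h1.mul (hasSum_coeff_sq b f) (h1.summable.mul_of_nonneg (summable_coeff b f)
      (fun n => by positivity) (fun i => by positivity))
    refine (hasSum_congr fun p => ?_).1 h2
    simp [K, map_add]
  have e1 : ∀ n, HasSum (fun i => K (n, i)) (∑ i ∈ n.support, K (n, i)) := fun n =>
    hasSum_sum_of_ne_finset_zero fun i hi => by simp [K, Finsupp.notMem_support_iff.1 hi]
  rw [mul_comm]
  refine hasSum_le (fun n => ?_) (Fock.hasSum_norm_sq _) (hK.prod_fiberwise e1)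
  rw [create_apply]
  calc ‖∑ i ∈ n.support, b.repr f i *
          ((Real.sqrt (n i) : ℂ) * ψ.1 (n - Finsupp.single i 1))‖ ^ 2
      ≤ (∑ i ∈ n.support, Real.sqrt (n i) *
          (‖b.repr f i‖ * ‖ψ.1 (n - Finsupp.single i 1)‖)) ^ 2 := by
        gcongr
        refine (norm_sum_le _ _).trans (Finset.sum_le_sum fun i _ => le_of_eq ?_)
        rw [norm_mul, norm_mul, Complex.norm_real, Real.norm_eq_abs,
          abs_of_nonneg (Real.sqrt_nonneg _)]
        ring
    _ ≤ (∑ i ∈ n.support, Real.sqrt (n i) ^ 2) *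
          ∑ i ∈ n.support, (‖b.repr f i‖ * ‖ψ.1 (n - Finsupp.single i 1)‖) ^ 2 :=
        Finset.sum_mul_sq_le_sq_mul_sq _ _ _
    _ = ∑ i ∈ n.support, K (n, i) := by
        have : ∑ i ∈ n.support, Real.sqrt (n i) ^ 2 = (n.degree : ℝ) := by
          rw [Finsupp.degree_apply]; push_cast
          exact Finset.sum_congr rfl fun i _ => Real.sq_sqrt (by positivity)
        rw [this, Finset.mul_sum]
        refine Finset.sum_congr rfl fun i hi => ?_
        simp only [K, if_neg (Finsupp.mem_support_iff.1 hi)]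
        ring

/-- The square of the graph norm of `N^{1/2}`. -/
def graphSq (ψ : numDom ι) : ℝ := numExp ψ + ‖ψ.1‖ ^ 2

theorem graphSq_nonneg (ψ : numDom ι) : 0 ≤ graphSq ψ :=
  add_nonneg (numExp_nonneg ψ) (by positivity)

theorem norm_create_le (b : HilbertBasis ι ℂ H) (f : H) (ψ : numDom ι) :
    ‖create b f ψ‖ ≤ √(graphSq ψ) * ‖f‖ := by
  refine abs_le_of_sq_le_sq' ?_ (by positivity) |>.2
  rw [mul_pow, Real.sq_sqrt (graphSq_nonneg ψ), mul_comm]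
  exact norm_create_sq_le b f ψ

theorem norm_annihilate_le (b : HilbertBasis ι ℂ H) (f : H) (ψ : numDom ι) :
    ‖annihilate b f ψ‖ ≤ √(graphSq ψ) * ‖f‖ := by
  refine abs_le_of_sq_le_sq' ?_ (by positivity) |>.2
  rw [mul_pow, Real.sq_sqrt (graphSq_nonneg ψ), mul_comm]
  refine (norm_annihilate_sq_le b f ψ).trans ?_
  unfold graphSq
  gcongr
  linarith [sq_nonneg ‖ψ.1‖]

/-- Both sides are sums over pairs (n, i), related by the shift n ↦ n + e_i. Absolute summability,
from the finite particle number of χ, permits summing in either order. -/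
theorem inner_annihilate_left (b : HilbertBasis ι ℂ H) (f : H) (χ ψ : numDom ι) :
    ⟪annihilate b f χ, ψ.1⟫_ℂ = ⟪χ.1, create b f ψ⟫_ℂ := by
  let K : (ι →₀ ℕ) × ι → ℂ := fun p => conj (χ.1 p.1) * (b.repr f p.2 *
    ((Real.sqrt (p.1 p.2) : ℂ) * ψ.1 (p.1 - Finsupp.single p.2 1)))
  let L : (ι →₀ ℕ) × ι → ℂ := fun p => conj (conj (b.repr f p.2) *
    ((Real.sqrt (p.1 p.2 + 1) : ℂ) * χ.1 (p.1 + Finsupp.single p.2 1))) * ψ.1 p.1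
  have hKL : ∀ p : (ι →₀ ℕ) × ι, K (p.1 + Finsupp.single p.2 1, p.2) = L p := by
    rintro ⟨n, i⟩
    simp only [K, L, map_mul, Complex.conj_conj, Complex.conj_ofReal]
    simp
    ring
  have hLs : Summable L := by
    have h1 := (hasSum_numExp_shift χ).summable
    have h2 : Summable fun p : (ι →₀ ℕ) × ι => ‖ψ.1 p.1‖ ^ 2 * ‖b.repr f p.2‖ ^ 2 :=
      (Fock.summable_sq ψ.1).mul_of_nonneg (summable_coeff b f)
        (fun n => by positivity) (fun i => by positivity)
    refine Summable.of_norm_bounded (h1.add h2) fun p => ?_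
    have h3 := norm_sqrt_mul_sq (p.1 p.2) (χ.1 (p.1 + Finsupp.single p.2 1))
    rw [← h3, ← mul_pow]
    simp only [L]
    rw [norm_mul, RCLike.norm_conj, norm_mul, RCLike.norm_conj]
    nlinarith [sq_nonneg (‖ψ.1 p.1‖ * ‖b.repr f p.2‖ -
      ‖(Real.sqrt (p.1 p.2 + 1) : ℂ) * χ.1 (p.1 + Finsupp.single p.2 1)‖),
      sq_nonneg (‖ψ.1 p.1‖ * ‖b.repr f p.2‖),
      sq_nonneg ‖(Real.sqrt (p.1 p.2 + 1) : ℂ) * χ.1 (p.1 + Finsupp.single p.2 1)‖]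
  have hK : HasSum K (∑' p, L p) := by
    refine (hasSum_of_support_add_single (fun n i h => by simp [K, h]) _).1 ?_
    simpa only [hKL] using hLs.hasSum
  have h1 : HasSum (fun n => ∑' i, L (n, i)) (∑' p, L p) :=
    hLs.hasSum.prod_fiberwise fun n => (hLs.prod_factor n).hasSum
  have h2 : HasSum (fun n => ∑ i ∈ n.support, K (n, i)) (∑' p, L p) :=
    hK.prod_fiberwise fun n => hasSum_sum_of_ne_finset_zero fun i hi => by
      simp [K, Finsupp.notMem_support_iff.1 hi]
  have e1 : ⟪annihilate b f χ, ψ.1⟫_ℂ = ∑' p, L p := by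
    refine (lp.hasSum_inner _ _).unique ?_
    refine (hasSum_congr fun n => ?_).1 h1
    rw [RCLike.inner_apply, mul_comm]
    symm
    show conj (∑' i, _) * _ = _
    rw [Complex.conj_tsum, ← tsum_mul_right]
  have e2 : ⟪χ.1, create b f ψ⟫_ℂ = ∑' p, L p := by
    refine (lp.hasSum_inner _ _).unique ?_
    refine (hasSum_congr fun n => ?_).1 h2
    rw [RCLike.inner_apply, mul_comm, create_apply, Finset.mul_sum]
  rw [e1, e2]

theorem inner_create_left (b : HilbertBasis ι ℂ H) (f : H) (χ ψ : numDom ι) :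
    ⟪create b f χ, ψ.1⟫_ℂ = ⟪χ.1, annihilate b f ψ⟫_ℂ := by
  rw [← inner_conj_symm, ← inner_annihilate_left, inner_conj_symm]

/-- The occupation number state at `n`. -/
def numState [DecidableEq ι] (n : ι →₀ ℕ) : numDom ι :=
  ⟨lp.single 2 n (1 : ℂ), by
    refine summable_of_ne_finset_zero (s := {n}) fun m hm => ?_
    have : m ≠ n := by simpa using hm
    simp [lp.single_apply, this]⟩

theorem inner_numState [DecidableEq ι] (n : ι →₀ ℕ) (ψ : Fock ι) :
    ⟪(numState n : numDom ι).1, ψ⟫_ℂ = ψ n := by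
  unfold numState
  rw [lp.inner_single_left]
  simp

theorem Fock.ext_inner {ψ χ : Fock ι} (h : ∀ u : numDom ι, ⟪u.1, ψ⟫_ℂ = ⟪u.1, χ⟫_ℂ) : ψ = χ := by
  classical
  ext n
  have := h (numState n)
  rwa [inner_numState, inner_numState] at this

/-- The operator `(N + 1)^{-1/2}` on Fock space. -/
def numWeight (ι : Type*) : Fock ι →L[ℂ] Fock ι :=
  LinearMap.mkContinuous
    { toFun := fun ψ => ⟨fun n => ((Real.sqrt ((n.degree : ℝ) + 1))⁻¹ : ℂ) * ψ n, by
        refine memℓp_two (Summable.of_nonneg_of_le (fun n => by positivity) (fun n => ?_)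
          (Fock.summable_sq ψ))
        have h1 : (1 : ℝ) ≤ Real.sqrt ((n.degree : ℝ) + 1) := by
          rw [Real.one_le_sqrt]; linarith [(Nat.cast_nonneg n.degree : (0 : ℝ) ≤ n.degree)]
        rw [norm_mul, norm_inv, Complex.norm_real, Real.norm_eq_abs, abs_of_nonneg (by positivity)]
        gcongr
        exact mul_le_of_le_one_left (norm_nonneg _) (inv_le_one_of_one_le₀ h1)⟩
      map_add' := fun ψ χ => by ext n; exact mul_add _ _ _
      map_smul' := fun z ψ => by ext n; exact mul_left_comm _ _ _ }
    1 (fun ψ => by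
      rw [one_mul]
      refine abs_le_of_sq_le_sq' ?_ (norm_nonneg _) |>.2
      refine hasSum_le (fun n => ?_) (Fock.hasSum_norm_sq _) (Fock.hasSum_norm_sq _)
      have h1 : (1 : ℝ) ≤ Real.sqrt ((n.degree : ℝ) + 1) := by
        rw [Real.one_le_sqrt]; linarith [(Nat.cast_nonneg n.degree : (0 : ℝ) ≤ n.degree)]
      show ‖((Real.sqrt ((n.degree : ℝ) + 1))⁻¹ : ℂ) * ψ n‖ ^ 2 ≤ _
      rw [norm_mul, norm_inv, Complex.norm_real, Real.norm_eq_abs, abs_of_nonneg (by positivity)]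
      gcongr
      exact mul_le_of_le_one_left (norm_nonneg _) (inv_le_one_of_one_le₀ h1))

theorem numWeight_apply (ψ : Fock ι) (n : ι →₀ ℕ) :
    numWeight ι ψ n = ((Real.sqrt ((n.degree : ℝ) + 1))⁻¹ : ℂ) * ψ n := rfl

theorem norm_numWeight_apply_sq (ψ : Fock ι) (n : ι →₀ ℕ) :
    ((n.degree : ℝ) + 1) * ‖numWeight ι ψ n‖ ^ 2 = ‖ψ n‖ ^ 2 := by
  have h : (0 : ℝ) < (n.degree : ℝ) + 1 := by positivity
  rw [numWeight_apply, norm_mul, norm_inv, Complex.norm_real, Real.norm_eq_abs,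
    abs_of_nonneg (by positivity), mul_pow, inv_pow, Real.sq_sqrt h.le, ← mul_assoc,
    mul_inv_cancel₀ h.ne', one_mul]

theorem numWeight_mem (ψ : Fock ι) : numWeight ι ψ ∈ numDom ι := by
  refine Summable.of_nonneg_of_le (fun n => by positivity) (fun n => ?_) (Fock.summable_sq ψ)
  have h : 0 ≤ ‖numWeight ι ψ n‖ ^ 2 := by positivity
  rw [← norm_numWeight_apply_sq ψ n]
  linarith

/-- `(N + 1)^{-1/2}` as a map onto `D(N^{1/2})`. -/
def toNumDom : Fock ι →ₗ[ℂ] numDom ι := (numWeight ι).toLinearMap.codRestrict _ numWeight_mem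

theorem coe_toNumDom (x : Fock ι) : (toNumDom x).1 = numWeight ι x := rfl

/-- Thus (N+1)^{-1/2} maps Fock space isometrically to D(N^{1/2}) with its graph norm. Forms bounded
in the graph norm become bounded forms on Fock space. -/
theorem graphSq_toNumDom (x : Fock ι) : graphSq (toNumDom x) = ‖x‖ ^ 2 := by
  have h := (hasSum_numExp (toNumDom x)).add (Fock.hasSum_norm_sq (toNumDom x).1)
  refine h.unique ?_
  refine (hasSum_congr fun n => ?_).1 (Fock.hasSum_norm_sq x)
  rw [coe_toNumDom, ← norm_numWeight_apply_sq x n]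
  ring

theorem toNumDom_surjective : Function.Surjective (toNumDom : Fock ι →ₗ[ℂ] numDom ι) := by
  intro ψ
  have hne : ∀ n : ι →₀ ℕ, (Real.sqrt ((n.degree : ℝ) + 1) : ℂ) ≠ 0 := fun n => by
    have : (0 : ℝ) < Real.sqrt ((n.degree : ℝ) + 1) := by positivity
    exact_mod_cast this.ne'
  refine ⟨⟨fun n => (Real.sqrt ((n.degree : ℝ) + 1) : ℂ) * ψ.1 n, memℓp_two ?_⟩, ?_⟩
  · refine ((hasSum_numExp ψ).add (Fock.hasSum_norm_sq ψ.1)).summable.congr fun n => ?_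
    rw [norm_sqrt_mul_sq]; ring
  · refine Subtype.ext ?_
    ext n
    rw [coe_toNumDom, numWeight_apply]
    show _ * (_ * _) = _
    rw [← mul_assoc, inv_mul_cancel₀ (hne n), one_mul]

theorem numWeight_injective : Function.Injective (numWeight ι) := by
  refine (injective_iff_map_eq_zero _).2 fun x hx => ?_
  ext n
  have h := norm_numWeight_apply_sq x n
  rw [hx] at h
  simpa using h.symm

theorem inner_numWeight (x y : Fock ι) : ⟪numWeight ι x, y⟫_ℂ = ⟪x, numWeight ι y⟫_ℂ := by
  rw [lp.inner_eq_tsum, lp.inner_eq_tsum]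
  refine tsum_congr fun n => ?_
  simp only [RCLike.inner_apply, numWeight_apply, map_mul, map_inv₀, Complex.conj_ofReal]
  ring

end FockBasics

/-! ### Exponential vectors -/

section ExpVec

variable {ι : Type*}

open Finset Filter Topology in
-- The multinomial theorem divided by N!.
theorem sum_finsuppAntidiag_prod [DecidableEq ι] (s : Finset ι) (N : ℕ) (x : ι → ℂ) :
    ∑ n ∈ s.finsuppAntidiag N, n.prod (fun i k => x i ^ k / (k.factorial : ℂ)) =
      (∑ i ∈ s, x i) ^ N / (N.factorial : ℂ) := by
  rw [sum_pow_eq_sum_piAntidiag, Finset.sum_div]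
  refine Finset.sum_nbij (fun n => ⇑n) ?_ (fun _ _ _ _ h => DFunLike.coe_injective h) ?_ ?_
  · intro n hn
    rw [Finset.mem_finsuppAntidiag] at hn
    rw [Finset.mem_piAntidiag]
    exact ⟨hn.1, fun i hi => hn.2 (Finsupp.mem_support_iff.2 hi)⟩
  · intro n hn
    rw [Finset.mem_coe, Finset.mem_piAntidiag] at hn
    refine ⟨Finsupp.onFinset s n hn.2, ?_, rfl⟩
    rw [Finset.mem_coe, Finset.mem_finsuppAntidiag]
    exact ⟨hn.1, Finsupp.support_onFinset_subset⟩
  · intro n hn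
    rw [Finset.mem_finsuppAntidiag] at hn
    rw [Finsupp.prod_of_support_subset _ hn.2 _ (fun i _ => by simp), Finset.prod_div_distrib]
    have h := Nat.multinomial_spec s n
    rw [hn.1] at h
    have h2 : (∏ i ∈ s, ((n i).factorial : ℂ)) * (Nat.multinomial s n : ℂ) = N.factorial := by
      exact_mod_cast h
    have h3 : (∏ i ∈ s, ((n i).factorial : ℂ)) ≠ 0 :=
      Finset.prod_ne_zero_iff.2 fun i _ => by exact_mod_cast (n i).factorial_ne_zero
    rw [← h2]
    have h4 : (Nat.multinomial s n : ℂ) ≠ 0 := by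
      rintro h0
      rw [h0, mul_zero] at h2
      exact (by exact_mod_cast N.factorial_ne_zero : (N.factorial : ℂ) ≠ 0) h2.symm
    field_simp

/-- The set of occupation numbers supported on `s` with total number below `M`. -/
def occBox [DecidableEq ι] (s : Finset ι) (M : ℕ) : Finset (ι →₀ ℕ) :=
  (Finset.range M).biUnion fun N => s.finsuppAntidiag N

theorem mem_occBox [DecidableEq ι] {s : Finset ι} {M : ℕ} {n : ι →₀ ℕ} :
    n ∈ occBox s M ↔ n.support ⊆ s ∧ n.degree < M := by
  unfold occBox
  rw [Finset.mem_biUnion]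
  constructor
  · rintro ⟨N, hN, hn⟩
    rw [Finset.mem_finsuppAntidiag'] at hn
    refine ⟨hn.2, ?_⟩
    have : n.degree = N := hn.1
    rw [this]
    exact Finset.mem_range.1 hN
  · rintro ⟨h1, h2⟩
    exact ⟨n.degree, Finset.mem_range.2 h2, Finset.mem_finsuppAntidiag'.2 ⟨rfl, h1⟩⟩

theorem sum_occBox_prod [DecidableEq ι] (s : Finset ι) (M : ℕ) (x : ι → ℂ) :
    ∑ n ∈ occBox s M, n.prod (fun i k => x i ^ k / (k.factorial : ℂ)) =
      ∑ N ∈ Finset.range M, (∑ i ∈ s, x i) ^ N / (N.factorial : ℂ) := by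
  unfold occBox
  rw [Finset.sum_biUnion]
  · exact Finset.sum_congr rfl fun N _ => sum_finsuppAntidiag_prod s N x
  · intro N _ N' _ h
    rw [Function.onFun, Finset.disjoint_left]
    intro n h1 h2
    rw [Finset.mem_finsuppAntidiag'] at h1 h2
    exact h (h1.1.symm.trans h2.1)

theorem exists_subset_occBox [DecidableEq ι] (t : Finset (ι →₀ ℕ)) :
    ∃ (s : Finset ι) (M : ℕ), ∀ s' M', s ⊆ s' → M ≤ M' → t ⊆ occBox s' M' := by
  refine ⟨t.biUnion Finsupp.support, t.sup Finsupp.degree + 1, fun s' M' h1 h2 n hn => ?_⟩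
  rw [mem_occBox]
  refine ⟨(Finset.subset_biUnion_of_mem _ hn).trans h1, ?_⟩
  have : n.degree ≤ t.sup Finsupp.degree := Finset.le_sup (f := Finsupp.degree) hn
  omega

/-- Any finite set of occupation numbers lies in a box of finitely many modes and bounded degree,
and the sum over a box is a partial sum of an exponential series. -/
theorem summable_prod_div_factorial {x : ι → ℂ} (hx : Summable fun i => ‖x i‖) :
    Summable fun n : ι →₀ ℕ => ‖n.prod (fun i k => x i ^ k / (k.factorial : ℂ))‖ := by
  classical
  refine summable_of_sum_le (c := Real.exp (∑' i, ‖x i‖)) (fun n => norm_nonneg _) fun t => ?_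
  obtain ⟨s, M, h⟩ := exists_subset_occBox t
  refine (Finset.sum_le_sum_of_subset_of_nonneg (h s M subset_rfl le_rfl)
    fun _ _ _ => norm_nonneg _).trans ?_
  have e1 : ∀ n : ι →₀ ℕ, ‖n.prod (fun i k => x i ^ k / (k.factorial : ℂ))‖ =
      (n.prod (fun i k => (‖x i‖ : ℂ) ^ k / (k.factorial : ℂ))).re := by
    intro n
    rw [Finsupp.prod, Finsupp.prod, norm_prod]
    have : (∏ i ∈ n.support, (‖x i‖ : ℂ) ^ n i / ((n i).factorial : ℂ)) =
        ((∏ i ∈ n.support, ‖x i‖ ^ n i / ((n i).factorial : ℝ) : ℝ) : ℂ) := by push_cast; rfl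
    rw [this, Complex.ofReal_re]
    exact Finset.prod_congr rfl fun i _ => by simp
  simp only [e1]
  rw [← Complex.re_sum, sum_occBox_prod]
  have e2 : (∑ N ∈ Finset.range M, (∑ i ∈ s, (‖x i‖ : ℂ)) ^ N / (N.factorial : ℂ)) =
      ((∑ N ∈ Finset.range M, (∑ i ∈ s, ‖x i‖) ^ N / (N.factorial : ℝ) : ℝ) : ℂ) := by
    push_cast; rfl
  rw [e2, Complex.ofReal_re]
  refine (Real.sum_le_exp_of_nonneg (Finset.sum_nonneg fun _ _ => norm_nonneg _) _).trans ?_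
  exact Real.exp_le_exp.2 (hx.sum_le_tsum _ fun _ _ => norm_nonneg _)

open Filter Topology in
theorem hasSum_prod_div_factorial {x : ι → ℂ} (hx : Summable fun i => ‖x i‖) :
    HasSum (fun n : ι →₀ ℕ => n.prod (fun i k => x i ^ k / (k.factorial : ℂ)))
      (Complex.exp (∑' i, x i)) := by
  classical
  have hs := (summable_prod_div_factorial hx).of_norm
  suffices h : Complex.exp (∑' i, x i) =
      ∑' n : ι →₀ ℕ, n.prod (fun i k => x i ^ k / (k.factorial : ℂ)) by
    rw [h]; exact hs.hasSum
  set S := ∑' n : ι →₀ ℕ, n.prod (fun i k => x i ^ k / (k.factorial : ℂ)) with hS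
  refine eq_of_forall_dist_le fun ε hε => ?_
  have h1 : Tendsto (fun s : Finset ι => dist (Complex.exp (∑ i ∈ s, x i)) S) atTop
      (𝓝 (dist (Complex.exp (∑' i, x i)) S)) :=
    ((Complex.continuous_exp.tendsto _).comp hx.of_norm.hasSum).dist tendsto_const_nhds
  refine le_of_tendsto h1 ?_
  -- Every large enough box contains t, so its sum is within ε of S. Letting the degree bound grow
  -- first, and then the set of modes, gives the exponential of the full sum.
  obtain ⟨t, ht⟩ := (Metric.tendsto_atTop.1 (hs.hasSum : Tendsto _ atTop _)) ε hε
  obtain ⟨s, M, hsM⟩ := exists_subset_occBox t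
  filter_upwards [eventually_ge_atTop s] with s' hs'
  have h2 : Tendsto (fun M' => dist (∑ N ∈ Finset.range M',
      (∑ i ∈ s', x i) ^ N / (N.factorial : ℂ)) S) atTop
      (𝓝 (dist (Complex.exp (∑ i ∈ s', x i)) S)) := by
    refine Tendsto.dist ?_ tendsto_const_nhds
    rw [Complex.exp_eq_exp_ℂ]
    exact (NormedSpace.exp_series_hasSum_exp' (𝕂 := ℂ) (∑ i ∈ s', x i)).tendsto_sum_nat.congr
      fun M' => Finset.sum_congr rfl fun N _ => by rw [smul_eq_mul, div_eq_inv_mul]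
  refine le_of_tendsto h2 ?_
  filter_upwards [eventually_ge_atTop M] with M' hM'
  rw [← sum_occBox_prod]
  exact (ht _ (hsM s' M' hs' hM')).le

variable {H : Type*} [NormedAddCommGroup H] [InnerProductSpace ℂ H]

/-- The amplitudes `∏_i f_i^{n_i} / √(n_i!)` of the exponential vector of `f`. -/
def expCoeff (b : HilbertBasis ι ℂ H) (f : H) (n : ι →₀ ℕ) : ℂ :=
  n.prod fun i k => b.repr f i ^ k / (Real.sqrt (k.factorial) : ℂ)

theorem conj_expCoeff_mul (b : HilbertBasis ι ℂ H) (f g : H) (n : ι →₀ ℕ) :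
    conj (expCoeff b f n) * expCoeff b g n =
      n.prod fun i k => (conj (b.repr f i) * b.repr g i) ^ k / (k.factorial : ℂ) := by
  simp only [expCoeff, Finsupp.prod, map_prod]
  rw [← Finset.prod_mul_distrib]
  refine Finset.prod_congr rfl fun i _ => ?_
  have h : (Real.sqrt ((n i).factorial) : ℂ) * (Real.sqrt ((n i).factorial) : ℂ) =
      ((n i).factorial : ℂ) := by
    rw [← Complex.ofReal_mul, Real.mul_self_sqrt (by positivity)]
    norm_cast
  rw [map_div₀, Complex.conj_ofReal, div_mul_div_comm, h, map_pow, mul_pow]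

/-- The weight degree + 1 is at most 2^degree, and 2^degree is absorbed by replacing |f_i|² with
2|f_i|² in the exponential series. -/
theorem summable_expCoeff (b : HilbertBasis ι ℂ H) (f : H) :
    Summable fun n : ι →₀ ℕ => ((n.degree : ℝ) + 1) * ‖expCoeff b f n‖ ^ 2 := by
  have h0 : Summable fun i => ‖(2 : ℂ) * (conj (b.repr f i) * b.repr f i)‖ := by
    refine ((summable_coeff b f).mul_left 2).congr fun i => ?_
    rw [norm_mul, norm_mul, RCLike.norm_conj, sq]
    norm_num
  refine Summable.of_nonneg_of_le (fun n => by positivity) (fun n => ?_)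
    (summable_prod_div_factorial h0)
  have e1 : ‖n.prod fun i k => ((2 : ℂ) * (conj (b.repr f i) * b.repr f i)) ^ k /
      (k.factorial : ℂ)‖ = 2 ^ n.degree * ‖expCoeff b f n‖ ^ 2 := by
    have h2 := congrArg norm (conj_expCoeff_mul b f f n)
    rw [norm_mul, RCLike.norm_conj, ← sq] at h2
    rw [h2, Finsupp.degree_apply, ← Finset.prod_pow_eq_pow_sum, Finsupp.prod, Finsupp.prod,
      norm_prod, norm_prod, ← Finset.prod_mul_distrib]
    refine Finset.prod_congr rfl fun i _ => ?_
    rw [mul_pow, mul_div_assoc, norm_mul, norm_pow]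
    norm_num
  rw [e1]
  gcongr
  exact_mod_cast Nat.lt_two_pow_self

/-- The exponential vector of `f`, with amplitudes multiplied by `√(N+1)`. -/
def expVecW (b : HilbertBasis ι ℂ H) (f : H) : Fock ι :=
  ⟨fun n => (Real.sqrt ((n.degree : ℝ) + 1) : ℂ) * expCoeff b f n, memℓp_two <| by
    refine (summable_expCoeff b f).congr fun n => ?_
    rw [norm_sqrt_mul_sq]⟩

/-- The exponential vector of `f`. -/
def expVec (b : HilbertBasis ι ℂ H) (f : H) : numDom ι := toNumDom (expVecW b f)

theorem expVec_apply (b : HilbertBasis ι ℂ H) (f : H) (n : ι →₀ ℕ) :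
    (expVec b f).1 n = expCoeff b f n := by
  have h : (Real.sqrt ((n.degree : ℝ) + 1) : ℂ) ≠ 0 := by
    have : (0 : ℝ) < Real.sqrt ((n.degree : ℝ) + 1) := by positivity
    exact_mod_cast this.ne'
  rw [expVec, coe_toNumDom, numWeight_apply]
  show _ * (_ * _) = _
  rw [← mul_assoc, inv_mul_cancel₀ h, one_mul]

theorem inner_expVec (b : HilbertBasis ι ℂ H) (f g : H) :
    ⟪(expVec b f).1, (expVec b g).1⟫_ℂ = Complex.exp ⟪f, g⟫_ℂ := by
  have h1 : Summable fun i => ‖conj (b.repr f i) * b.repr g i‖ := by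
    refine Summable.of_nonneg_of_le (fun i => norm_nonneg _) (fun i => ?_)
      ((summable_coeff b f).add (summable_coeff b g))
    rw [norm_mul, RCLike.norm_conj]
    nlinarith [sq_nonneg (‖b.repr f i‖ - ‖b.repr g i‖), sq_nonneg ‖b.repr f i‖,
      sq_nonneg ‖b.repr g i‖]
  have h2 : ⟪f, g⟫_ℂ = ∑' i, conj (b.repr f i) * b.repr g i := by
    rw [← b.repr.inner_map_map, lp.inner_eq_tsum]
    exact tsum_congr fun i => by rw [RCLike.inner_apply, mul_comm]
  rw [h2]
  refine (lp.hasSum_inner _ _).unique ?_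
  refine (hasSum_congr fun n => ?_).1 (hasSum_prod_div_factorial h1)
  rw [← conj_expCoeff_mul, RCLike.inner_apply, mul_comm, expVec_apply, expVec_apply]

/-- The coordinate form of a(e_i) ε(f) = f_i ε(f). -/
theorem expCoeff_add_single (b : HilbertBasis ι ℂ H) (f : H) (n : ι →₀ ℕ) (i : ι) :
    (Real.sqrt (n i + 1) : ℂ) * expCoeff b f (n + Finsupp.single i 1) =
      b.repr f i * expCoeff b f n := by
  classical
  unfold expCoeff
  rw [← Finsupp.mul_prod_erase' n i _ (by simp),
    ← Finsupp.mul_prod_erase' (n + Finsupp.single i 1) i _ (by simp)]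
  have h : (n + Finsupp.single i 1).erase i = n.erase i := by
    ext j; by_cases hj : j = i <;> simp [hj, Finsupp.erase]
  have h1 : (Real.sqrt ((n i : ℝ) + 1) : ℂ) ≠ 0 := by
    have : (0 : ℝ) < Real.sqrt ((n i : ℝ) + 1) := by positivity
    exact_mod_cast this.ne'
  have h2 : (Real.sqrt ((n i).factorial) : ℂ) ≠ 0 := by
    have : (0 : ℝ) < Real.sqrt ((n i).factorial) := by positivity
    exact_mod_cast this.ne'
  rw [h, Finsupp.add_apply, Finsupp.single_eq_same, Nat.factorial_succ, Nat.cast_mul,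
    Real.sqrt_mul (by positivity), Complex.ofReal_mul, Nat.cast_add, Nat.cast_one, pow_succ]
  field_simp

theorem annVec_expVec (b : HilbertBasis ι ℂ H) (f : H) (n : ι →₀ ℕ) :
    annVec b (expVec b f) n = (expVec b f).1 n • f := by
  apply b.repr.injective
  rw [annVec, LinearIsometryEquiv.apply_symm_apply, map_smul]
  ext i
  show (Real.sqrt (n i + 1) : ℂ) * (expVec b f).1 (n + Finsupp.single i 1) =
    (expVec b f).1 n * b.repr f i
  rw [expVec_apply, expVec_apply, expCoeff_add_single, mul_comm]

/-- Exponential vectors are joint eigenvectors of all annihilation operators; every commutation rule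
for the displacement operators is checked through this. -/
theorem annihilate_expVec (b : HilbertBasis ι ℂ H) (g f : H) :
    annihilate b g (expVec b f) = ⟪g, f⟫_ℂ • (expVec b f).1 := by
  ext n
  rw [annihilate_apply, annVec_expVec, inner_smul_right, lp.coeFn_smul, Pi.smul_apply,
    smul_eq_mul, mul_comm]

end ExpVec

/-! ### Totality of the exponential vectors and Weyl transformations -/

section Weyl

variable {ι : Type*} {H : Type*} [NormedAddCommGroup H] [InnerProductSpace ℂ H]

theorem coeff_eq_zero_of_hasSum_zero {a : ℕ → ℂ} (h : ∀ z : ℂ, HasSum (fun N => z ^ N * a N) 0)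
    (N : ℕ) : a N = 0 := by
  let p : FormalMultilinearSeries ℂ ℂ ℂ := fun n =>
    ContinuousMultilinearMap.mkPiRing ℂ (Fin n) (a n)
  have hc : ∀ n, p.coeff n = a n := fun n => by
    simp [p, FormalMultilinearSeries.coeff]
  have hp : HasFPowerSeriesAt (0 : ℂ → ℂ) p 0 := by
    refine hasFPowerSeriesAt_iff.2 (Filter.Eventually.of_forall fun z => ?_)
    simpa [hc] using h z
  rw [← hc, hp.eq_zero]
  rfl

theorem repr_sum_smul (b : HilbertBasis ι ℂ H) [DecidableEq ι] (s : Finset ι) (z : ι → ℂ) (i : ι) :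
    b.repr (∑ j ∈ s, z j • b j) i = if i ∈ s then z i else 0 := by
  rw [b.repr_apply_apply, inner_sum]
  simp only [inner_smul_right, orthonormal_iff_ite.1 b.orthonormal, mul_ite, mul_one, mul_zero,
    Finset.sum_ite_eq]

/-- On f = ∑_{j ∈ s} z_j e_j the inner product with χ is a power series in finitely many variables
z_j whose coefficients are nonzero multiples of conj (χ n). Its vanishing for all z forces every
such coefficient to vanish; s is the support of the chosen occupation number. -/
theorem eq_zero_of_inner_expVecW (b : HilbertBasis ι ℂ H) {χ : Fock ι}
    (h : ∀ f, ⟪χ, expVecW b f⟫_ℂ = 0) : χ = 0 := by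
  classical
  ext n₀
  set s := n₀.support
  let A : (ι →₀ ℕ) → ℂ := fun n => conj (χ n) * (Real.sqrt ((n.degree : ℝ) + 1) : ℂ) *
    n.prod fun _ k => (Real.sqrt (k.factorial) : ℂ)⁻¹
  have e1 : ∀ (z : ι → ℂ) (n : ι →₀ ℕ), conj (χ n) * expVecW b (∑ j ∈ s, z j • b j) n =
      if n.support ⊆ s then A n * n.prod (fun i k => z i ^ k) else 0 := by
    intro z n
    show _ * ((Real.sqrt ((n.degree : ℝ) + 1) : ℂ) * expCoeff b _ n) = _
    split_ifs with hn
    · simp only [A, mul_assoc]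
      congr 2
      rw [expCoeff, ← Finsupp.prod_mul]
      refine Finset.prod_congr rfl fun i hi => ?_
      have h0 := repr_sum_smul b s z i
      rw [if_pos (hn hi)] at h0
      exact (congrArg (fun t : ℂ => t ^ n i / (Real.sqrt ((n i).factorial) : ℂ)) h0).trans
        (div_eq_inv_mul _ _)
    · obtain ⟨i, hi, his⟩ := Finset.not_subset.1 hn
      have : expCoeff b (∑ j ∈ s, z j • b j) n = 0 := by
        refine Finset.prod_eq_zero hi ?_
        have h0 := repr_sum_smul b s z i
        rw [if_neg his] at h0
        refine (congrArg (fun t : ℂ => t ^ n i / (Real.sqrt ((n i).factorial) : ℂ)) h0).trans ?_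
        rw [zero_pow (Finsupp.mem_support_iff.1 hi), zero_div]
      rw [this, mul_zero, mul_zero]
  have e2 : ∀ z : ι → ℂ, HasSum (fun N => ∑ n ∈ s.finsuppAntidiag N,
      A n * n.prod (fun i k => z i ^ k)) 0 := by
    intro z
    have h1 : HasSum (fun n => ⟪χ n, expVecW b (∑ j ∈ s, z j • b j) n⟫_ℂ)
        ⟪χ, expVecW b (∑ j ∈ s, z j • b j)⟫_ℂ := lp.hasSum_inner (𝕜 := ℂ) _ _
    rw [h] at h1
    have h2 : HasSum (fun n : ι →₀ ℕ =>
        if n.support ⊆ s then A n * n.prod (fun i k => z i ^ k) else 0) 0 :=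
      (hasSum_congr fun n => (RCLike.inner_apply _ _).trans ((mul_comm _ _).trans (e1 z n))).1 h1
    have h3 := ((Equiv.sigmaFiberEquiv (Finsupp.degree : (ι →₀ ℕ) → ℕ)).hasSum_iff).2 h2
    refine h3.sigma fun N => ?_
    refine (hasSum_subtype_iff_indicator (s := {n : ι →₀ ℕ | n.degree = N})
      (f := fun n => if n.support ⊆ s then A n * n.prod (fun i k => z i ^ k) else 0)).2 ?_
    have e3 : (∑ n ∈ s.finsuppAntidiag N, A n * n.prod (fun i k => z i ^ k)) =
        ∑ n ∈ s.finsuppAntidiag N, Set.indicator {n : ι →₀ ℕ | n.degree = N} (fun n =>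
          if n.support ⊆ s then A n * n.prod (fun i k => z i ^ k) else 0) n := by
      refine Finset.sum_congr rfl fun n hn => ?_
      rw [Finset.mem_finsuppAntidiag'] at hn
      rw [Set.indicator_of_mem (show n ∈ {n : ι →₀ ℕ | n.degree = N} from hn.1), if_pos hn.2]
    rw [e3]
    refine hasSum_sum_of_ne_finset_zero fun n hn => ?_
    rw [Finset.mem_finsuppAntidiag'] at hn
    by_cases hN : n.degree = N
    · rw [Set.indicator_of_mem (show n ∈ {n : ι →₀ ℕ | n.degree = N} from hN),
        if_neg fun h' => hn ⟨hN, h'⟩]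
    · exact Set.indicator_of_notMem (show n ∉ {n : ι →₀ ℕ | n.degree = N} from hN) _
  have e4 : ∀ (z : ι → ℂ) (N : ℕ), ∑ n ∈ s.finsuppAntidiag N,
      A n * n.prod (fun i k => z i ^ k) = 0 := by
    intro z
    -- Scaling z to t z multiplies the degree-N part by t^N, so the identity theorem in the single
    -- variable t separates the degrees.
    refine coeff_eq_zero_of_hasSum_zero fun t => ?_
    refine (hasSum_congr fun N => ?_).1 (e2 fun i => t * z i)
    rw [Finset.mul_sum]
    refine Finset.sum_congr rfl fun n hn => ?_
    rw [Finset.mem_finsuppAntidiag'] at hn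
    have : n.prod (fun i k => (t * z i) ^ k) = t ^ N * n.prod (fun i k => z i ^ k) := by
      have hN : N = ∑ i ∈ n.support, n i := hn.1.symm
      rw [hN, ← Finset.prod_pow_eq_pow_sum, Finsupp.prod, Finsupp.prod, ← Finset.prod_mul_distrib]
      exact Finset.prod_congr rfl fun i _ => mul_pow _ _ _
    rw [this]
    ring
  -- The homogeneous part of degree |n₀| is a polynomial vanishing at every point, hence the zero
  -- polynomial; its coefficient at n₀ is read off.
  let P : MvPolynomial ι ℂ := ∑ n ∈ s.finsuppAntidiag n₀.degree, MvPolynomial.monomial n (A n)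
  have hP : P = 0 := by
    refine MvPolynomial.funext fun z => ?_
    rw [map_zero, ← e4 z n₀.degree, map_sum]
    exact Finset.sum_congr rfl fun n _ => MvPolynomial.eval_monomial
  have hA : A n₀ = 0 := by
    have h5 := congrArg (MvPolynomial.coeff n₀) hP
    rw [MvPolynomial.coeff_sum, MvPolynomial.coeff_zero] at h5
    simp only [MvPolynomial.coeff_monomial] at h5
    rwa [Finset.sum_ite_eq', if_pos] at h5
    exact Finset.mem_finsuppAntidiag'.2 ⟨rfl, subset_rfl⟩
  have h6 : (Real.sqrt ((n₀.degree : ℝ) + 1) : ℂ) ≠ 0 := by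
    have : (0 : ℝ) < Real.sqrt ((n₀.degree : ℝ) + 1) := by positivity
    exact_mod_cast this.ne'
  have h7 : (n₀.prod fun _ k => (Real.sqrt (k.factorial) : ℂ)⁻¹) ≠ 0 := by
    refine Finset.prod_ne_zero_iff.2 fun i _ => inv_ne_zero ?_
    have : (0 : ℝ) < Real.sqrt ((n₀ i).factorial) := by positivity
    exact_mod_cast this.ne'
  simpa [A, h6, h7] using hA

/-- The weight √(N+1) makes this density of exponential vectors in the graph norm of N^{1/2}.
Identities involving a(f)(N+1)^{-1/2} may therefore be tested on them. -/
theorem dense_span_expVecW (b : HilbertBasis ι ℂ H) :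
    Dense (Submodule.span ℂ (Set.range (expVecW b)) : Set (Fock ι)) := by
  rw [Submodule.dense_iff_topologicalClosure_eq_top, Submodule.topologicalClosure_eq_top_iff,
    Submodule.eq_bot_iff]
  intro χ hχ
  refine eq_zero_of_inner_expVecW b fun f => ?_
  rw [← inner_conj_symm, Submodule.inner_right_of_mem_orthogonal
    (Submodule.subset_span (Set.mem_range_self f)) hχ, map_zero]

theorem dense_numDom : Dense (numDom ι : Set (Fock ι)) := by
  rw [Submodule.dense_iff_topologicalClosure_eq_top, Submodule.topologicalClosure_eq_top_iff,
    Submodule.eq_bot_iff]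
  intro χ hχ
  refine Fock.ext_inner fun u => ?_
  rw [inner_zero_right]
  exact Submodule.inner_right_of_mem_orthogonal u.2 hχ

theorem denseRange_numWeight : DenseRange (numWeight ι) := by
  refine dense_numDom.mono fun ψ hψ => ?_
  obtain ⟨x, hx⟩ := toNumDom_surjective ⟨ψ, hψ⟩
  exact ⟨x, congrArg Subtype.val hx⟩

theorem dense_span_expVec (b : HilbertBasis ι ℂ H) :
    Dense (Submodule.span ℂ (Set.range fun f => (expVec b f).1) : Set (Fock ι)) := by
  have h := denseRange_numWeight.dense_image (numWeight ι).continuous (dense_span_expVecW b)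
  refine h.mono ?_
  rintro _ ⟨x, hx, rfl⟩
  have h2 : numWeight ι x ∈ (Submodule.span ℂ (Set.range (expVecW b))).map
      (numWeight ι).toLinearMap := ⟨x, hx, rfl⟩
  rw [Submodule.map_span, ← Set.range_comp] at h2
  exact h2

/-- The factor in `D_η ε(f) = dispFactor η f • ε(f + η)`. -/
def dispFactor (η f : H) : ℂ := Complex.exp (-⟪η, η⟫_ℂ / 2 - ⟪η, f⟫_ℂ)

/-- The map sending formal combinations of vectors `f` to combinations of exponential vectors. -/
def expComb (b : HilbertBasis ι ℂ H) : (H →₀ ℂ) →ₗ[ℂ] Fock ι :=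
  Finsupp.linearCombination ℂ fun f => (expVec b f).1

/-- The displaced version of `expComb`. -/
def dispComb (b : HilbertBasis ι ℂ H) (η : H) : (H →₀ ℂ) →ₗ[ℂ] Fock ι :=
  Finsupp.linearCombination ℂ fun f => dispFactor η f • (expVec b (f + η)).1

/-- The norm of a linear combination depends only on the Gram matrix. -/
theorem norm_linearCombination_eq {κ : Type*} {u v : κ → Fock ι}
    (h : ∀ i j, ⟪u i, u j⟫_ℂ = ⟪v i, v j⟫_ℂ) (x : κ →₀ ℂ) :
    ‖Finsupp.linearCombination ℂ u x‖ = ‖Finsupp.linearCombination ℂ v x‖ := by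
  have : ⟪Finsupp.linearCombination ℂ u x, Finsupp.linearCombination ℂ u x⟫_ℂ =
      ⟪Finsupp.linearCombination ℂ v x, Finsupp.linearCombination ℂ v x⟫_ℂ := by
    simp only [Finsupp.linearCombination_apply, Finsupp.sum_inner, Finsupp.inner_sum,
      inner_smul_left, inner_smul_right, h]
  rw [inner_self_eq_norm_sq_to_K, inner_self_eq_norm_sq_to_K] at this
  have h2 : ‖Finsupp.linearCombination ℂ u x‖ ^ 2 = ‖Finsupp.linearCombination ℂ v x‖ ^ 2 := by
    exact_mod_cast this
  exact (pow_left_inj₀ (norm_nonneg _) (norm_nonneg _) two_ne_zero).1 h2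

/-- The normalisation in `dispFactor` cancels the terms ⟨f,η⟩, ⟨η,g⟩ and ⟨η,η⟩ of ⟨f+η, g+η⟩, so
displacement preserves the Gram matrix. This makes the displacement operator well defined and
isometric. -/
theorem norm_dispComb (b : HilbertBasis ι ℂ H) (η : H) (x : H →₀ ℂ) :
    ‖dispComb b η x‖ = ‖expComb b x‖ := by
  refine norm_linearCombination_eq (fun f g => ?_) x
  rw [inner_smul_left, inner_smul_right, inner_expVec, inner_expVec, dispFactor, dispFactor,
    ← Complex.exp_conj, ← Complex.exp_add, ← Complex.exp_add]
  congr 1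
  rw [map_sub, map_div₀, map_neg, inner_conj_symm, inner_conj_symm, inner_add_left,
    inner_add_right, inner_add_right]
  have : conj (2 : ℂ) = 2 := Complex.conj_ofNat 2
  rw [this]
  ring

theorem denseRange_expComb (b : HilbertBasis ι ℂ H) : DenseRange (expComb b) := by
  have h : Set.range (expComb b) =
      (Submodule.span ℂ (Set.range fun f => (expVec b f).1) : Set (Fock ι)) := by
    rw [← Finsupp.range_linearCombination]
    rfl
  rw [DenseRange, h]
  exact dense_span_expVec b

/-- The displacement operator with `D_η ε(f) = dispFactor η f • ε(f + η)`. -/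
def dispCLM (b : HilbertBasis ι ℂ H) (η : H) : Fock ι →L[ℂ] Fock ι :=
  (dispComb b η).extendOfNorm (expComb b)

theorem dispCLM_expVec (b : HilbertBasis ι ℂ H) (η f : H) :
    dispCLM b η (expVec b f).1 = dispFactor η f • (expVec b (f + η)).1 := by
  have h := LinearMap.extendOfNorm_eq (f := dispComb b η) (denseRange_expComb b)
    ⟨1, fun x => by rw [one_mul, norm_dispComb]⟩ (Finsupp.single f 1)
  simpa [expComb, dispComb, dispCLM] using h

theorem norm_dispCLM_le (b : HilbertBasis ι ℂ H) (η : H) (ψ : Fock ι) : ‖dispCLM b η ψ‖ ≤ ‖ψ‖ := by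
  have h := LinearMap.norm_extendOfNorm_apply_le (f := dispComb b η) (denseRange_expComb b) 1
    (fun x => by rw [one_mul, norm_dispComb]) ψ
  simpa [dispCLM] using h

theorem dispCLM_dispCLM_neg (b : HilbertBasis ι ℂ H) (η : H) (ψ : Fock ι) :
    dispCLM b η (dispCLM b (-η) ψ) = ψ := by
  suffices h : dispCLM b η ∘L dispCLM b (-η) = ContinuousLinearMap.id ℂ _ from
    congrArg (fun L : Fock ι →L[ℂ] Fock ι => L ψ) h
  refine ContinuousLinearMap.ext_on (dense_span_expVec b) ?_
  rintro _ ⟨f, rfl⟩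
  simp only [ContinuousLinearMap.comp_apply, ContinuousLinearMap.id_apply]
  rw [dispCLM_expVec, map_smul, dispCLM_expVec, smul_smul, neg_add_cancel_right, dispFactor,
    dispFactor, ← Complex.exp_add]
  simp only [inner_neg_left, inner_neg_right, inner_add_right]
  ring_nf
  rw [Complex.exp_zero, one_smul]

/-- The displacement operator as a unitary operator. -/
def disp (b : HilbertBasis ι ℂ H) (η : H) : Fock ι ≃ₗᵢ[ℂ] Fock ι where
  toFun := dispCLM b η
  map_add' := map_add _
  map_smul' := map_smul _
  invFun := dispCLM b (-η)
  left_inv ψ := by simpa using dispCLM_dispCLM_neg b (-η) ψ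
  right_inv ψ := dispCLM_dispCLM_neg b η ψ
  norm_map' ψ := by
    refine le_antisymm (norm_dispCLM_le b η ψ) ?_
    have h := dispCLM_dispCLM_neg b (-η) ψ
    rw [neg_neg] at h
    conv_lhs => rw [← h]
    exact norm_dispCLM_le b (-η) _

/-- The bounded operator `a(f) (N+1)^{-1/2}`. -/
def annWeight (b : HilbertBasis ι ℂ H) (f : H) : Fock ι →L[ℂ] Fock ι :=
  (annihilate b f ∘ₗ toNumDom).mkContinuous ‖f‖ fun x => by
    have h := norm_annihilate_le b f (toNumDom x)
    rwa [graphSq_toNumDom, Real.sqrt_sq (norm_nonneg _), mul_comm] at h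

theorem annWeight_apply (b : HilbertBasis ι ℂ H) (f : H) (x : Fock ι) :
    annWeight b f x = annihilate b f (toNumDom x) := rfl

/-- This is a(e_i) D_η = D_η (a(e_i) + ⟨e_i,η⟩) read at one occupation number. In this form it makes
sense before D_η ψ is known to lie in D(N^{1/2}): both sides are bounded functionals of (N+1)^{1/2}
ψ, so they need only be compared on exponential vectors. -/
theorem dispCLM_apply_add_single (b : HilbertBasis ι ℂ H) (η : H) (ψ : numDom ι) (n : ι →₀ ℕ)
    (i : ι) : (Real.sqrt (n i + 1) : ℂ) * dispCLM b η ψ.1 (n + Finsupp.single i 1) =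
      dispCLM b η (annihilate b (b i) ψ + ⟪b i, η⟫_ℂ • ψ.1) n := by
  classical
  obtain ⟨x, rfl⟩ := toNumDom_surjective ψ
  have key : (Real.sqrt (n i + 1) : ℂ) •
        (innerSL ℂ (numState (n + Finsupp.single i 1) : numDom ι).1 ∘L
          dispCLM b η ∘L numWeight ι) =
      innerSL ℂ (numState n : numDom ι).1 ∘L dispCLM b η ∘L
        (annWeight b (b i) + ⟪b i, η⟫_ℂ • numWeight ι) := by
    refine ContinuousLinearMap.ext_on (dense_span_expVecW b) ?_
    rintro _ ⟨f, rfl⟩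
    simp only [_root_.smul_apply, ContinuousLinearMap.comp_apply,
      _root_.add_apply, innerSL_apply_apply, inner_numState, annWeight_apply]
    rw [← coe_toNumDom, ← expVec, annihilate_expVec, ← add_smul, map_smul, dispCLM_expVec]
    simp only [lp.coeFn_smul, Pi.smul_apply, smul_eq_mul, expVec_apply]
    rw [mul_left_comm, expCoeff_add_single, b.repr_apply_apply, inner_add_right]
    ring
  have h := congrArg (fun L : Fock ι →L[ℂ] ℂ => L x) key
  simpa only [coe_toNumDom, _root_.smul_apply, ContinuousLinearMap.comp_apply, smul_eq_mul,
    _root_.add_apply, innerSL_apply_apply, inner_numState, annWeight_apply] using h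

theorem hasSum_norm_annihilate_sq (b : HilbertBasis ι ℂ H) (ψ : numDom ι) :
    HasSum (fun i => ‖annihilate b (b i) ψ‖ ^ 2) (numExp ψ) := by
  have h1 := (Equiv.prodComm _ _).hasSum_iff.2 (hasSum_numExp_shift ψ)
  refine h1.prod_fiberwise fun i => ?_
  refine (hasSum_congr fun n => ?_).1 (Fock.hasSum_norm_sq (annihilate b (b i) ψ))
  rw [annihilate_apply, ← b.repr_apply_apply, annVec, LinearIsometryEquiv.apply_symm_apply]
  exact norm_sqrt_mul_sq _ _

/-- By the coordinate relation, the particle number of D_η ψ is ∑_i ‖D_η(a(e_i)ψ + η_i ψ)‖², at most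
twice the particle number of ψ plus 2‖η‖²‖ψ‖². -/
theorem dispCLM_mem (b : HilbertBasis ι ℂ H) (η : H) (ψ : numDom ι) :
    dispCLM b η ψ.1 ∈ numDom ι := by
  set ξ := dispCLM b η ψ.1
  suffices h : Summable fun p : (ι →₀ ℕ) × ι =>
      ((p.1 p.2 : ℝ) + 1) * ‖ξ (p.1 + Finsupp.single p.2 1)‖ ^ 2 from
    ((hasSum_single_mul_sq_iff (F := fun n => ‖ξ n‖ ^ 2) (fun n => by positivity) _).1
      h.hasSum).summable
  rw [← (Equiv.prodComm _ _).summable_iff]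
  have hf : ∀ i, HasSum (fun n : ι →₀ ℕ =>
      ((n i : ℝ) + 1) * ‖ξ (n + Finsupp.single i 1)‖ ^ 2)
      (‖dispCLM b η (annihilate b (b i) ψ + ⟪b i, η⟫_ℂ • ψ.1)‖ ^ 2) := fun i => by
    refine (hasSum_congr fun n => ?_).1 (Fock.hasSum_norm_sq _)
    rw [← dispCLM_apply_add_single, norm_sqrt_mul_sq]
  refine (summable_prod_of_nonneg fun p => mul_nonneg (by positivity) (sq_nonneg _)).2 ⟨fun i => (hf i).summable, ?_⟩
  refine Summable.of_nonneg_of_le (fun i => tsum_nonneg fun n => mul_nonneg (by positivity) (sq_nonneg _))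
    (fun i => ?_)
    (((hasSum_norm_annihilate_sq b ψ).summable.mul_left 2).add
      ((summable_coeff b η).mul_left (2 * ‖ψ.1‖ ^ 2)))
  refine (hf i).tsum_eq.trans_le ?_
  have h1 := norm_dispCLM_le b η (annihilate b (b i) ψ + ⟪b i, η⟫_ℂ • ψ.1)
  have h2 := norm_add_le (annihilate b (b i) ψ) (⟪b i, η⟫_ℂ • ψ.1)
  rw [norm_smul, ← b.repr_apply_apply] at h2
  rw [← b.repr_apply_apply] at h1 ⊢
  have h3 := pow_le_pow_left₀ (norm_nonneg _) (h1.trans h2) 2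
  nlinarith [sq_nonneg (‖annihilate b (b i) ψ‖ - ‖b.repr η i‖ * ‖ψ.1‖)]

/-- With domain invariance available, the commutation rule is tested weakly: a creation operator on
the test vector absorbs a(g), leaving bounded functionals that agree on exponential vectors. -/
theorem annihilate_dispCLM (b : HilbertBasis ι ℂ H) (η g : H) (ψ : numDom ι) :
    annihilate b g ⟨dispCLM b η ψ.1, dispCLM_mem b η ψ⟩ =
      dispCLM b η (annihilate b g ψ + ⟪g, η⟫_ℂ • ψ.1) := by
  refine Fock.ext_inner fun u => ?_
  rw [← inner_create_left]
  obtain ⟨x, rfl⟩ := toNumDom_surjective ψ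
  have key : innerSL ℂ (create b g u) ∘L dispCLM b η ∘L numWeight ι =
      innerSL ℂ u.1 ∘L dispCLM b η ∘L (annWeight b g + ⟪g, η⟫_ℂ • numWeight ι) := by
    refine ContinuousLinearMap.ext_on (dense_span_expVecW b) ?_
    rintro _ ⟨f, rfl⟩
    simp only [_root_.smul_apply, ContinuousLinearMap.comp_apply,
      _root_.add_apply, innerSL_apply_apply, annWeight_apply]
    rw [← coe_toNumDom, ← expVec, annihilate_expVec, ← add_smul, map_smul, dispCLM_expVec,
      inner_smul_right, inner_create_left, annihilate_expVec, inner_smul_right, inner_smul_right,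
      inner_smul_right, inner_add_right]
    ring
  exact congrArg (fun L : Fock ι →L[ℂ] ℂ => L x) key

/-- Weyl transformations exist for every parameter; the annihilation operators transform
accordingly. -/
theorem exists_isWeyl (b : HilbertBasis ι ℂ H) (η : H) :
    ∃ (W : Fock ι ≃ₗᵢ[ℂ] Fock ι) (hW : IsWeyl b η W), IsWeyl b (-η) W.symm ∧
      ∀ (f : H) (ψ : numDom ι), annihilate b f ⟨W.symm ψ.1, hW.symm_mem ψ.1 ψ.2⟩ =
        W.symm (annihilate b f ψ + ⟪f, η⟫_ℂ • ψ.1) := by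
  -- Since D_η^* a(g) D_η = a(g) + ⟨g,η⟩, the Weyl transformation with parameter η is D_{-η}, with
  -- inverse D_η. The rule for creation operators follows by taking adjoints.
  have key : ∀ η : H, IsWeyl b η (disp b (-η)) := fun η =>
    { map_mem := fun ψ hψ => dispCLM_mem b (-η) ⟨ψ, hψ⟩
      symm_mem := fun ψ hψ => dispCLM_mem b (- -η) ⟨ψ, hψ⟩
      conj_create := fun f ψ hψ => by
        have hs : ∀ ξ : Fock ι, ξ ∈ numDom ι → (disp b (-η)).symm ξ ∈ numDom ι :=
          fun ξ hξ => dispCLM_mem b (- -η) ⟨ξ, hξ⟩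
        refine Fock.ext_inner fun u => ?_
        have h1 : annihilate b f ⟨(disp b (-η)).symm u.1, hs _ u.2⟩ =
            (disp b (-η)).symm (annihilate b f u + ⟪f, - -η⟫_ℂ • u.1) :=
          annihilate_dispCLM b (- -η) f u
        rw [← (disp b (-η)).symm.inner_map_map, LinearIsometryEquiv.symm_apply_apply]
        have h2 := inner_annihilate_left b f ⟨(disp b (-η)).symm u.1, hs _ u.2⟩
          ⟨(disp b (-η)).symm ψ, hs _ hψ⟩
        rw [← h2, h1, LinearIsometryEquiv.inner_map_map, inner_add_left, inner_smul_left,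
          neg_neg, inner_conj_symm, inner_add_right, inner_smul_right]
        rw [inner_annihilate_left b f u ⟨ψ, hψ⟩] }
  have e : (disp b (-η)).symm = disp b (- -η) := by
    ext1 ψ
    rfl
  refine ⟨disp b (-η), key η, e ▸ key (-η), fun f ψ => ?_⟩
  have h := annihilate_dispCLM b (- -η) f ψ
  rw [show ⟪f, η⟫_ℂ = ⟪f, - -η⟫_ℂ by rw [neg_neg]]
  exact h

end Weyl

/-! ### Self-adjoint operators from coercive forms -/

section FormOperator

variable {E : Type*} [NormedAddCommGroup E] [InnerProductSpace ℂ E]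

theorem inner_self_ofReal (x : E) : ⟪x, x⟫_ℂ = ((‖x‖ ^ 2 : ℝ) : ℂ) := by
  rw [inner_self_eq_norm_sq_to_K]
  norm_cast

/-- `A` is the operator associated with the form `⟨G x, A (G x)⟩ = ⟨x, B x⟩`, whose form domain is
the range of `G`. -/
structure IsFormOperator (A : E →ₗ.[ℂ] E) (G B : E →L[ℂ] E) : Prop where
  symm_left : ∀ x y, ⟪G x, y⟫_ℂ = ⟪x, G y⟫_ℂ
  symm_right : ∀ x y, ⟪B x, y⟫_ℂ = ⟪x, B y⟫_ℂ
  injective : Function.Injective G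
  mem_graph : ∀ u ξ, (u, ξ) ∈ A.graph ↔ ∃ x, G x = u ∧ G ξ = B x
  coercive : ∃ δ : ℝ, 0 < δ ∧ ∀ x, δ * ‖x‖ ^ 2 ≤ (⟪x, B x⟫_ℂ).re + ‖G x‖ ^ 2

namespace IsFormOperator

variable {A : E →ₗ.[ℂ] E} {G B : E →L[ℂ] E}

theorem inner_sub (h : IsFormOperator A G B) (t : ℝ) (x : E) :
    (⟪x, B x - (t : ℂ) • G (G x)⟫_ℂ).re = (⟪x, B x⟫_ℂ).re - t * ‖G x‖ ^ 2 := by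
  rw [inner_sub_right, inner_smul_right, ← h.symm_left, inner_self_ofReal,
    Complex.sub_re, Complex.re_ofReal_mul, Complex.ofReal_re]

theorem symmetric (h : IsFormOperator A G B) {u ξ v ζ : E} (hu : (u, ξ) ∈ A.graph)
    (hv : (v, ζ) ∈ A.graph) : ⟪ξ, v⟫_ℂ = ⟪u, ζ⟫_ℂ := by
  obtain ⟨x, rfl, hx⟩ := (h.mem_graph _ _).1 hu
  obtain ⟨y, rfl, hy⟩ := (h.mem_graph _ _).1 hv
  rw [← h.symm_left, hx, h.symm_left, hy, h.symm_right]

variable [CompleteSpace E]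

/-- If u = G x and G ξ = B x, then G(ξ − t u) = K x with K = B − t G². Coercivity makes K invertible
(Lax–Milgram), and the resolvent at t is G K⁻¹ G. -/
theorem exists_resolvent (h : IsFormOperator A G B) {t δ : ℝ} (hδ : 0 < δ)
    (hc : ∀ x, δ * ‖x‖ ^ 2 ≤ (⟪x, B x⟫_ℂ).re - t * ‖G x‖ ^ 2) :
    ∃ R : E →L[ℂ] E, (∀ v, (R v, v + (t : ℂ) • R v) ∈ A.graph) ∧
      ∀ u ξ, (u, ξ) ∈ A.graph → R (ξ - (t : ℂ) • u) = u := by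
  set K : E →L[ℂ] E := B - (t : ℂ) • (G ∘L G) with hK
  have hKx : ∀ x, K x = B x - (t : ℂ) • G (G x) := fun x => rfl
  have hu : IsUnit K := by
    refine ContinuousLinearMap.isUnit_of_forall_le_norm_inner_map K (c := ⟨δ, hδ.le⟩) hδ
      fun x => ?_
    have h1 := hc x
    rw [← h.inner_sub, ← hKx] at h1
    have h2 := (Complex.re_le_norm ⟪x, K x⟫_ℂ)
    rw [norm_inner_symm, mul_comm]
    exact h1.trans h2
  obtain ⟨U, hU⟩ := hu
  have hl : ∀ x, (U⁻¹ : (E →L[ℂ] E)ˣ).1 (K x) = x := fun x => by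
    rw [← hU]
    exact congrArg (fun L : E →L[ℂ] E => L x) U.inv_mul
  have hr : ∀ x, K ((U⁻¹ : (E →L[ℂ] E)ˣ).1 x) = x := fun x => by
    rw [← hU]
    exact congrArg (fun L : E →L[ℂ] E => L x) U.mul_inv
  refine ⟨G ∘L (U⁻¹ : (E →L[ℂ] E)ˣ).1 ∘L G, fun v => ?_, fun u ξ hm => ?_⟩
  · rw [h.mem_graph]
    refine ⟨(U⁻¹ : (E →L[ℂ] E)ˣ).1 (G v), rfl, ?_⟩
    have h1 := hr (G v)
    rw [hKx] at h1
    simp only [ContinuousLinearMap.comp_apply, map_add, map_smul]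
    nth_rewrite 1 [← h1]
    rw [sub_add_cancel]
  · obtain ⟨x, rfl, hx⟩ := (h.mem_graph u ξ).1 hm
    simp only [ContinuousLinearMap.comp_apply]
    rw [map_sub, map_smul, hx, ← hKx, hl]

theorem exists_resolvent_neg_one (h : IsFormOperator A G B) :
    ∃ R : E →L[ℂ] E, ∀ v, (R v, v - R v) ∈ A.graph := by
  obtain ⟨δ, hδ, hc⟩ := h.coercive
  obtain ⟨R, hR, -⟩ := h.exists_resolvent (t := -1) hδ fun x => by
    have := hc x; linarith
  refine ⟨R, fun v => ?_⟩
  have := hR v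
  simpa [sub_eq_add_neg] using this

/-- Let y be orthogonal to the domain and R y = G x. Then ⟨x, B x⟩ = ⟨R y, y − R y⟩ = −‖G x‖², so
coercivity gives x = 0, then G y = 0 and y = 0. -/
theorem dense_domain (h : IsFormOperator A G B) : Dense (A.domain : Set E) := by
  obtain ⟨R, hR⟩ := h.exists_resolvent_neg_one
  rw [Submodule.dense_iff_topologicalClosure_eq_top, Submodule.topologicalClosure_eq_top_iff,
    Submodule.eq_bot_iff]
  intro y hy
  have h1 : R y ∈ A.domain := LinearPMap.mem_domain_of_mem_graph (hR y)
  have h2 : ⟪R y, y⟫_ℂ = 0 := Submodule.inner_right_of_mem_orthogonal h1 hy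
  obtain ⟨x, hx, hx2⟩ := (h.mem_graph _ _).1 (hR y)
  obtain ⟨δ, hδ, hc⟩ := h.coercive
  have h3 := hc x
  rw [← hx2, ← h.symm_left, hx, inner_sub_right, h2, zero_sub, inner_self_ofReal,
    Complex.neg_re, Complex.ofReal_re] at h3
  have h5 : ‖x‖ ^ 2 ≤ 0 := by nlinarith
  have h6 : x = 0 := by
    have : ‖x‖ = 0 := by nlinarith [norm_nonneg x]
    exact norm_eq_zero.1 this
  rw [h6, map_zero] at hx hx2
  rw [← hx, sub_zero] at hx2
  exact (map_eq_zero_iff G h.injective).1 hx2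

/-- A is symmetric and A + 1 is onto. For y in the domain of the adjoint put z = A^* y + y; then y −
R z is orthogonal to the range of A + 1, hence y = R z lies in the domain of A. -/
theorem isSelfAdjoint (h : IsFormOperator A G B) : IsSelfAdjoint A := by
  have hd := h.dense_domain
  obtain ⟨R, hR⟩ := h.exists_resolvent_neg_one
  rw [LinearPMap.isSelfAdjoint_def]
  have hformal : A.IsFormalAdjoint A := fun x y =>
    h.symmetric (LinearPMap.mem_graph A x) (LinearPMap.mem_graph A y)
  have h1 : A ≤ A.adjoint := hformal.le_adjoint hd
  refine (LinearPMap.eq_of_le_of_domain_eq h1 (le_antisymm h1.1 fun y hy => ?_)).symm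
  set z := A.adjoint ⟨y, hy⟩ + y with hz
  have h2 : ∀ v, ⟪y - R z, v⟫_ℂ = 0 := by
    intro v
    have hm := hR v
    obtain ⟨w, hw1, hw2⟩ := (LinearPMap.mem_graph_iff A).1 hm
    have h3 := LinearPMap.adjoint_isFormalAdjoint hd ⟨y, hy⟩ w
    have h4 := h.symmetric (hR z) hm
    simp only at hw1 hw2 h3
    rw [hw1, hw2] at h3
    rw [inner_sub_left, inner_sub_right, hz, inner_add_left] at h4
    rw [inner_sub_right] at h3
    rw [inner_sub_left]
    linear_combination h4 - h3
  have h5 : y - R z = 0 := inner_self_eq_zero.1 (h2 _)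
  rw [sub_eq_zero.1 h5]
  exact LinearPMap.mem_domain_of_mem_graph (hR z)

/-- The form P = B − m G² is nonnegative with infimum zero on ‖G x‖ = 1. A resolvent R at m, applied
to G x for an approximate minimiser x, would yield z with ⟨z, P x⟩ = 1 and ⟨z, P z⟩ ≤ ‖R‖,
contradicting Cauchy–Schwarz for P once ⟨x, P x⟩ is small. Below m the form stays coercive, so a
resolvent exists there. -/
theorem isLeast_spectrum (h : IsFormOperator A G B) {m : ℝ}
    (hm : ∀ x, m * ‖G x‖ ^ 2 ≤ (⟪x, B x⟫_ℂ).re)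
    (hm' : ∀ ε > 0, ∃ x, ‖G x‖ = 1 ∧ (⟪x, B x⟫_ℂ).re < m + ε) :
    IsLeast {t : ℝ | (t : ℂ) ∈ opSpectrum A} m := by
  constructor
  · rintro ⟨R, hR, -⟩
    obtain ⟨x, hx1, hx2⟩ := hm' (1 / (‖R‖ + 1)) (by positivity)
    obtain ⟨hd, hA⟩ := hR (G x)
    have hg : (R (G x), G x + (m : ℂ) • R (G x)) ∈ A.graph :=
      (LinearPMap.mem_graph_iff A).2 ⟨⟨_, hd⟩, rfl, by
        change A ⟨R (G x), hd⟩ = G x + (m : ℂ) • R (G x)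
        rw [← sub_eq_iff_eq_add]; exact hA⟩
    obtain ⟨z, hz1, hz2⟩ := (h.mem_graph _ _).1 hg
    have hz3 : B z - (m : ℂ) • G (G z) = G (G x) := by
      rw [← hz2, ← hz1, map_add, map_smul, add_sub_cancel_right]
    set P : E →L[ℂ] E := B - (m : ℂ) • (G ∘L G) with hP
    have hPx : ∀ x, P x = B x - (m : ℂ) • G (G x) := fun x => rfl
    have hPs : ∀ x y, ⟪P x, y⟫_ℂ = ⟪x, P y⟫_ℂ := fun x y => by
      rw [hPx, hPx, inner_sub_left, inner_sub_right, h.symm_right, inner_smul_left,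
        inner_smul_right, h.symm_left, h.symm_left, Complex.conj_ofReal]
    have hP0 : ∀ x, 0 ≤ (⟪x, P x⟫_ℂ).re := fun x => by
      rw [hPx, h.inner_sub]
      linarith [hm x]
    have e1 : (⟪z, P x⟫_ℂ).re = 1 := by
      rw [← hPs, hPx, hz3, h.symm_left, inner_self_eq_norm_sq_to_K, hx1]
      simp
    have e2 : (⟪x, P z⟫_ℂ).re = 1 := by
      rw [← hPs, ← inner_conj_symm, Complex.conj_re, e1]
    have e3 : (⟪z, P z⟫_ℂ).re ≤ ‖R‖ := by
      rw [hPx, hz3, ← h.symm_left, hz1]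
      refine (Complex.re_le_norm _).trans ((norm_inner_le_norm _ _).trans ?_)
      have := R.le_opNorm (G x)
      rw [hx1, mul_one] at this ⊢
      exact this
    have e4 : (⟪x, P x⟫_ℂ).re < 1 / (‖R‖ + 1) := by
      rw [hPx, h.inner_sub, hx1]
      linarith
    -- Cauchy–Schwarz for P in the form of positivity at one vector. The value is below ‖R‖ − 2(‖R‖
    -- + 1) + (‖R‖ + 1) = −1, because ⟨x, P x⟩ < 1/(‖R‖ + 1).
    have e5 := hP0 (z - ((‖R‖ + 1 : ℝ) : ℂ) • x)
    rw [map_sub, map_smul, inner_sub_left, inner_sub_right, inner_sub_right, inner_smul_left,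
      inner_smul_left, inner_smul_right, inner_smul_right, Complex.conj_ofReal] at e5
    simp only [Complex.sub_re, Complex.re_ofReal_mul] at e5
    rw [e1, e2] at e5
    have h0 : 0 < ‖R‖ + 1 := by positivity
    rw [lt_div_iff₀ h0] at e4
    nlinarith
  · intro t ht
    by_contra! hlt
    apply ht
    obtain ⟨δ, hδ, hc⟩ := h.coercive
    -- Coercivity is weighted with s and the lower bound by m with 1 − s. The combination bounds the
    -- form minus t‖G x‖² below by sδ‖x‖² as soon as s(m + 1) ≤ m − t; the denominator |m| + 2 is
    -- positive and exceeds m + 1.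
    set s := min 1 ((m - t) / (|m| + 2)) with hs
    have hs0 : 0 < s := lt_min one_pos (div_pos (by linarith) (by positivity))
    have hs1 : s ≤ 1 := min_le_left _ _
    have hs2 : s * (m + 1) ≤ m - t := by
      have h1 : s * (|m| + 2) ≤ m - t := by
        rw [← le_div_iff₀ (by positivity)]; exact min_le_right _ _
      nlinarith [le_abs_self m]
    obtain ⟨R, hR, hR'⟩ := h.exists_resolvent (t := t) (mul_pos hs0 hδ) fun x => by
      have h1 := hc x
      have h2 := hm x
      have h3 : 0 ≤ ‖G x‖ ^ 2 := by positivity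
      nlinarith [mul_le_mul_of_nonneg_left h1 hs0.le,
        mul_le_mul_of_nonneg_left h2 (sub_nonneg.2 hs1), mul_le_mul_of_nonneg_right hs2 h3]
    refine ⟨R, fun v => ?_, fun u => hR' _ _ (LinearPMap.mem_graph A u)⟩
    obtain ⟨w, hw1, hw2⟩ := (LinearPMap.mem_graph_iff A).1 (hR v)
    have hd : R v ∈ A.domain := LinearPMap.mem_domain_of_mem_graph (hR v)
    refine ⟨hd, ?_⟩
    have : w = ⟨R v, hd⟩ := Subtype.ext hw1
    rw [this] at hw2
    rw [hw2, add_sub_cancel_right]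

end IsFormOperator

end FormOperator

/-! ### Generalized annihilation operators and one-particle forms -/

section AbstractForm

variable {ι : Type*} {H : Type*} [NormedAddCommGroup H] [InnerProductSpace ℂ H]

/-- `J` is an antiunitary involution. -/
structure IsAntiunitaryInvolution (J : H → H) : Prop where
  invol : ∀ f, J (J f) = f
  inner_map_map : ∀ f g, ⟪J f, J g⟫_ℂ = ⟪g, f⟫_ℂ
  map_add : ∀ f g, J (f + g) = J f + J g
  map_smul : ∀ (z : ℂ) f, J (z • f) = conj z • J f

theorem IsAntiunitaryInvolution.norm_map {J : H → H} (hJ : IsAntiunitaryInvolution J) (f : H) :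
    ‖J f‖ = ‖f‖ := by
  have h := hJ.inner_map_map f f
  rw [inner_self_ofReal, inner_self_ofReal] at h
  exact (pow_left_inj₀ (norm_nonneg _) (norm_nonneg _) two_ne_zero).1 (by exact_mod_cast h)

theorem field_add_left (b : HilbertBasis ι ℂ H) (f g : H) (ψ : numDom ι) :
    field b (f + g) ψ = field b f ψ + field b g ψ := by
  unfold field
  rw [create_add_left, annihilate_add_left]
  abel

theorem field_real_smul_left (b : HilbertBasis ι ℂ H) (t : ℝ) (f : H) (ψ : numDom ι) :
    field b ((t : ℂ) • f) ψ = (t : ℂ) • field b f ψ := by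
  unfold field
  rw [create_smul_left, annihilate_smul_left, Complex.conj_ofReal, smul_add]

theorem norm_field_le (b : HilbertBasis ι ℂ H) (f : H) (ψ : numDom ι) :
    ‖field b f ψ‖ ≤ 2 * √(graphSq ψ) * ‖f‖ := by
  refine (norm_add_le _ _).trans ?_
  linarith [norm_create_le b f ψ, norm_annihilate_le b f ψ]

theorem continuous_field (b : HilbertBasis ι ℂ H) (ψ : numDom ι) :
    Continuous fun f => field b f ψ := by
  refine (LipschitzWith.of_dist_le_mul (K := ⟨2 * √(graphSq ψ), by positivity⟩)
    fun f g => ?_).continuous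
  rw [dist_eq_norm, dist_eq_norm, show f = (f - g) + g by abel, field_add_left,
    add_sub_cancel_right, add_sub_cancel_right]
  exact norm_field_le b _ ψ

theorem inner_field_left (b : HilbertBasis ι ℂ H) (f : H) (χ ψ : numDom ι) :
    ⟪field b f χ, ψ.1⟫_ℂ = ⟪χ.1, field b f ψ⟫_ℂ := by
  unfold field
  rw [inner_add_left, inner_add_right, inner_create_left, inner_annihilate_left]
  ring

theorem genAnnihilate_apply (b : HilbertBasis ι ℂ H) (J : H → H) (F : WithLp 2 (H × H))
    (ψ : numDom ι) :
    genAnnihilate b J F ψ = annihilate b F.fst ψ + create b (J F.snd) ψ := rfl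

/-- This is why the one-particle space is doubled: on vectors q(f) the generalized annihilation
operator is a field operator, so rank-one operators |q(v)⟩⟨q(v)| second-quantize to squares of
fields. -/
theorem genAnnihilate_qMap {J : H → H} (hJ : IsAntiunitaryInvolution J) (b : HilbertBasis ι ℂ H)
    (f : H) (ψ : numDom ι) : genAnnihilate b J (qMap J f) ψ = field b f ψ := by
  rw [genAnnihilate_apply, field, add_comm]
  show create b (J (J f)) ψ + annihilate b f ψ = _
  rw [hJ.invol]

theorem WithLp.norm_fst_le' {H : Type*} [NormedAddCommGroup H] (F : WithLp 2 (H × H)) : ‖F.fst‖ ≤ ‖F‖ := by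
  have h := WithLp.prod_norm_sq_eq_of_L2 F
  refine abs_le_of_sq_le_sq' ?_ (norm_nonneg _) |>.2
  nlinarith [sq_nonneg ‖F.snd‖]

theorem WithLp.norm_snd_le' {H : Type*} [NormedAddCommGroup H] (F : WithLp 2 (H × H)) : ‖F.snd‖ ≤ ‖F‖ := by
  have h := WithLp.prod_norm_sq_eq_of_L2 F
  refine abs_le_of_sq_le_sq' ?_ (norm_nonneg _) |>.2
  nlinarith [sq_nonneg ‖F.fst‖]

theorem WithLp.inner_prod (F G : WithLp 2 (H × H)) :
    ⟪F, G⟫_ℂ = ⟪F.fst, G.fst⟫_ℂ + ⟪F.snd, G.snd⟫_ℂ := rfl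

/-- The orthonormal basis `pairBasis` as a Hilbert basis. -/
def pairHilbertBasis [CompleteSpace H] (b : HilbertBasis ι ℂ H) : HilbertBasis (ι ⊕ ι) ℂ (WithLp 2 (H × H)) :=
  HilbertBasis.mkOfOrthogonalEqBot (v := pairBasis b)
    (by
      classical
      rw [orthonormal_iff_ite]
      have h := orthonormal_iff_ite.1 b.orthonormal
      rintro (i | i) (j | j) <;> simp [pairBasis, h])
    (by
      rw [Submodule.eq_bot_iff]
      intro F hF
      have h : ∀ i, ⟪pairBasis b i, F⟫_ℂ = 0 := fun i =>
        Submodule.inner_right_of_mem_orthogonal (Submodule.subset_span (Set.mem_range_self i)) hF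
      have h1 : F.fst = 0 := by
        apply b.repr.injective
        rw [map_zero]
        ext i
        rw [b.repr_apply_apply]
        have := h (Sum.inl i)
        rw [WithLp.inner_prod] at this
        simpa [pairBasis] using this
      have h2 : F.snd = 0 := by
        apply b.repr.injective
        rw [map_zero]
        ext i
        rw [b.repr_apply_apply]
        have := h (Sum.inr i)
        rw [WithLp.inner_prod] at this
        simpa [pairBasis] using this
      have h3 := WithLp.prod_norm_sq_eq_of_L2 F
      rw [h1, h2] at h3
      simpa using h3)

theorem coe_pairHilbertBasis [CompleteSpace H] (b : HilbertBasis ι ℂ H) : ⇑(pairHilbertBasis b) = pairBasis b :=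
  HilbertBasis.coe_mkOfOrthogonalEqBot _ _

theorem hasSum_pairBasis [CompleteSpace H] (b : HilbertBasis ι ℂ H) (F G : WithLp 2 (H × H)) :
    HasSum (fun i => ⟪F, pairBasis b i⟫_ℂ * ⟪pairBasis b i, G⟫_ℂ) ⟪F, G⟫_ℂ := by
  have h := (pairHilbertBasis b).hasSum_inner_mul_inner F G
  rwa [coe_pairHilbertBasis] at h

theorem HilbertBasis.hasSum_inner_sq {κ E : Type*} [NormedAddCommGroup E] [InnerProductSpace ℂ E]
    (b : HilbertBasis κ ℂ E) (x : E) : HasSum (fun i => ‖⟪b i, x⟫_ℂ‖ ^ 2) (‖x‖ ^ 2) := by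
  refine (hasSum_congr fun i => ?_).1 (hasSum_coeff_sq b x)
  rw [b.repr_apply_apply]

theorem HilbertBasis.summable_prod_inner_sq {κ κ' E : Type*} [NormedAddCommGroup E]
    [InnerProductSpace ℂ E] (b : HilbertBasis κ ℂ E) {u : κ' → E}
    (hu : Summable fun n => ‖u n‖ ^ 2) :
    Summable fun p : κ' × κ => ‖⟪b p.2, u p.1⟫_ℂ‖ ^ 2 := by
  refine (summable_prod_of_nonneg fun p => sq_nonneg _).2
    ⟨fun n => (HilbertBasis.hasSum_inner_sq b (u n)).summable, hu.congr fun n => ?_⟩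
  exact (HilbertBasis.hasSum_inner_sq b (u n)).tsum_eq.symm

theorem HilbertBasis.sum_norm_inner_mul_le {κ E : Type*} [NormedAddCommGroup E]
    [InnerProductSpace ℂ E] (b : HilbertBasis κ ℂ E) (x y : E) (s : Finset κ) :
    ∑ i ∈ s, ‖⟪b i, x⟫_ℂ‖ * ‖⟪b i, y⟫_ℂ‖ ≤ ‖x‖ * ‖y‖ := by
  refine (Real.sum_mul_le_sqrt_mul_sqrt _ _ _).trans ?_
  have h := fun z : E => sum_le_hasSum s (fun i _ => by positivity)
    (HilbertBasis.hasSum_inner_sq b z)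
  refine mul_le_mul ?_ ?_ (by positivity) (by positivity)
  · exact (Real.sqrt_le_sqrt (h x)).trans_eq (Real.sqrt_sq (norm_nonneg _))
  · exact (Real.sqrt_le_sqrt (h y)).trans_eq (Real.sqrt_sq (norm_nonneg _))

theorem norm_genAnnihilate_le {J : H → H} (hJ : IsAntiunitaryInvolution J)
    (b : HilbertBasis ι ℂ H) (F : WithLp 2 (H × H)) (ψ : numDom ι) :
    ‖genAnnihilate b J F ψ‖ ≤ 2 * √(graphSq ψ) * ‖F‖ := by
  rw [genAnnihilate_apply]
  refine (norm_add_le _ _).trans ?_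
  have h1 := norm_create_le b (J F.snd) ψ
  have h2 := norm_annihilate_le b F.fst ψ
  rw [hJ.norm_map] at h1
  have h3 := mul_le_mul_of_nonneg_left (WithLp.norm_fst_le' F) (Real.sqrt_nonneg (graphSq ψ))
  have h4 := mul_le_mul_of_nonneg_left (WithLp.norm_snd_le' F) (Real.sqrt_nonneg (graphSq ψ))
  linarith

/-- The Riesz representative of the functional `F ↦ ⟨A_J(F) ψ, ξ⟩`. -/
theorem exists_riesz_genAnnihilate [CompleteSpace H] {J : H → H} (hJ : IsAntiunitaryInvolution J)
    (b : HilbertBasis ι ℂ H) (ψ : numDom ι) (ξ : Fock ι) :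
    ∃ G : WithLp 2 (H × H), ‖G‖ ≤ 2 * √(graphSq ψ) * ‖ξ‖ ∧
      ∀ F, ⟪genAnnihilate b J F ψ, ξ⟫_ℂ = ⟪G, F⟫_ℂ := by
  let L : WithLp 2 (H × H) →L[ℂ] ℂ := LinearMap.mkContinuous
    { toFun := fun F => ⟪genAnnihilate b J F ψ, ξ⟫_ℂ
      map_add' := fun F G => by
        simp only [genAnnihilate_apply, WithLp.add_fst, WithLp.add_snd, hJ.map_add,
          annihilate_add_left, create_add_left, inner_add_left]
        ring
      map_smul' := fun z F => by
        simp only [genAnnihilate_apply, WithLp.smul_fst, WithLp.smul_snd, hJ.map_smul,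
          annihilate_smul_left, create_smul_left, ← smul_add, inner_smul_left,
          Complex.conj_conj, RingHom.id_apply, smul_eq_mul] }
    (2 * √(graphSq ψ) * ‖ξ‖) (fun F => by
      show ‖⟪genAnnihilate b J F ψ, ξ⟫_ℂ‖ ≤ _
      refine (norm_inner_le_norm (𝕜 := ℂ) _ _).trans ?_
      have := mul_le_mul_of_nonneg_right (norm_genAnnihilate_le hJ b F ψ) (norm_nonneg ξ)
      linarith)
  refine ⟨(InnerProductSpace.toDual ℂ _).symm L, ?_, fun F => ?_⟩
  · rw [LinearIsometryEquiv.norm_map]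
    exact LinearMap.mkContinuous_norm_le _ (by positivity) _
  · exact (InnerProductSpace.toDual_symm_apply (𝕜 := ℂ) (x := F) (y := L)).symm

/-- The Riesz representative of the functional `f ↦ ⟨a(f) ψ, ξ⟩`. -/
theorem exists_riesz_annihilate [CompleteSpace H] (b : HilbertBasis ι ℂ H) (ψ : numDom ι) (ξ : Fock ι) :
    ∃ g : H, ∀ f, ⟪annihilate b f ψ, ξ⟫_ℂ = ⟪g, f⟫_ℂ := by
  let L : H →L[ℂ] ℂ := LinearMap.mkContinuous
    { toFun := fun f => ⟪annihilate b f ψ, ξ⟫_ℂ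
      map_add' := fun F G => by rw [annihilate_add_left, inner_add_left]
      map_smul' := fun z F => by
        rw [annihilate_smul_left, inner_smul_left, Complex.conj_conj, RingHom.id_apply,
          smul_eq_mul] }
    (√(graphSq ψ) * ‖ξ‖) (fun F => by
      show ‖⟪annihilate b F ψ, ξ⟫_ℂ‖ ≤ _
      refine (norm_inner_le_norm (𝕜 := ℂ) _ _).trans ?_
      have := mul_le_mul_of_nonneg_right (norm_annihilate_le b F ψ) (norm_nonneg ξ)
      linarith)
  exact ⟨(InnerProductSpace.toDual ℂ _).symm L, fun F =>
    (InnerProductSpace.toDual_symm_apply (𝕜 := ℂ) (x := F) (y := L)).symm⟩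

/-! ### The second quantization of a one-particle operator -/

/-- The sesquilinear form `⟨χ, dΓ(D) ψ⟩`. -/
def secForm (b : HilbertBasis ι ℂ H) (D : H →L[ℂ] H) (χ ψ : numDom ι) : ℂ :=
  ∑' n, ⟪annVec b χ n, D (annVec b ψ n)⟫_ℂ

theorem norm_secForm_term_le (b : HilbertBasis ι ℂ H) (D : H →L[ℂ] H) (χ ψ : numDom ι)
    (n : ι →₀ ℕ) : ‖⟪annVec b χ n, D (annVec b ψ n)⟫_ℂ‖ ≤
      ‖D‖ * (‖annVec b χ n‖ * ‖annVec b ψ n‖) := by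
  refine (norm_inner_le_norm _ _).trans ?_
  have := mul_le_mul_of_nonneg_left (D.le_opNorm (annVec b ψ n)) (norm_nonneg (annVec b χ n))
  linarith

theorem summable_annVec_mul (b : HilbertBasis ι ℂ H) (χ ψ : numDom ι) :
    Summable fun n => ‖annVec b χ n‖ * ‖annVec b ψ n‖ := by
  refine Summable.of_nonneg_of_le (fun n => by positivity) (fun n => ?_)
    ((hasSum_norm_annVec_sq b χ).summable.add (hasSum_norm_annVec_sq b ψ).summable)
  nlinarith [sq_nonneg (‖annVec b χ n‖ - ‖annVec b ψ n‖), sq_nonneg ‖annVec b χ n‖,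
    sq_nonneg ‖annVec b ψ n‖]

theorem tsum_annVec_mul_le (b : HilbertBasis ι ℂ H) (χ ψ : numDom ι) :
    ∑' n, ‖annVec b χ n‖ * ‖annVec b ψ n‖ ≤ √(numExp χ) * √(numExp ψ) := by
  refine (summable_annVec_mul b χ ψ).tsum_le_of_sum_le fun s => ?_
  refine (Real.sum_mul_le_sqrt_mul_sqrt _ _ _).trans ?_
  gcongr
  · exact sum_le_hasSum s (fun i _ => by positivity) (hasSum_norm_annVec_sq b χ)
  · exact sum_le_hasSum s (fun i _ => by positivity) (hasSum_norm_annVec_sq b ψ)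

theorem summable_secForm (b : HilbertBasis ι ℂ H) (D : H →L[ℂ] H) (χ ψ : numDom ι) :
    Summable fun n => ⟪annVec b χ n, D (annVec b ψ n)⟫_ℂ :=
  Summable.of_norm_bounded ((summable_annVec_mul b χ ψ).mul_left ‖D‖)
    (norm_secForm_term_le b D χ ψ)

theorem norm_secForm_le (b : HilbertBasis ι ℂ H) (D : H →L[ℂ] H) (χ ψ : numDom ι) :
    ‖secForm b D χ ψ‖ ≤ ‖D‖ * (√(graphSq χ) * √(graphSq ψ)) := by
  refine (norm_tsum_le_tsum_norm (summable_secForm b D χ ψ).norm).trans ?_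
  refine ((summable_secForm b D χ ψ).norm.tsum_le_tsum (norm_secForm_term_le b D χ ψ)
    ((summable_annVec_mul b χ ψ).mul_left ‖D‖)).trans ?_
  rw [tsum_mul_left]
  have h : ∀ ψ : numDom ι, √(numExp ψ) ≤ √(graphSq ψ) := fun ψ =>
    Real.sqrt_le_sqrt (le_add_of_nonneg_right (sq_nonneg ‖ψ.1‖))
  refine mul_le_mul_of_nonneg_left ((tsum_annVec_mul_le b χ ψ).trans ?_) (norm_nonneg _)
  exact mul_le_mul (h χ) (h ψ) (Real.sqrt_nonneg _) (Real.sqrt_nonneg _)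

theorem summable_norm_map_annVec_sq (b : HilbertBasis ι ℂ H) (D : H →L[ℂ] H) (ψ : numDom ι) :
    Summable fun n => ‖D (annVec b ψ n)‖ ^ 2 := by
  have h0 : ∀ n, ‖D (annVec b ψ n)‖ ^ 2 ≤ ‖D‖ ^ 2 * ‖annVec b ψ n‖ ^ 2 := fun n => by
    have h2 := D.le_opNorm (annVec b ψ n)
    have h3 := pow_le_pow_left₀ (norm_nonneg (D (annVec b ψ n))) h2 2
    rwa [mul_pow] at h3
  have h1 := (hasSum_norm_annVec_sq b ψ).summable.mul_left (‖D‖ ^ 2)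
  exact Summable.of_nonneg_of_le (fun n => sq_nonneg _) h0 h1

/-- Parseval in the basis e_i at each fixed n, followed by exchanging the sums over n and i; the
double series converges absolutely by Cauchy–Schwarz. -/
theorem hasSum_secForm (b : HilbertBasis ι ℂ H) {D : H →L[ℂ] H}
    (hD : ∀ f g, ⟪D f, g⟫_ℂ = ⟪f, D g⟫_ℂ) (χ ψ : numDom ι) :
    HasSum (fun i => ⟪annihilate b (b i) χ, annihilate b (D (b i)) ψ⟫_ℂ) (secForm b D χ ψ) := by
  let K : (ι →₀ ℕ) × ι → ℂ := fun p =>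
    ⟪annVec b χ p.1, b p.2⟫_ℂ * ⟪b p.2, D (annVec b ψ p.1)⟫_ℂ
  have h1 : ∀ n, HasSum (fun i => K (n, i)) ⟪annVec b χ n, D (annVec b ψ n)⟫_ℂ := fun n =>
    b.hasSum_inner_mul_inner (annVec b χ n) (D (annVec b ψ n))
  have hDn := summable_norm_map_annVec_sq b D ψ
  have hK : Summable K := by
    have h2 := HilbertBasis.summable_prod_inner_sq b (u := fun n => annVec b χ n)
      (hasSum_norm_annVec_sq b χ).summable
    have h3 := HilbertBasis.summable_prod_inner_sq b (u := fun n => D (annVec b ψ n)) hDn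
    refine Summable.of_norm_bounded (h2.add h3) fun p => ?_
    show ‖⟪annVec b χ p.1, b p.2⟫_ℂ * ⟪b p.2, D (annVec b ψ p.1)⟫_ℂ‖ ≤
      ‖⟪b p.2, annVec b χ p.1⟫_ℂ‖ ^ 2 + ‖⟪b p.2, D (annVec b ψ p.1)⟫_ℂ‖ ^ 2
    rw [norm_mul, norm_inner_symm]
    nlinarith [sq_nonneg (‖⟪b p.2, annVec b χ p.1⟫_ℂ‖ - ‖⟪b p.2, D (annVec b ψ p.1)⟫_ℂ‖),
      sq_nonneg ‖⟪b p.2, annVec b χ p.1⟫_ℂ‖, sq_nonneg ‖⟪b p.2, D (annVec b ψ p.1)⟫_ℂ‖]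
  have h2 : HasSum K (secForm b D χ ψ) := by
    have := hK.hasSum.prod_fiberwise h1
    rw [secForm, this.tsum_eq]
    exact hK.hasSum
  have h3 := (Equiv.prodComm ι (ι →₀ ℕ)).hasSum_iff.2 h2
  refine h3.prod_fiberwise fun i => ?_
  refine (hasSum_congr fun n => ?_).1 (lp.hasSum_inner (𝕜 := ℂ) _ _)
  rw [annihilate_apply, annihilate_apply, RCLike.inner_apply, hD, inner_conj_symm, mul_comm]
  rfl

/-- The inner series over j is Parseval applied to the Riesz vector of f ↦ ⟨a(f)ψ, a(e_i)ψ⟩; it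
moves the one-particle operator inside the annihilation operator. -/
theorem secondQuantForm_eq [CompleteSpace H] (b : HilbertBasis ι ℂ H) {D : H →L[ℂ] H}
    (hD : ∀ f g, ⟪D f, g⟫_ℂ = ⟪f, D g⟫_ℂ) (ψ : numDom ι) :
    secondQuantForm b D ψ = (secForm b D ψ ψ).re := by
  unfold secondQuantForm
  congr 1
  refine (tsum_congr fun i => ?_).trans (hasSum_secForm b hD ψ ψ).tsum_eq
  obtain ⟨g, hg⟩ := exists_riesz_annihilate b ψ (annihilate b (b i) ψ)
  have h1 : ∀ f, ⟪annihilate b (b i) ψ, annihilate b f ψ⟫_ℂ = ⟪f, g⟫_ℂ := fun f => by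
    rw [← inner_conj_symm, hg, inner_conj_symm]
  simp only [h1, ← hD]
  exact (b.hasSum_inner_mul_inner _ _).tsum_eq

theorem conj_secForm (b : HilbertBasis ι ℂ H) {D : H →L[ℂ] H}
    (hD : ∀ f g, ⟪D f, g⟫_ℂ = ⟪f, D g⟫_ℂ) (χ ψ : numDom ι) :
    conj (secForm b D χ ψ) = secForm b D ψ χ := by
  unfold secForm
  rw [Complex.conj_tsum]
  exact tsum_congr fun n => by rw [inner_conj_symm, hD]

theorem secForm_add_right (b : HilbertBasis ι ℂ H) (D : H →L[ℂ] H) (χ ψ ψ' : numDom ι) :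
    secForm b D χ (ψ + ψ') = secForm b D χ ψ + secForm b D χ ψ' := by
  unfold secForm
  rw [← (summable_secForm b D χ ψ).tsum_add (summable_secForm b D χ ψ')]
  exact tsum_congr fun n => by rw [annVec_add, map_add, inner_add_right]

theorem secForm_smul_right (b : HilbertBasis ι ℂ H) (D : H →L[ℂ] H) (z : ℂ) (χ ψ : numDom ι) :
    secForm b D χ (z • ψ) = z * secForm b D χ ψ := by
  unfold secForm
  rw [← tsum_mul_left]
  exact tsum_congr fun n => by rw [annVec_smul, map_smul, inner_smul_right]

theorem le_secForm (b : HilbertBasis ι ℂ H) {D : H →L[ℂ] H} {m : ℝ}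
    (hm : ∀ f, m * ‖f‖ ^ 2 ≤ (⟪f, D f⟫_ℂ).re) (ψ : numDom ι) :
    m * numExp ψ ≤ (secForm b D ψ ψ).re :=
  hasSum_le (fun _ => hm _) ((hasSum_norm_annVec_sq b ψ).mul_left m)
    (Complex.hasSum_re (summable_secForm b D ψ ψ).hasSum)

end AbstractForm

/-! ### Second quantization of an integral of rank-one operators -/

section FormKernel

variable {ι : Type*} {H : Type*} [NormedAddCommGroup H] [InnerProductSpace ℂ H]
  {X : Type*} [MeasurableSpace X]

theorem norm_qMap_le {J : H → H} (hJ : IsAntiunitaryInvolution J) (f : H) :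
    ‖qMap J f‖ ≤ 2 * ‖f‖ := by
  have h := WithLp.prod_norm_sq_eq_of_L2 (qMap J f)
  have h1 : ‖(qMap J f).fst‖ = ‖f‖ := rfl
  have h2 : ‖(qMap J f).snd‖ = ‖f‖ := hJ.norm_map f
  rw [h1, h2] at h
  refine abs_le_of_sq_le_sq' ?_ (by positivity) |>.2
  nlinarith [sq_nonneg ‖f‖]

theorem IsAntiunitaryInvolution.map_zero {J : H → H} (hJ : IsAntiunitaryInvolution J) :
    J 0 = 0 := by
  rw [← norm_eq_zero, hJ.norm_map, norm_zero]

theorem IsAntiunitaryInvolution.continuous {J : H → H} (hJ : IsAntiunitaryInvolution J) :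
    Continuous J := by
  refine (LipschitzWith.of_dist_le_mul (K := 1) fun f g => ?_).continuous
  rw [dist_eq_norm, dist_eq_norm, show f = (f - g) + g by abel, hJ.map_add,
    add_sub_cancel_right, add_sub_cancel_right, hJ.norm_map]
  simp

theorem continuous_qMap {J : H → H} (hJ : IsAntiunitaryInvolution J) : Continuous (qMap J) :=
  (WithLp.prod_continuous_toLp 2 H H).comp (continuous_id.prodMk hJ.continuous)

theorem genAnnihilate_toLp_zero_right {J : H → H} (hJ : IsAntiunitaryInvolution J)
    (b : HilbertBasis ι ℂ H) (f : H) (ψ : numDom ι) :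
    genAnnihilate b J (WithLp.toLp 2 (f, 0)) ψ = annihilate b f ψ := by
  rw [genAnnihilate_apply]
  show annihilate b f ψ + create b (J 0) ψ = _
  have h := create_smul_left b 0 (0 : H) ψ
  rw [zero_smul, zero_smul] at h
  rw [hJ.map_zero, h, add_zero]

/-- `T` is the operator on `H ⊕ H` with
`⟨F, T G⟩ = ⟨F₁, D G₁⟩ + ∫ ⟨F, q(v_x)⟩ ⟨q(v_x), G⟩ dν(x)`, where `J v_x = v_x`. -/
structure IsFormKernel (ν : Measure X) (J : H → H) (D : H →L[ℂ] H) (v : X → H)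
    (T : WithLp 2 (H × H) →L[ℂ] WithLp 2 (H × H)) : Prop where
  involution : IsAntiunitaryInvolution J
  real : ∀ x, J (v x) = v x
  aestronglyMeasurable : AEStronglyMeasurable v ν
  integrable_sq : Integrable (fun x => ‖v x‖ ^ 2) ν
  symm : ∀ f g, ⟪D f, g⟫_ℂ = ⟪f, D g⟫_ℂ
  inner_map : ∀ F G, ⟪F, T G⟫_ℂ = ⟪F.fst, D G.fst⟫_ℂ +
    ∫ x, ⟪F, qMap J (v x)⟫_ℂ * ⟪qMap J (v x), G⟫_ℂ ∂ν

/-- The sesquilinear form `⟨χ, dΓ(D) ψ⟩ + ∫ ⟨A(v_x) χ, A(v_x) ψ⟩ dν(x)`, where `A(f)` is the field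
operator. -/
def fieldForm (b : HilbertBasis ι ℂ H) (ν : Measure X) (D : H →L[ℂ] H) (v : X → H)
    (χ ψ : numDom ι) : ℂ :=
  secForm b D χ ψ + ∫ x, ⟪field b (v x) χ, field b (v x) ψ⟫_ℂ ∂ν

namespace IsFormKernel

variable {ν : Measure X} {J : H → H} {D : H →L[ℂ] H} {v : X → H}
  {T : WithLp 2 (H × H) →L[ℂ] WithLp 2 (H × H)}

theorem norm_inner_field_le (b : HilbertBasis ι ℂ H) (χ ψ : numDom ι) (f : H) :
    ‖⟪field b f χ, field b f ψ⟫_ℂ‖ ≤ 4 * (√(graphSq χ) * √(graphSq ψ)) * ‖f‖ ^ 2 := by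
  refine (norm_inner_le_norm _ _).trans ?_
  refine (mul_le_mul (norm_field_le b f χ) (norm_field_le b f ψ) (norm_nonneg _)
    (by positivity)).trans_eq ?_
  ring

theorem integrable_inner_field (h : IsFormKernel ν J D v T) (b : HilbertBasis ι ℂ H)
    (χ ψ : numDom ι) : Integrable (fun x => ⟪field b (v x) χ, field b (v x) ψ⟫_ℂ) ν := by
  refine (h.integrable_sq.const_mul (4 * (√(graphSq χ) * √(graphSq ψ)))).mono'
    (((continuous_field b χ).comp_aestronglyMeasurable h.aestronglyMeasurable).inner
      ((continuous_field b ψ).comp_aestronglyMeasurable h.aestronglyMeasurable))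
    (Filter.Eventually.of_forall fun x => norm_inner_field_le b χ ψ (v x))

theorem fieldForm_add_right (h : IsFormKernel ν J D v T) (b : HilbertBasis ι ℂ H)
    (χ ψ ψ' : numDom ι) :
    fieldForm b ν D v χ (ψ + ψ') = fieldForm b ν D v χ ψ + fieldForm b ν D v χ ψ' := by
  have e : ∀ x, ⟪field b (v x) χ, field b (v x) (ψ + ψ')⟫_ℂ =
      ⟪field b (v x) χ, field b (v x) ψ⟫_ℂ + ⟪field b (v x) χ, field b (v x) ψ'⟫_ℂ := fun x => by
    rw [← inner_add_right]
    congr 1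
    unfold field
    rw [map_add, map_add]
    abel
  unfold fieldForm
  simp only [e]
  rw [integral_add (h.integrable_inner_field b χ ψ) (h.integrable_inner_field b χ ψ'),
    secForm_add_right]
  ring

theorem fieldForm_smul_right (b : HilbertBasis ι ℂ H) (z : ℂ) (χ ψ : numDom ι) :
    fieldForm b ν D v χ (z • ψ) = z * fieldForm b ν D v χ ψ := by
  have e : ∀ x, ⟪field b (v x) χ, field b (v x) (z • ψ)⟫_ℂ =
      z * ⟪field b (v x) χ, field b (v x) ψ⟫_ℂ := fun x => by
    rw [← inner_smul_right]
    congr 1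
    unfold field
    rw [map_smul, map_smul, smul_add]
  unfold fieldForm
  simp only [e]
  rw [integral_const_mul, secForm_smul_right]
  ring

theorem conj_fieldForm (h : IsFormKernel ν J D v T) (b : HilbertBasis ι ℂ H) (χ ψ : numDom ι) :
    conj (fieldForm b ν D v χ ψ) = fieldForm b ν D v ψ χ := by
  unfold fieldForm
  rw [map_add, conj_secForm b h.symm, ← integral_conj]
  simp only [inner_conj_symm]

theorem norm_fieldForm_le (h : IsFormKernel ν J D v T) (b : HilbertBasis ι ℂ H)
    (χ ψ : numDom ι) : ‖fieldForm b ν D v χ ψ‖ ≤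
      (‖D‖ + 4 * ∫ x, ‖v x‖ ^ 2 ∂ν) * (√(graphSq χ) * √(graphSq ψ)) := by
  refine (norm_add_le _ _).trans ?_
  have h1 := norm_integral_le_of_norm_le
    (h.integrable_sq.const_mul (4 * (√(graphSq χ) * √(graphSq ψ))))
    (Filter.Eventually.of_forall fun x => norm_inner_field_le b χ ψ (v x))
  rw [integral_const_mul] at h1
  have h2 := norm_secForm_le b D χ ψ
  linarith

theorem fieldForm_self_re (b : HilbertBasis ι ℂ H)
    (ψ : numDom ι) : (fieldForm b ν D v ψ ψ).re =
      (secForm b D ψ ψ).re + ∫ x, ‖field b (v x) ψ‖ ^ 2 ∂ν := by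
  unfold fieldForm
  rw [Complex.add_re]
  congr 1
  simp only [inner_self_ofReal]
  rw [integral_complex_ofReal, Complex.ofReal_re]

theorem integrable_norm_field_sq (h : IsFormKernel ν J D v T) (b : HilbertBasis ι ℂ H)
    (ψ : numDom ι) : Integrable (fun x => ‖field b (v x) ψ‖ ^ 2) ν := by
  have := (h.integrable_inner_field b ψ ψ).re
  refine this.congr (Filter.Eventually.of_forall fun x => ?_)
  show (⟪field b (v x) ψ, field b (v x) ψ⟫_ℂ).re = _
  rw [inner_self_ofReal, Complex.ofReal_re]

theorem hasSum_genAnnihilate_fst (h : IsFormKernel ν J D v T) (b : HilbertBasis ι ℂ H)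
    (χ ψ : numDom ι) :
    HasSum (fun i => ⟪genAnnihilate b J (pairBasis b i) χ,
      annihilate b (D (pairBasis b i).fst) ψ⟫_ℂ) (secForm b D χ ψ) := by
  refine (Function.Injective.hasSum_iff (Sum.inl_injective (α := ι) (β := ι)) ?_).1
    ((hasSum_congr fun i => ?_).1 (hasSum_secForm b h.symm χ ψ))
  · rintro (i | i) hi
    · exact absurd ⟨i, rfl⟩ hi
    · have e : (pairBasis b (Sum.inr i)).fst = 0 := rfl
      have e2 := annihilate_smul_left b 0 (0 : H) ψ
      rw [zero_smul, map_zero, zero_smul] at e2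
      rw [e, map_zero, e2, inner_zero_right]
  · show _ = ⟪genAnnihilate b J (WithLp.toLp 2 (b i, 0)) χ, annihilate b (D (b i)) ψ⟫_ℂ
    rw [genAnnihilate_toLp_zero_right h.involution]

variable [CompleteSpace H]

/-- For fixed i the map F ↦ ⟨A_J(F_i)χ, A_J(F)ψ⟩ is ⟨F, G⟩ for a vector G, so the sum over j is
⟨F_i, T G⟩ by Parseval. The kernel representation of T then splits it into its two parts. -/
theorem hasSum_quadTerm (h : IsFormKernel ν J D v T) (b : HilbertBasis ι ℂ H) (χ ψ : numDom ι)
    (i : ι ⊕ ι) : HasSum (fun j => quadTerm b J T χ ψ i j)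
      (⟪genAnnihilate b J (pairBasis b i) χ, annihilate b (D (pairBasis b i).fst) ψ⟫_ℂ +
        ∫ x, ⟪pairBasis b i, qMap J (v x)⟫_ℂ *
          ⟪genAnnihilate b J (pairBasis b i) χ, field b (v x) ψ⟫_ℂ ∂ν) := by
  obtain ⟨G, -, hG⟩ := exists_riesz_genAnnihilate h.involution b ψ
    (genAnnihilate b J (pairBasis b i) χ)
  have hG' : ∀ F, ⟪genAnnihilate b J (pairBasis b i) χ, genAnnihilate b J F ψ⟫_ℂ = ⟪F, G⟫_ℂ :=
    fun F => by rw [← inner_conj_symm, hG, inner_conj_symm]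
  have h1 := hasSum_pairBasis b (T.adjoint (pairBasis b i)) G
  rw [ContinuousLinearMap.adjoint_inner_left, h.inner_map] at h1
  have e1 : ⟪genAnnihilate b J (pairBasis b i) χ, annihilate b (D (pairBasis b i).fst) ψ⟫_ℂ =
      ⟪(pairBasis b i).fst, D G.fst⟫_ℂ := by
    rw [← genAnnihilate_toLp_zero_right h.involution, hG', WithLp.inner_prod, ← h.symm]
    simp
  have e2 : ∀ x, ⟪genAnnihilate b J (pairBasis b i) χ, field b (v x) ψ⟫_ℂ =
      ⟪qMap J (v x), G⟫_ℂ := fun x => by rw [← genAnnihilate_qMap h.involution, hG']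
  rw [e1]
  simp only [e2]
  refine (hasSum_congr fun j => ?_).1 h1
  rw [ContinuousLinearMap.adjoint_inner_left, quadTerm, hG']

theorem hasSum_genAnnihilate (h : IsFormKernel ν J D v T) (b : HilbertBasis ι ℂ H)
    (χ : numDom ι) (ξ : Fock ι) (f : H) :
    HasSum (fun i => ⟪pairBasis b i, qMap J f⟫_ℂ * ⟪genAnnihilate b J (pairBasis b i) χ, ξ⟫_ℂ)
      ⟪field b f χ, ξ⟫_ℂ := by
  obtain ⟨G, -, hG⟩ := exists_riesz_genAnnihilate h.involution b χ ξ
  rw [← genAnnihilate_qMap h.involution, hG]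
  refine (hasSum_congr fun i => ?_).1 (hasSum_pairBasis b G (qMap J f))
  rw [hG, mul_comm]

theorem sum_norm_genAnnihilate_le (h : IsFormKernel ν J D v T) (b : HilbertBasis ι ℂ H)
    (χ : numDom ι) (ξ : Fock ι) (f : H) (s : Finset (ι ⊕ ι)) :
    ∑ i ∈ s, ‖⟪pairBasis b i, qMap J f⟫_ℂ * ⟪genAnnihilate b J (pairBasis b i) χ, ξ⟫_ℂ‖ ≤
      4 * √(graphSq χ) * ‖f‖ * ‖ξ‖ := by
  obtain ⟨G, hG0, hG⟩ := exists_riesz_genAnnihilate h.involution b χ ξ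
  have h1 := HilbertBasis.sum_norm_inner_mul_le (pairHilbertBasis b) (qMap J f) G s
  rw [coe_pairHilbertBasis] at h1
  calc _ = ∑ i ∈ s, ‖⟪pairBasis b i, qMap J f⟫_ℂ‖ * ‖⟪pairBasis b i, G⟫_ℂ‖ := by
        refine Finset.sum_congr rfl fun i _ => ?_
        rw [norm_mul, hG, norm_inner_symm G]
    _ ≤ _ := h1
    _ ≤ (2 * ‖f‖) * (2 * √(graphSq χ) * ‖ξ‖) :=
        mul_le_mul (norm_qMap_le h.involution f) hG0 (norm_nonneg _) (by positivity)
    _ = _ := by ring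

/-- For fixed x this is Parseval. Sum and integral may be exchanged because Cauchy–Schwarz bounds
every finite sum of absolute values by a constant times ‖v x‖², independently of the finite set. -/
theorem hasSum_integral_genAnnihilate [Countable ι] (h : IsFormKernel ν J D v T)
    (b : HilbertBasis ι ℂ H) (χ ψ : numDom ι) :
    HasSum (fun i => ∫ x, ⟪pairBasis b i, qMap J (v x)⟫_ℂ *
        ⟪genAnnihilate b J (pairBasis b i) χ, field b (v x) ψ⟫_ℂ ∂ν)
      (∫ x, ⟪field b (v x) χ, field b (v x) ψ⟫_ℂ ∂ν) := by
  let Φ : ι ⊕ ι → X → ℂ := fun i x => ⟪pairBasis b i, qMap J (v x)⟫_ℂ *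
        ⟪genAnnihilate b J (pairBasis b i) χ, field b (v x) ψ⟫_ℂ
  have hbd : ∀ (s : Finset (ι ⊕ ι)) (x : X), ∑ i ∈ s, ‖Φ i x‖ ≤
      8 * √(graphSq χ) * √(graphSq ψ) * ‖v x‖ ^ 2 := fun s x => by
    refine (h.sum_norm_genAnnihilate_le b χ (field b (v x) ψ) (v x) s).trans ?_
    refine (mul_le_mul_of_nonneg_left (norm_field_le b (v x) ψ) (by positivity)).trans_eq ?_
    ring
  have hint : ∀ i, Integrable (Φ i) ν := fun i => by
    refine (h.integrable_sq.const_mul (8 * √(graphSq χ) * √(graphSq ψ))).mono' ?_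
      (Filter.Eventually.of_forall fun x => ?_)
    · exact (aestronglyMeasurable_const.inner
        ((continuous_qMap h.involution).comp_aestronglyMeasurable h.aestronglyMeasurable)).mul
        (aestronglyMeasurable_const.inner
        ((continuous_field b ψ).comp_aestronglyMeasurable h.aestronglyMeasurable))
    · have := hbd {i} x
      rwa [Finset.sum_singleton] at this
  have h1 := hasSum_integral_of_summable_integral_norm (F := Φ) hint (by
    refine summable_of_sum_le (c := ∫ x, 8 * √(graphSq χ) * √(graphSq ψ) * ‖v x‖ ^ 2 ∂ν)
      (fun i => integral_nonneg fun x => norm_nonneg _) fun s => ?_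
    rw [← integral_finsetSum s fun i _ => (hint i).norm]
    exact integral_mono (integrable_finsetSum s fun i _ => (hint i).norm)
      (h.integrable_sq.const_mul _) (hbd s))
  have e : ∀ x, ∑' i, Φ i x = ⟪field b (v x) χ, field b (v x) ψ⟫_ℂ := fun x =>
    (h.hasSum_genAnnihilate b χ (field b (v x) ψ) (v x)).tsum_eq
  simp only [e] at h1
  exact h1

/-- The central identity dΓ_J[T,0] = dΓ(D) + ∫ A(v_x)² dν. The operators appear in the order A_J^*
A_J, so the squares of the fields arise exactly, without an additive ordering constant. -/
theorem hasSum_tsum_quadTerm [Countable ι] (h : IsFormKernel ν J D v T)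
    (b : HilbertBasis ι ℂ H) (χ ψ : numDom ι) :
    HasSum (fun i => ∑' j, quadTerm b J T χ ψ i j) (fieldForm b ν D v χ ψ) := by
  refine (hasSum_congr fun i => ?_).1
    ((h.hasSum_genAnnihilate_fst b χ ψ).add (h.hasSum_integral_genAnnihilate b χ ψ))
  exact (h.hasSum_quadTerm b χ ψ i).tsum_eq.symm

theorem hasSum_linTerm (h : IsFormKernel ν J D v T) (b : HilbertBasis ι ℂ H) (y : H)
    (χ ψ : numDom ι) :
    HasSum (fun i => linTerm b J y χ ψ i) (⟪field b y χ, ψ.1⟫_ℂ + ⟪χ.1, field b y ψ⟫_ℂ) := by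
  refine (h.hasSum_genAnnihilate b χ ψ.1 y).add ?_
  have h1 := (h.hasSum_genAnnihilate b ψ χ.1 y).map (starRingEnd ℂ) Complex.continuous_conj
  rw [inner_conj_symm] at h1
  refine (hasSum_congr fun i => ?_).1 h1
  simp

/-- Both A_J(q(y)) and its adjoint are the field operator of y, so the linear part is twice the
expectation of that field. -/
theorem dGammaForm_eq [Countable ι] (h : IsFormKernel ν J D v T) (b : HilbertBasis ι ℂ H)
    (y : H) (ψ : numDom ι) : dGammaForm b J T y ψ =
      (fieldForm b ν D v ψ ψ).re + 2 * (⟪ψ.1, field b y ψ⟫_ℂ).re := by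
  unfold dGammaForm
  rw [(h.hasSum_tsum_quadTerm b ψ ψ).tsum_eq, (h.hasSum_linTerm b y ψ ψ).tsum_eq,
    inner_field_left, Complex.add_re, Complex.add_re]
  ring

theorem dGammaForm_zero [Countable ι] (h : IsFormKernel ν J D v T) (b : HilbertBasis ι ℂ H)
    (ψ : numDom ι) : dGammaForm b J T 0 ψ = (fieldForm b ν D v ψ ψ).re := by
  have h1 := field_real_smul_left b 0 (0 : H) ψ
  rw [Complex.ofReal_zero, zero_smul, zero_smul] at h1
  rw [h.dGammaForm_eq, h1, inner_zero_right]
  simp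

theorem isDGammaImage_iff [Countable ι] (h : IsFormKernel ν J D v T) (b : HilbertBasis ι ℂ H)
    (ψ : numDom ι) (ξ : Fock ι) :
    IsDGammaImage b J T ψ ξ ↔ ∀ χ, fieldForm b ν D v χ ψ = ⟪χ.1, ξ⟫_ℂ := by
  constructor
  · exact fun h1 χ => (h.hasSum_tsum_quadTerm b χ ψ).unique (h1 χ).2
  · exact fun h1 χ => ⟨fun i => (h.hasSum_quadTerm b χ ψ i).summable,
      h1 χ ▸ h.hasSum_tsum_quadTerm b χ ψ⟩

end IsFormKernel

/-- A bounded Hermitian sesquilinear form is represented by a bounded operator. -/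
theorem exists_clm_of_sesquilinear {E : Type*} [NormedAddCommGroup E] [InnerProductSpace ℂ E]
    [CompleteSpace E] {S : E → E → ℂ} (hadd : ∀ x y z, S x (y + z) = S x y + S x z)
    (hsmul : ∀ (z : ℂ) x y, S x (z • y) = z * S x y) (hconj : ∀ x y, conj (S x y) = S y x)
    {C : ℝ} (hC : ∀ x y, ‖S x y‖ ≤ C * ‖x‖ * ‖y‖) :
    ∃ B : E →L[ℂ] E, ∀ x y, ⟪x, B y⟫_ℂ = S x y ∧ ⟪B x, y⟫_ℂ = S x y := by
  let L : E →L⋆[ℂ] E →L[ℂ] ℂ := LinearMap.mkContinuous₂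
    (LinearMap.mk₂'ₛₗ (starRingEnd ℂ) (RingHom.id ℂ) S
      (fun x y z => by rw [← hconj, hadd, map_add, hconj, hconj])
      (fun z x y => by rw [← hconj, hsmul, map_mul, hconj, smul_eq_mul])
      hadd hsmul) C hC
  have h : ∀ x y, ⟪InnerProductSpace.continuousLinearMapOfBilin L x, y⟫_ℂ = S x y :=
    fun x y => InnerProductSpace.continuousLinearMapOfBilin_apply L x y
  refine ⟨InnerProductSpace.continuousLinearMapOfBilin L, fun x y => ⟨?_, h x y⟩⟩
  rw [← inner_conj_symm, h, hconj]

/-- The form is transported by (N+1)^{-1/2} and represented by a bounded operator B. Since D ≥ m and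
the field part is nonnegative, form + ‖ψ‖² ≥ min(m, 1)(⟨N⟩ + ‖ψ‖²), which is coercivity with δ =
min(m, 1). -/
theorem IsFormKernel.exists_isFormOperator [Countable ι] [CompleteSpace H] {ν : Measure X}
    {J : H → H} {D : H →L[ℂ] H} {v : X → H} {T : WithLp 2 (H × H) →L[ℂ] WithLp 2 (H × H)}
    (h : IsFormKernel ν J D v T) (b : HilbertBasis ι ℂ H) {m : ℝ} (hm : 0 < m)
    (hD : ∀ f, m * ‖f‖ ^ 2 ≤ (⟪f, D f⟫_ℂ).re) :
    ∃ B : Fock ι →L[ℂ] Fock ι, IsFormOperator (dGamma b J T) (numWeight ι) B ∧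
      ∀ x y, ⟪x, B y⟫_ℂ = fieldForm b ν D v (toNumDom x) (toNumDom y) := by
  obtain ⟨B, hB⟩ := exists_clm_of_sesquilinear
    (S := fun x y : Fock ι => fieldForm b ν D v (toNumDom x) (toNumDom y))
    (fun x y z => by rw [map_add, h.fieldForm_add_right])
    (fun z x y => by rw [map_smul, fieldForm_smul_right])
    (fun x y => h.conj_fieldForm b _ _)
    (C := ‖D‖ + 4 * ∫ x, ‖v x‖ ^ 2 ∂ν) (fun x y => by
      refine (h.norm_fieldForm_le b _ _).trans_eq ?_
      rw [graphSq_toNumDom, graphSq_toNumDom, Real.sqrt_sq (norm_nonneg _),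
        Real.sqrt_sq (norm_nonneg _), mul_assoc])
  refine ⟨B, ⟨inner_numWeight, fun x y => (hB x y).2.trans (hB x y).1.symm, numWeight_injective,
    fun u ξ => ?_, min m 1, lt_min hm one_pos, fun x => ?_⟩, fun x y => (hB x y).1⟩
  · have hg : (dGamma b J T).graph = dGammaGraph b J T :=
      Submodule.toLinearPMap_graph_eq _ fun p hp h0 => by
        obtain ⟨p1, p2⟩ := p
        obtain rfl : p1 = 0 := h0
        exact dGammaGraph_functional b J T hp
    rw [hg]
    show (∃ ψ : numDom ι, ψ.1 = u ∧ IsDGammaImage b J T ψ ξ) ↔ _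
    constructor
    · rintro ⟨ψ, rfl, hψ⟩
      obtain ⟨x, rfl⟩ := toNumDom_surjective ψ
      refine ⟨x, rfl, ext_inner_left ℂ fun y => ?_⟩
      rw [(hB y x).1, (h.isDGammaImage_iff b _ _).1 hψ, coe_toNumDom, inner_numWeight]
    · rintro ⟨x, rfl, hx⟩
      refine ⟨toNumDom x, rfl, (h.isDGammaImage_iff b _ _).2 fun χ => ?_⟩
      obtain ⟨y, rfl⟩ := toNumDom_surjective χ
      rw [← (hB y x).1, ← hx, coe_toNumDom, inner_numWeight]
  · rw [(hB x x).1, IsFormKernel.fieldForm_self_re, ← graphSq_toNumDom, graphSq, ← coe_toNumDom]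
    have h1 := le_secForm b hD (toNumDom x)
    have h2 : 0 ≤ ∫ y, ‖field b (v y) (toNumDom x)‖ ^ 2 ∂ν := integral_nonneg fun _ => sq_nonneg _
    have h3 := mul_le_mul_of_nonneg_right (min_le_left m 1) (numExp_nonneg (toNumDom x))
    have h4 := mul_le_mul_of_nonneg_right (min_le_right m 1) (sq_nonneg ‖(toNumDom x).1‖)
    linarith

end FormKernel

/-! ### Removing the linear term by a Weyl transformation -/

section WeylStep

variable {ι : Type*} {H : Type*} [NormedAddCommGroup H] [InnerProductSpace ℂ H]
  {X : Type*} [MeasurableSpace X]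

theorem IsAntiunitaryInvolution.inner_right {J : H → H} (hJ : IsAntiunitaryInvolution J)
    (f g : H) : ⟪f, J g⟫_ℂ = conj ⟪J f, g⟫_ℂ := by
  have h := hJ.inner_map_map (J f) g
  rw [hJ.invol] at h
  rw [h, inner_conj_symm]

/-- Vectors fixed by J form a real Hilbert space. This makes the shifts of the fields A(v_x) real
squares with no phase information. -/
theorem IsAntiunitaryInvolution.inner_eq_re {J : H → H} (hJ : IsAntiunitaryInvolution J)
    {f g : H} (hf : J f = f) (hg : J g = g) : ⟪f, g⟫_ℂ = ((⟪f, g⟫_ℂ).re : ℂ) := by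
  have h := hJ.inner_right f g
  rw [hf, hg] at h
  exact (Complex.conj_eq_iff_re.1 h.symm).symm

theorem norm_inner_mul_inner_le (f g v : H) :
    ‖⟪f, v⟫_ℂ * ⟪v, g⟫_ℂ‖ ≤ ‖f‖ * ‖g‖ * ‖v‖ ^ 2 := by
  rw [norm_mul]
  refine (mul_le_mul (norm_inner_le_norm _ _) (norm_inner_le_norm _ _) (norm_nonneg _)
    (by positivity)).trans_eq ?_
  ring

/-- The vector g records the expectations of all annihilation operators in ψ. Every term of first
order in a shift is expressed through it. -/
theorem re_inner_field (b : HilbertBasis ι ℂ H) (ψ : numDom ι) {g : H}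
    (hg : ∀ f, ⟪annihilate b f ψ, ψ.1⟫_ℂ = ⟪g, f⟫_ℂ) (f : H) :
    (⟪ψ.1, field b f ψ⟫_ℂ).re = 2 * (⟪g, f⟫_ℂ).re := by
  unfold field
  rw [inner_add_right, ← inner_annihilate_left, ← inner_conj_symm ψ.1 (annihilate b f ψ), hg,
    Complex.add_re, Complex.conj_re]
  ring

/-- Conjugation by a Weyl transformation shifts all annihilation operators by constants. -/
def ShiftsAnnihilation (b : HilbertBasis ι ℂ H) (η : H) (ψ ψ' : numDom ι)
    (W : Fock ι ≃ₗᵢ[ℂ] Fock ι) : Prop :=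
  ∀ f : H, annihilate b f ψ' = W.symm (annihilate b f ψ + ⟪f, η⟫_ℂ • ψ.1) ∧
    create b f ψ' = W.symm (create b f ψ + ⟪η, f⟫_ℂ • ψ.1)

theorem ShiftsAnnihilation.field_eq {b : HilbertBasis ι ℂ H} {η : H} {ψ ψ' : numDom ι}
    {W : Fock ι ≃ₗᵢ[ℂ] Fock ι} (h : ShiftsAnnihilation b η ψ ψ' W) (f : H) :
    field b f ψ' = W.symm (field b f ψ + ((2 * (⟪f, η⟫_ℂ).re : ℝ) : ℂ) • ψ.1) := by
  unfold field
  rw [(h f).1, (h f).2, ← map_add]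
  congr 1
  have e : ((2 * (⟪f, η⟫_ℂ).re : ℝ) : ℂ) = ⟪η, f⟫_ℂ + ⟪f, η⟫_ℂ := by
    rw [← inner_conj_symm η f, add_comm, Complex.add_conj]
  rw [e, add_smul]
  abel

/-- Each summand ⟨a(e_i)ψ', a(D e_i)ψ'⟩ is expanded after the shift; the cross terms and the
constant are resummed by Parseval. -/
theorem ShiftsAnnihilation.secForm_eq {b : HilbertBasis ι ℂ H} {η : H} {ψ ψ' : numDom ι}
    {W : Fock ι ≃ₗᵢ[ℂ] Fock ι} (h : ShiftsAnnihilation b η ψ ψ' W) {D : H →L[ℂ] H}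
    (hD : ∀ f g, ⟪D f, g⟫_ℂ = ⟪f, D g⟫_ℂ) {g : H}
    (hg : ∀ f, ⟪annihilate b f ψ, ψ.1⟫_ℂ = ⟪g, f⟫_ℂ) :
    secForm b D ψ' ψ' = secForm b D ψ ψ + (⟪g, D η⟫_ℂ + ⟪η, D g⟫_ℂ) +
      ⟪η, D η⟫_ℂ * ((‖ψ.1‖ ^ 2 : ℝ) : ℂ) := by
  have h1 := ((hasSum_secForm b hD ψ ψ).add ((b.hasSum_inner_mul_inner g (D η)).add
    (b.hasSum_inner_mul_inner η (D g)))).add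
    ((b.hasSum_inner_mul_inner η (D η)).mul_right ((‖ψ.1‖ ^ 2 : ℝ) : ℂ))
  refine (hasSum_secForm b hD ψ' ψ').unique ((hasSum_congr fun i => ?_).1 h1)
  have e1 : ⟪ψ.1, annihilate b (D (b i)) ψ⟫_ℂ = ⟪b i, D g⟫_ℂ := by
    rw [← inner_conj_symm, hg, inner_conj_symm, hD]
  rw [(h (b i)).1, (h (D (b i))).1, LinearIsometryEquiv.inner_map_map, inner_add_left,
    inner_add_right, inner_add_right, inner_smul_left, inner_smul_right, inner_smul_left,
    inner_smul_right, inner_conj_symm, e1, hg, inner_self_ofReal, hD]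
  ring

namespace IsFormKernel

variable {ν : Measure X} {J : H → H} {D : H →L[ℂ] H} {v : X → H}
  {T : WithLp 2 (H × H) →L[ℂ] WithLp 2 (H × H)}

theorem integrable_inner_mul_inner (h : IsFormKernel ν J D v T) (f g : H) :
    Integrable (fun x => ⟪f, v x⟫_ℂ * ⟪v x, g⟫_ℂ) ν := by
  refine (h.integrable_sq.const_mul (‖f‖ * ‖g‖)).mono'
    ((aestronglyMeasurable_const.inner h.aestronglyMeasurable).mul
      (h.aestronglyMeasurable.inner aestronglyMeasurable_const))
    (Filter.Eventually.of_forall fun x => ?_)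
  exact norm_inner_mul_inner_le f g _

/-- For real η the operator ½ q^* T q is ½D + 2∫ |v⟩⟨v|. Here ⟨q(v), q(η)⟩ = 2⟨v,η⟩ and both
components of q^* contribute equally, whence ½ · (2 + 2) = 2, whereas D acts in the first component
only. -/
theorem inner_shift (h : IsFormKernel ν J D v T) {η : H} (hη : J η = η) (f : H) :
    ⟪f, (1 / 2 : ℂ) • qStar J (T (qMap J η))⟫_ℂ =
      1 / 2 * ⟪f, D η⟫_ℂ + 2 * ∫ x, ⟪f, v x⟫_ℂ * ⟪v x, η⟫_ℂ ∂ν := by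
  have hJ := h.involution
  have e0 : ∀ x, ⟪qMap J (v x), qMap J η⟫_ℂ = 2 * ⟪v x, η⟫_ℂ := fun x => by
    rw [WithLp.inner_prod]
    show ⟪v x, η⟫_ℂ + ⟪J (v x), J η⟫_ℂ = _
    rw [h.real, hη]
    ring
  have e1 : ⟪f, (T (qMap J η)).fst⟫_ℂ = ⟪f, D η⟫_ℂ + 2 * ∫ x, ⟪f, v x⟫_ℂ * ⟪v x, η⟫_ℂ ∂ν := by
    have h1 := h.inner_map (WithLp.toLp 2 (f, 0)) (qMap J η)
    rw [WithLp.inner_prod] at h1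
    have h2 : ∀ x, ⟪(WithLp.toLp 2 (f, 0) : WithLp 2 (H × H)), qMap J (v x)⟫_ℂ *
        ⟪qMap J (v x), qMap J η⟫_ℂ = 2 * (⟪f, v x⟫_ℂ * ⟪v x, η⟫_ℂ) := fun x => by
      rw [e0, WithLp.inner_prod]
      show (⟪f, v x⟫_ℂ + ⟪(0 : H), J (v x)⟫_ℂ) * _ = _
      rw [inner_zero_left]
      ring
    simp only [h2] at h1
    rw [integral_const_mul] at h1
    have h3 : ⟪(WithLp.toLp 2 (f, 0) : WithLp 2 (H × H)).snd, (T (qMap J η)).snd⟫_ℂ = 0 :=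
      inner_zero_left _
    rw [h3, add_zero] at h1
    exact h1
  have e2 : ⟪J f, (T (qMap J η)).snd⟫_ℂ = 2 * ∫ x, ⟪v x, f⟫_ℂ * ⟪v x, η⟫_ℂ ∂ν := by
    have h1 := h.inner_map (WithLp.toLp 2 (0, J f)) (qMap J η)
    rw [WithLp.inner_prod] at h1
    have h2 : ∀ x, ⟪(WithLp.toLp 2 (0, J f) : WithLp 2 (H × H)), qMap J (v x)⟫_ℂ *
        ⟪qMap J (v x), qMap J η⟫_ℂ = 2 * (⟪v x, f⟫_ℂ * ⟪v x, η⟫_ℂ) := fun x => by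
      rw [e0, WithLp.inner_prod]
      show (⟪(0 : H), v x⟫_ℂ + ⟪J f, J (v x)⟫_ℂ) * _ = _
      rw [inner_zero_left, hJ.inner_map_map]
      ring
    simp only [h2] at h1
    rw [integral_const_mul] at h1
    have h3 : ⟪(WithLp.toLp 2 (0, J f) : WithLp 2 (H × H)).fst, (T (qMap J η)).fst⟫_ℂ = 0 :=
      inner_zero_left _
    have h4 : ⟪(WithLp.toLp 2 (0, J f) : WithLp 2 (H × H)).fst, D (qMap J η).fst⟫_ℂ = 0 :=
      inner_zero_left _
    rw [h3, h4, zero_add, zero_add] at h1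
    exact h1
  rw [inner_smul_right, qStar, inner_add_right, e1, hJ.inner_right, e2, map_mul, ← integral_conj]
  have e3 : ∀ x, conj (⟪v x, f⟫_ℂ * ⟪v x, η⟫_ℂ) = ⟪f, v x⟫_ℂ * ⟪v x, η⟫_ℂ := fun x => by
    rw [map_mul, inner_conj_symm, hJ.inner_eq_re (h.real x) hη, Complex.conj_ofReal]
  simp only [e3]
  rw [Complex.conj_ofNat]
  ring

theorem inner_mul_inner_eq_ofReal (h : IsFormKernel ν J D v T) {η : H} (hη : J η = η) (x : X) :
    ⟪η, v x⟫_ℂ * ⟪v x, η⟫_ℂ = (((⟪v x, η⟫_ℂ).re ^ 2 : ℝ) : ℂ) := by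
  rw [← inner_conj_symm, h.involution.inner_eq_re (h.real x) hη, Complex.conj_ofReal]
  push_cast
  rw [Complex.ofReal_re, sq]

theorem integrable_re_inner_sq (h : IsFormKernel ν J D v T) {η : H} (hη : J η = η) :
    Integrable (fun x => (⟪v x, η⟫_ℂ).re ^ 2) ν := by
  refine (h.integrable_inner_mul_inner η η).re.congr (Filter.Eventually.of_forall fun x => ?_)
  show (⟪η, v x⟫_ℂ * ⟪v x, η⟫_ℂ).re = _
  rw [h.inner_mul_inner_eq_ofReal hη, Complex.ofReal_re]

theorem re_inner_shift_self (h : IsFormKernel ν J D v T) {η : H} (hη : J η = η) :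
    2 * (⟪η, (1 / 2 : ℂ) • qStar J (T (qMap J η))⟫_ℂ).re =
      (⟪η, D η⟫_ℂ).re + 4 * ∫ x, (⟪v x, η⟫_ℂ).re ^ 2 ∂ν := by
  rw [h.inner_shift hη]
  simp only [h.inner_mul_inner_eq_ofReal hη]
  rw [integral_complex_ofReal, Complex.add_re, show (1 / 2 : ℂ) = ((1 / 2 : ℝ) : ℂ) by norm_num,
    show (2 : ℂ) = ((2 : ℝ) : ℂ) by norm_num, Complex.re_ofReal_mul, Complex.re_ofReal_mul,
    Complex.ofReal_re]
  ring

/-- Shifting changes the form by 2Re⟨g, Dη⟩ + 8Re∫⟨g,v⟩⟨v,η⟩ plus a constant. With y = ½D η + 2∫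
v⟨v,η⟩ the first-order part is 4Re⟨g, y⟩, the linear term of dΓ_J[T, y], and the constant is 2Re⟨η,
y⟩‖ψ‖². -/
theorem fieldForm_shift [CompleteSpace H] (h : IsFormKernel ν J D v T)
    {b : HilbertBasis ι ℂ H} {η : H} (hη : J η = η) {ψ ψ' : numDom ι} {W : Fock ι ≃ₗᵢ[ℂ] Fock ι}
    (hs : ShiftsAnnihilation b η ψ ψ' W) :
    (fieldForm b ν D v ψ' ψ').re = (fieldForm b ν D v ψ ψ).re +
      2 * (⟪ψ.1, field b ((1 / 2 : ℂ) • qStar J (T (qMap J η))) ψ⟫_ℂ).re +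
      2 * (⟪η, (1 / 2 : ℂ) • qStar J (T (qMap J η))⟫_ℂ).re * ‖ψ.1‖ ^ 2 := by
  obtain ⟨g, hg⟩ := exists_riesz_annihilate b ψ ψ.1
  have ht : ∀ x, ⟪v x, η⟫_ℂ = ((⟪v x, η⟫_ℂ).re : ℂ) := fun x =>
    h.involution.inner_eq_re (h.real x) hη
  have h1 : ∀ x, ‖field b (v x) ψ'‖ ^ 2 = ‖field b (v x) ψ‖ ^ 2 +
      8 * ((⟪g, v x⟫_ℂ * ⟪v x, η⟫_ℂ).re) + 4 * ‖ψ.1‖ ^ 2 * (⟪v x, η⟫_ℂ).re ^ 2 := fun x => by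
    have e : (⟪g, v x⟫_ℂ * ⟪v x, η⟫_ℂ).re = (⟪v x, η⟫_ℂ).re * (⟪g, v x⟫_ℂ).re := by
      rw [mul_comm]
      conv_lhs => rw [ht x]
      rw [Complex.re_ofReal_mul]
    rw [hs.field_eq, LinearIsometryEquiv.norm_map, @norm_add_sq ℂ, inner_smul_right, norm_smul,
      Complex.norm_real, inner_field_left, e]
    show _ + 2 * (((2 * (⟪v x, η⟫_ℂ).re : ℝ) : ℂ) * ⟪ψ.1, field b (v x) ψ⟫_ℂ).re + _ = _
    rw [Complex.re_ofReal_mul, re_inner_field b ψ hg, mul_pow, Real.norm_eq_abs, sq_abs]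
    ring
  have hi2 : Integrable (fun x => (⟪g, v x⟫_ℂ * ⟪v x, η⟫_ℂ).re) ν :=
    (h.integrable_inner_mul_inner g η).re
  have hi3 := h.integrable_re_inner_sq hη
  have h2 : ∫ x, (⟪g, v x⟫_ℂ * ⟪v x, η⟫_ℂ).re ∂ν = (∫ x, ⟪g, v x⟫_ℂ * ⟪v x, η⟫_ℂ ∂ν).re :=
    integral_re (h.integrable_inner_mul_inner g η)
  have h3 : ∫ x, ‖field b (v x) ψ'‖ ^ 2 ∂ν = ∫ x, ‖field b (v x) ψ‖ ^ 2 ∂ν +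
      8 * (∫ x, ⟪g, v x⟫_ℂ * ⟪v x, η⟫_ℂ ∂ν).re +
      4 * ‖ψ.1‖ ^ 2 * ∫ x, (⟪v x, η⟫_ℂ).re ^ 2 ∂ν := by
    simp only [h1]
    have h5 : Integrable (fun x => ‖field b (v x) ψ‖ ^ 2 +
        8 * (⟪g, v x⟫_ℂ * ⟪v x, η⟫_ℂ).re) ν :=
      (h.integrable_norm_field_sq b ψ).add (hi2.const_mul 8)
    rw [integral_add h5 (hi3.const_mul _),
      integral_add (h.integrable_norm_field_sq b ψ) (hi2.const_mul 8), integral_const_mul,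
      integral_const_mul, ← h2]
  have h4 : (⟪η, D g⟫_ℂ).re = (⟪g, D η⟫_ℂ).re := by
    rw [← h.symm, ← inner_conj_symm, Complex.conj_re]
  rw [fieldForm_self_re, fieldForm_self_re, hs.secForm_eq h.symm hg, h3,
    re_inner_field b ψ hg, h.inner_shift hη g, h.re_inner_shift_self hη]
  rw [show (1 / 2 : ℂ) = ((1 / 2 : ℝ) : ℂ) by norm_num,
    show (2 : ℂ) = ((2 : ℝ) : ℂ) by norm_num, Complex.add_re, Complex.add_re, Complex.add_re,
    Complex.add_re, Complex.re_ofReal_mul, Complex.re_ofReal_mul, Complex.re_mul_ofReal, h4]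
  ring

/-- With t = ⟨v,η⟩, the vector y = ∫ w v gives 2∫ t w = ⟨η,Dη⟩ + 4∫ t², where the left side is
2⟨η,y⟩. Inserting this into ∫ (2t − w)² ≥ 0 gives ∫ w² ≥ 2⟨η,Dη⟩ + 4∫ t², which is at least 2⟨η,y⟩
because D ≥ 0. -/
theorem re_inner_shift_le (h : IsFormKernel ν J D v T) (hD : ∀ f, 0 ≤ (⟪f, D f⟫_ℂ).re)
    {w : X → ℝ} (hw : MemLp w 2 ν) {η : H} (hη : J η = η)
    (hy : ∀ f, ⟪f, (1 / 2 : ℂ) • qStar J (T (qMap J η))⟫_ℂ = ∫ x, ⟪f, v x⟫_ℂ * w x ∂ν) :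
    2 * (⟪η, (1 / 2 : ℂ) • qStar J (T (qMap J η))⟫_ℂ).re ≤ ∫ x, w x ^ 2 ∂ν := by
  have ht : ∀ x, ⟪v x, η⟫_ℂ = ((⟪v x, η⟫_ℂ).re : ℂ) := fun x =>
    h.involution.inner_eq_re (h.real x) hη
  have hi3 := h.integrable_re_inner_sq hη
  have hm : MemLp (fun x => (⟪v x, η⟫_ℂ).re) 2 ν := by
    refine (memLp_two_iff_integrable_sq ?_).2 hi3
    exact (RCLike.continuous_re (K := ℂ)).comp_aestronglyMeasurable
      (h.aestronglyMeasurable.inner aestronglyMeasurable_const)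
  have hi : Integrable (fun x => (⟪v x, η⟫_ℂ).re * w x) ν := hm.integrable_mul hw
  have hw2 : Integrable (fun x => w x ^ 2) ν := hw.integrable_sq
  have e1 : (⟪η, (1 / 2 : ℂ) • qStar J (T (qMap J η))⟫_ℂ).re =
      ∫ x, (⟪v x, η⟫_ℂ).re * w x ∂ν := by
    rw [hy]
    have : ∀ x, ⟪η, v x⟫_ℂ * w x = (((⟪v x, η⟫_ℂ).re * w x : ℝ) : ℂ) := fun x => by
      rw [← inner_conj_symm, ht, Complex.conj_ofReal, Complex.ofReal_re, Complex.ofReal_mul]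
    simp only [this]
    rw [integral_complex_ofReal, Complex.ofReal_re]
  have e2 := h.re_inner_shift_self hη
  have e3 : 0 ≤ ∫ x, (2 * (⟪v x, η⟫_ℂ).re - w x) ^ 2 ∂ν := integral_nonneg fun x => sq_nonneg _
  have h6 : Integrable (fun x => 4 * (⟪v x, η⟫_ℂ).re ^ 2 - 4 * ((⟪v x, η⟫_ℂ).re * w x)) ν :=
    (hi3.const_mul 4).sub (hi.const_mul 4)
  have e4 : ∫ x, (2 * (⟪v x, η⟫_ℂ).re - w x) ^ 2 ∂ν = 4 * ∫ x, (⟪v x, η⟫_ℂ).re ^ 2 ∂ν -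
      4 * ∫ x, (⟪v x, η⟫_ℂ).re * w x ∂ν + ∫ x, w x ^ 2 ∂ν := by
    rw [← integral_const_mul, ← integral_const_mul,
      ← integral_sub (hi3.const_mul 4) (hi.const_mul 4), ← integral_add h6 hw2]
    exact integral_congr_ae (Filter.Eventually.of_forall fun x => by ring)
  have e5 := hD η
  linarith

/-- On real vectors the equation reads M η = y with M = ½D + 2∫ |v⟩⟨v| ≥ m/2, so M is invertible. M
commutes with J, hence the preimage of a real vector is real. -/
theorem existsUnique_shift [CompleteSpace H] (h : IsFormKernel ν J D v T) {m : ℝ} (hm : 0 < m)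
    (hD : ∀ f, m * ‖f‖ ^ 2 ≤ (⟪f, D f⟫_ℂ).re) (hDJ : ∀ f, D (J f) = J (D f)) {y : H}
    (hy : J y = y) : ∃! η : H, J η = η ∧ y = (1 / 2 : ℂ) • qStar J (T (qMap J η)) := by
  have hJ := h.involution
  let P : WithLp 2 (H × H) →L[ℂ] H := ContinuousLinearMap.fst ℂ H H ∘L
    (WithLp.prodContinuousLinearEquiv 2 ℂ H H).toContinuousLinearMap
  let I : H →L[ℂ] WithLp 2 (H × H) :=
    (WithLp.prodContinuousLinearEquiv 2 ℂ H H).symm.toContinuousLinearMap ∘L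
      ContinuousLinearMap.inl ℂ H H
  -- P T I is the upper left block of T, namely D + ∫ |v⟩⟨v|. Doubling it and subtracting (3/2)D
  -- leaves ½D + 2∫ |v⟩⟨v|.
  let M : H →L[ℂ] H := (2 : ℂ) • (P ∘L T ∘L I) - (3 / 2 : ℂ) • D
  have hM : ∀ f g, ⟪f, M g⟫_ℂ = 1 / 2 * ⟪f, D g⟫_ℂ + 2 * ∫ x, ⟪f, v x⟫_ℂ * ⟪v x, g⟫_ℂ ∂ν := by
    intro f g
    have h1 := h.inner_map (I f) (I g)
    have h2 : ∀ x, ⟪I f, qMap J (v x)⟫_ℂ * ⟪qMap J (v x), I g⟫_ℂ =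
        ⟪f, v x⟫_ℂ * ⟪v x, g⟫_ℂ := fun x => by
      rw [WithLp.inner_prod, WithLp.inner_prod]
      show (⟪f, v x⟫_ℂ + ⟪(0 : H), J (v x)⟫_ℂ) * (⟪v x, g⟫_ℂ + ⟪J (v x), (0 : H)⟫_ℂ) = _
      rw [inner_zero_left, inner_zero_right, add_zero, add_zero]
    simp only [h2] at h1
    have h3 : ⟪I f, T (I g)⟫_ℂ = ⟪f, (T (I g)).fst⟫_ℂ := by
      rw [WithLp.inner_prod]
      show ⟪f, (T (I g)).fst⟫_ℂ + ⟪(0 : H), (T (I g)).snd⟫_ℂ = _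
      rw [inner_zero_left, add_zero]
    have h4 : ⟪(I f).fst, D (I g).fst⟫_ℂ = ⟪f, D g⟫_ℂ := rfl
    have h5 : M g = (2 : ℂ) • (T (I g)).fst - (3 / 2 : ℂ) • D g := rfl
    rw [h3, h4] at h1
    rw [h5, inner_sub_right, inner_smul_right, inner_smul_right, h1]
    ring
  have hMη : ∀ η, J η = η → (1 / 2 : ℂ) • qStar J (T (qMap J η)) = M η := fun η hη =>
    ext_inner_left ℂ fun f => by rw [h.inner_shift hη, hM]
  have hMJ : ∀ g, M (J g) = J (M g) := fun g => ext_inner_left ℂ fun f => by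
    have e : ∀ x, conj (⟪J f, v x⟫_ℂ * ⟪v x, g⟫_ℂ) = ⟪f, v x⟫_ℂ * ⟪v x, J g⟫_ℂ := fun x => by
      have h1 := hJ.inner_right f (v x)
      have h2 := hJ.inner_right (v x) g
      rw [h.real] at h1 h2
      rw [map_mul, h1, h2]
    rw [hJ.inner_right, hM, hM, hDJ, hJ.inner_right f, map_add, map_mul, map_mul,
      ← integral_conj]
    simp only [e]
    rw [inner_conj_symm, map_div₀, map_one, Complex.conj_ofNat]
  have hc : ∀ f, m / 2 * ‖f‖ ^ 2 ≤ (⟪f, M f⟫_ℂ).re := fun f => by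
    have e : ∀ x, ⟪f, v x⟫_ℂ * ⟪v x, f⟫_ℂ = ((‖⟪f, v x⟫_ℂ‖ ^ 2 : ℝ) : ℂ) := fun x => by
      rw [← inner_conj_symm (v x) f, Complex.mul_conj, Complex.normSq_eq_norm_sq]
    rw [hM]
    simp only [e]
    rw [integral_complex_ofReal, Complex.add_re, show (1 / 2 : ℂ) = ((1 / 2 : ℝ) : ℂ) by norm_num,
      show (2 : ℂ) = ((2 : ℝ) : ℂ) by norm_num, Complex.re_ofReal_mul, Complex.re_ofReal_mul,
      Complex.ofReal_re]
    have h1 : 0 ≤ ∫ x, ‖⟪f, v x⟫_ℂ‖ ^ 2 ∂ν := integral_nonneg fun _ => sq_nonneg _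
    have h2 := hD f
    linarith
  have hu : IsUnit M := by
    refine ContinuousLinearMap.isUnit_of_forall_le_norm_inner_map M (c := ⟨m / 2, by positivity⟩)
      (half_pos hm) fun x => ?_
    rw [norm_inner_symm, mul_comm]
    exact (hc x).trans (Complex.re_le_norm ⟪x, M x⟫_ℂ)
  obtain ⟨U, hU⟩ := hu
  have hl : ∀ x, (U⁻¹ : (H →L[ℂ] H)ˣ).1 (M x) = x := fun x => by
    rw [← hU]
    exact DFunLike.congr_fun U.inv_mul x
  have hr : ∀ x, M ((U⁻¹ : (H →L[ℂ] H)ˣ).1 x) = x := fun x => by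
    rw [← hU]
    exact DFunLike.congr_fun U.mul_inv x
  refine ⟨(U⁻¹ : (H →L[ℂ] H)ˣ).1 y, ?_, fun η hη => ?_⟩
  · have h1 : J ((U⁻¹ : (H →L[ℂ] H)ˣ).1 y) = (U⁻¹ : (H →L[ℂ] H)ˣ).1 y := by
      rw [← hl (J _), hMJ, hr, hy]
    exact ⟨h1, by rw [hMη _ h1, hr]⟩
  · rw [hη.2, hMη _ hη.1, hl]

end IsFormKernel

theorem exists_isWeyl_shifts [CompleteSpace H] (b : HilbertBasis ι ℂ H) (η : H) :
    ∃ (W : Fock ι ≃ₗᵢ[ℂ] Fock ι) (hW : IsWeyl b η W), IsWeyl b (-η) W.symm ∧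
      ∀ ψ : numDom ι, ShiftsAnnihilation b η ψ ⟨W.symm ψ.1, hW.symm_mem ψ.1 ψ.2⟩ W := by
  obtain ⟨W, hW, hW', h⟩ := exists_isWeyl b η
  refine ⟨W, hW, hW', fun ψ f => ⟨h f ψ, ?_⟩⟩
  rw [← hW.conj_create f ψ.1 ψ.2, LinearIsometryEquiv.symm_apply_apply]

theorem IsFormKernel.exists_isWeyl_dGammaForm_le [Countable ι] [CompleteSpace H] {ν : Measure X}
    {J : H → H} {D : H →L[ℂ] H} {v : X → H} {T : WithLp 2 (H × H) →L[ℂ] WithLp 2 (H × H)}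
    (h : IsFormKernel ν J D v T) (b : HilbertBasis ι ℂ H) (hD : ∀ f, 0 ≤ (⟪f, D f⟫_ℂ).re)
    {w : X → ℝ} (hw : MemLp w 2 ν) {y η : H} (hη : J η = η)
    (hyη : y = (1 / 2 : ℂ) • qStar J (T (qMap J η)))
    (hy : ∀ f, ⟪f, y⟫_ℂ = ∫ x, ⟪f, v x⟫_ℂ * w x ∂ν) :
    ∃ (W : Fock ι ≃ₗᵢ[ℂ] Fock ι) (hW : IsWeyl b η W), IsWeyl b (-η) W.symm ∧
      ∀ ψ : numDom ι, dGammaForm b J T 0 ⟨W.symm ψ.1, hW.symm_mem ψ.1 ψ.2⟩ -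
        (∫ x, w x ^ 2 ∂ν) * ‖ψ.1‖ ^ 2 ≤ dGammaForm b J T y ψ := by
  obtain ⟨W, hW, hW', hs⟩ := exists_isWeyl_shifts b η
  refine ⟨W, hW, hW', fun ψ => ?_⟩
  subst hyη
  have h1 := h.re_inner_shift_le hD hw hη hy
  rw [h.dGammaForm_zero, h.dGammaForm_eq, h.fieldForm_shift hη (hs ψ)]
  have h2 := mul_le_mul_of_nonneg_right h1 (sq_nonneg ‖ψ.1‖)
  linarith

end WeylStep

/-! ### The unitary Fourier transform on L² -/

section FourierPlancherel

variable {F : Type*} [NormedAddCommGroup F] [InnerProductSpace ℂ F] [CompleteSpace F]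

/-- The Fourier transform on `L²` is given by the Fourier integral for integrable functions. -/
theorem fourier_toLp_ae {u : R3 → F} (h1 : Integrable u) (h2 : MemLp u 2 volume) :
    ((𝓕 (h2.toLp u) : Lp F 2 (volume : Measure R3)) : R3 → F) =ᵐ[volume] 𝓕 u := by
  refine ae_eq_of_integral_contDiff_smul_eq ((Lp.memLp _).locallyIntegrable (by norm_num))
    ?_ fun g hg hgc => ?_
  · exact (VectorFourier.fourierIntegral_continuous Real.continuous_fourierChar
      (by exact continuous_inner) h1).locallyIntegrable
  · have hg' : ContDiff ℝ (⊤ : ℕ∞) fun x => (g x : ℂ) := Complex.ofRealCLM.contDiff.comp hg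
    have hgc' : HasCompactSupport fun x => (g x : ℂ) := hgc.comp_left Complex.ofReal_zero
    let G : SchwartzMap R3 ℂ := hgc'.toSchwartzMap hg'
    have hG : ∀ x, G x = (g x : ℂ) := fun x => rfl
    have e : ∀ f : R3 → F, ∫ x, g x • f x = ∫ x, G x • f x := fun f =>
      integral_congr_ae (Filter.Eventually.of_forall fun x => by
        show g x • f x = (g x : ℂ) • f x
        rw [Complex.coe_smul])
    -- The L² transform is known as a tempered distribution, so the Fourier transform moves to the
    -- test function G; Fubini for the integrable u moves it back as a Fourier integral.
    have h3 := DFunLike.congr_fun (Lp.fourier_toTemperedDistribution_eq (h2.toLp u)) G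
    rw [TemperedDistribution.fourier_apply, Lp.toTemperedDistribution_apply,
      Lp.toTemperedDistribution_apply] at h3
    rw [e, e, ← h3]
    have h4 : ∫ x, (𝓕 G) x • (h2.toLp u) x = ∫ x, (𝓕 G) x • u x := by
      refine integral_congr_ae ?_
      filter_upwards [h2.coeFn_toLp] with x hx
      rw [hx]
    rw [h4, SchwartzMap.fourier_coe]
    have h5 := VectorFourier.integral_fourierIntegral_smul_eq_flip (L := innerₗ R3)
      (μ := (volume : Measure R3)) (ν := (volume : Measure R3))
      Real.continuous_fourierChar (by exact continuous_inner) (G.integrable) h1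
    rw [flip_innerₗ] at h5
    exact h5

theorem ae_smul_arg {t : ℝ} (ht : t ≠ 0) {P : R3 → Prop} (h : ∀ᵐ p, P p) : ∀ᵐ p : R3, P (t • p) := by
  have hq : Measure.QuasiMeasurePreserving (fun p : R3 => t • p) volume volume :=
    ⟨measurable_const_smul t, by
      rw [Measure.map_addHaar_smul _ ht]
      exact Measure.smul_absolutelyContinuous⟩
  exact hq.ae h

/-- Plancherel: the two prefactors give (2π)^{-3}, which cancels the Jacobian (2π)³ of the dilation.
-/
theorem inner_fhat (f g : Lp F 2 (volume : Measure R3)) :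
    ⟪(memLp_fhat f).toLp (fhat f), (memLp_fhat g).toLp (fhat g)⟫_ℂ = ⟪f, g⟫_ℂ := by
  have h0 : (0 : ℝ) < 2 * Real.pi := by positivity
  rw [← Lp.inner_fourier_eq f g, L2.inner_def, L2.inner_def]
  have e1 : ∫ p, ⟪((memLp_fhat f).toLp (fhat f)) p, ((memLp_fhat g).toLp (fhat g)) p⟫_ℂ =
      ∫ p, (((2 * Real.pi) ^ (-3 : ℝ) : ℝ) : ℂ) * ⟪(𝓕 f : Lp F 2 (volume : Measure R3))
        ((2 * Real.pi)⁻¹ • p), (𝓕 g : Lp F 2 (volume : Measure R3)) ((2 * Real.pi)⁻¹ • p)⟫_ℂ := by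
    refine integral_congr_ae ?_
    filter_upwards [(memLp_fhat f).coeFn_toLp, (memLp_fhat g).coeFn_toLp] with p hp hp'
    rw [hp, hp', fhat, fhat, inner_smul_left, inner_smul_right, Complex.conj_ofReal, ← mul_assoc,
      ← Complex.ofReal_mul, ← Real.rpow_add h0]
    norm_num
  rw [e1, integral_const_mul, Measure.integral_comp_smul volume (fun p =>
    ⟪(𝓕 f : Lp F 2 (volume : Measure R3)) p, (𝓕 g : Lp F 2 (volume : Measure R3)) p⟫_ℂ)]
  rw [finrank_euclideanSpace_fin, mul_smul_comm, ← smul_mul_assoc]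
  have e2 : |((2 * Real.pi)⁻¹ ^ 3)⁻¹| • (((2 * Real.pi) ^ (-3 : ℝ) : ℝ) : ℂ) = 1 := by
    rw [Real.rpow_neg h0.le, inv_pow, inv_inv, abs_of_pos (by positivity), Complex.real_smul,
      ← Complex.ofReal_mul, show (3 : ℝ) = ((3 : ℕ) : ℝ) by norm_num, Real.rpow_natCast,
      mul_inv_cancel₀ (by positivity), Complex.ofReal_one]
  rw [e2, one_mul]

theorem norm_fhat (f : Lp F 2 (volume : Measure R3)) :
    ‖(memLp_fhat f).toLp (fhat f)‖ = ‖f‖ := by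
  have h := inner_fhat f f
  rw [inner_self_ofReal, inner_self_ofReal] at h
  exact (pow_left_inj₀ (norm_nonneg _) (norm_nonneg _) two_ne_zero).1 (by exact_mod_cast h)

theorem fhat_sub (f g : Lp F 2 (volume : Measure R3)) :
    fhat (f - g) =ᵐ[volume] fun p => fhat f p - fhat g p := by
  have h0 : (2 * Real.pi)⁻¹ ≠ 0 := by positivity
  have h1 : (𝓕 (f - g) : Lp F 2 (volume : Measure R3)) = 𝓕 f - 𝓕 g :=
    (Lp.fourierTransformₗᵢ R3 F).map_sub f g
  filter_upwards [ae_smul_arg h0 (Lp.coeFn_sub (𝓕 f : Lp F 2 (volume : Measure R3)) (𝓕 g))]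
    with p hp
  rw [fhat, fhat, fhat, ← smul_sub, h1, hp, Pi.sub_apply]

theorem fhat_toLp_ae {u : R3 → F} (h1 : Integrable u) (h2 : MemLp u 2 volume) :
    fhat (h2.toLp u) =ᵐ[volume] fun p => (((2 * Real.pi) ^ (-(3 / 2) : ℝ) : ℝ) : ℂ) •
      ∫ x, Complex.exp (-Complex.I * (⟪x, p⟫_ℝ : ℂ)) • u x := by
  have h0 : (2 * Real.pi)⁻¹ ≠ 0 := by positivity
  filter_upwards [ae_smul_arg h0 (fourier_toLp_ae h1 h2)] with p hp
  rw [fhat, hp, Real.fourier_eq']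
  congr 1
  refine integral_congr_ae (Filter.Eventually.of_forall fun x => ?_)
  show Complex.exp _ • u x = Complex.exp _ • u x
  congr 2
  rw [inner_smul_right]
  have : (Real.pi : ℂ) ≠ 0 := by exact_mod_cast Real.pi_ne_zero
  push_cast
  field_simp

/-- Schwartz functions are dense in `L²`. -/
theorem exists_schwartz_seq {F : Type*} [NormedAddCommGroup F] [InnerProductSpace ℂ F]
    (r : Lp F 2 (volume : Measure R3)) :
    ∃ s : ℕ → SchwartzMap R3 F, Filter.Tendsto (fun n => ((s n).memLp 2 volume).toLp (s n))
      Filter.atTop (nhds r) := by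
  have h := SchwartzMap.denseRange_toLpCLM (F := F) (μ := (volume : Measure R3))
    (p := 2) ENNReal.ofNat_ne_top
  obtain ⟨x, hx, hlim⟩ := mem_closure_iff_seq_limit.1 (h r)
  choose s hs using hx
  refine ⟨s, hlim.congr fun n => ?_⟩
  rw [← hs n]
  rfl

end FourierPlancherel

/-! ### The involution J and powers of |k| on the one-photon space -/

theorem C3.inner_eq (u v : C3) : ⟪u, v⟫_ℂ = ∑ ν, conj (u ν) * v ν := by
  rw [PiLp.inner_apply]
  exact Finset.sum_congr rfl fun ν _ => by rw [RCLike.inner_apply, mul_comm]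

namespace Cutoff

variable (c : Cutoff)

theorem inner_photon (f g : c.photonSpace) : ⟪f, g⟫_ℂ = ∫ k, ⟪f.1 k, g.1 k⟫_ℂ ∂c.meas := by
  rw [Submodule.coe_inner, L2.inner_def]

theorem inner_conj3 (u v : C3) : ⟪conj3 u, conj3 v⟫_ℂ = ⟪v, u⟫_ℂ := by
  rw [C3.inner_eq, C3.inner_eq]
  refine Finset.sum_congr rfl fun ν _ => ?_
  simp [conj3, mul_comm]

theorem conj3_conj3 (v : C3) : conj3 (conj3 v) = v := by
  ext ν
  simp [conj3]

theorem conj3_add (u v : C3) : conj3 (u + v) = conj3 u + conj3 v := by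
  ext ν
  simp [conj3]

theorem conj3_smul (z : ℂ) (v : C3) : conj3 (z • v) = conj z • conj3 v := by
  ext ν
  simp [conj3]

theorem coeFn_J (f : c.photonSpace) : (c.J f).1 =ᵐ[c.meas] fun k => conj3 (f.1 (-k)) :=
  c.coeFn_mkPhoton _ _ _

theorem ae_neg {P : R3 → Prop} (h : ∀ᵐ k ∂c.meas, P k) : ∀ᵐ k ∂c.meas, P (-k) :=
  c.measurePreserving_neg_shell.quasiMeasurePreserving.ae h

theorem isAntiunitaryInvolution_J : IsAntiunitaryInvolution c.J where
  invol f := by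
    refine c.photon_ext ?_
    filter_upwards [c.coeFn_J (c.J f), c.ae_neg (c.coeFn_J f)] with k h1 h2
    rw [h1, h2, neg_neg, conj3_conj3]
  inner_map_map f g := by
    rw [c.inner_photon, c.inner_photon]
    have e : ∫ k, ⟪(c.J f).1 k, (c.J g).1 k⟫_ℂ ∂c.meas =
        ∫ k, ⟪g.1 (-k), f.1 (-k)⟫_ℂ ∂c.meas := by
      refine integral_congr_ae ?_
      filter_upwards [c.coeFn_J f, c.coeFn_J g] with k h1 h2
      rw [h1, h2, inner_conj3]
    rw [e]
    exact c.measurePreserving_neg_shell.integral_comp (Homeomorph.neg R3).measurableEmbedding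
      (fun k => ⟪g.1 k, f.1 k⟫_ℂ)
  map_add f g := by
    refine c.photon_ext ?_
    filter_upwards [c.coeFn_J f, c.coeFn_J g, c.coeFn_J (f + g), c.coeFn_add (c.J f) (c.J g),
      c.ae_neg (c.coeFn_add f g)] with k h1 h2 h3 h4 h5
    rw [h3, h4, h1, h2, h5, conj3_add]
  map_smul z f := by
    refine c.photon_ext ?_
    filter_upwards [c.coeFn_J f, c.coeFn_J (z • f), c.coeFn_smul (conj z) (c.J f),
      c.ae_neg (c.coeFn_smul z f)] with k h1 h2 h3 h4
    rw [h2, h3, h1, h4, conj3_smul]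

theorem coeFn_absPow (s : ℝ) (f : c.photonSpace) :
    (c.absPow s f).1 =ᵐ[c.meas] fun k => ((‖k‖ ^ s : ℝ) : ℂ) • f.1 k :=
  c.coeFn_mkPhoton _ (c.memLp_mul (measurable_norm.pow_const s) (c.rpow_bound s) f)
    (c.transversal_mul _ f)

theorem inner_absPow_left (s : ℝ) (f g : c.photonSpace) :
    ⟪c.absPow s f, g⟫_ℂ = ⟪f, c.absPow s g⟫_ℂ := by
  rw [c.inner_photon, c.inner_photon]
  refine integral_congr_ae ?_
  filter_upwards [c.coeFn_absPow s f, c.coeFn_absPow s g] with k h1 h2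
  rw [h1, h2, inner_smul_left, inner_smul_right, Complex.conj_ofReal]

theorem absPow_absPow (s t : ℝ) (f : c.photonSpace) :
    c.absPow s (c.absPow t f) = c.absPow (s + t) f := by
  refine c.photon_ext ?_
  filter_upwards [c.coeFn_absPow s (c.absPow t f), c.coeFn_absPow t f, c.coeFn_absPow (s + t) f,
    ae_restrict_mem c.measurableSet_shell] with k h1 h2 h3 hk
  rw [h1, h2, h3, smul_smul, ← Complex.ofReal_mul,
    ← Real.rpow_add (c.σ_pos.trans_le hk.1)]

theorem absPow_J (s : ℝ) (f : c.photonSpace) : c.absPow s (c.J f) = c.J (c.absPow s f) := by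
  refine c.photon_ext ?_
  filter_upwards [c.coeFn_absPow s (c.J f), c.coeFn_J f, c.coeFn_J (c.absPow s f),
    c.ae_neg (c.coeFn_absPow s f)] with k h1 h2 h3 h4
  rw [h1, h2, h3, h4, conj3_smul, norm_neg, Complex.conj_ofReal]

/-- The infrared cutoff gives |k| ≥ σ on the shell. This gap is the source of coercivity for the
form and for the equation determining η. -/
theorem le_inner_absPow_one (f : c.photonSpace) :
    c.σ * ‖f‖ ^ 2 ≤ (⟪f, c.absPow 1 f⟫_ℂ).re := by
  have h1 : ⟪f, c.absPow 1 f⟫_ℂ = ((∫ k, ‖k‖ * ‖f.1 k‖ ^ 2 ∂c.meas : ℝ) : ℂ) := by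
    rw [c.inner_photon, ← integral_complex_ofReal]
    refine integral_congr_ae ?_
    filter_upwards [c.coeFn_absPow 1 f] with k hk
    rw [hk, inner_smul_right, inner_self_ofReal, Real.rpow_one, Complex.ofReal_mul]
  have h2 : ‖f‖ ^ 2 = ∫ k, ‖f.1 k‖ ^ 2 ∂c.meas := by
    have h3 : ⟪f, f⟫_ℂ = ((∫ k, ‖f.1 k‖ ^ 2 ∂c.meas : ℝ) : ℂ) := by
      rw [c.inner_photon, ← integral_complex_ofReal]
      simp only [inner_self_ofReal]
    rw [inner_self_ofReal] at h3
    exact_mod_cast h3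
  have hi : Integrable (fun k => ‖f.1 k‖ ^ 2) c.meas := (Lp.memLp f.1).integrable_norm_pow two_ne_zero
  have hi2 : Integrable (fun k => ‖k‖ * ‖f.1 k‖ ^ 2) c.meas := by
    refine (hi.const_mul c.Λ).mono' (measurable_norm.aestronglyMeasurable.mul hi.1) ?_
    filter_upwards [ae_restrict_mem c.measurableSet_shell] with k hk
    rw [norm_mul, norm_norm, Real.norm_of_nonneg (sq_nonneg _)]
    exact mul_le_mul_of_nonneg_right hk.2.le (sq_nonneg _)
  rw [h1, Complex.ofReal_re, h2, ← integral_const_mul]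
  refine integral_mono_ae (hi.const_mul _) hi2 ?_
  filter_upwards [ae_restrict_mem c.measurableSet_shell] with k hk
  exact mul_le_mul_of_nonneg_right hk.1 (sq_nonneg _)

/-! ### The coupling functions -/

theorem coeFn_mode (x : R3) (μ : Fin 3) : (c.mode x μ).1 =ᵐ[c.meas] modeFun x μ :=
  c.coeFn_mkPhoton _ _ _

theorem modeFun_eq_smul (x : R3) (μ : Fin 3) (k : R3) :
    modeFun x μ k = Complex.exp (-Complex.I * (⟪k, x⟫_ℝ : ℂ)) • modeFun 0 μ k := by
  ext ν
  simp [modeFun, mul_comm]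

theorem exists_norm_modeFun_le (μ : Fin 3) : ∃ B : ℝ, 0 ≤ B ∧
    ∀ k ∈ c.shell, ∀ x, ‖modeFun x μ k‖ ≤ B := by
  set K : ℝ := (2 * Real.pi) ^ (-(3 / 2) : ℝ) * (c.σ ^ (-(1 / 2) : ℝ) + c.Λ ^ (-(1 / 2) : ℝ)) * 2
  refine ⟨√(∑ _ν : Fin 3, K ^ 2), Real.sqrt_nonneg _, fun k hk x => ?_⟩
  have hk0 : 0 < ‖k‖ := c.σ_pos.trans_le hk.1
  have e1 : ‖Complex.exp (-Complex.I * (⟪k, x⟫_ℝ : ℂ))‖ = 1 := by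
    rw [Complex.norm_exp]; simp
  rw [modeFun_eq_smul, norm_smul, e1, one_mul, EuclideanSpace.norm_eq]
  refine Real.sqrt_le_sqrt (Finset.sum_le_sum fun ν _ => ?_)
  have e2 : ∀ i : Fin 3, |k i| ≤ ‖k‖ := fun i => PiLp.norm_apply_le k i
  have e3 : |k μ * k ν / ‖k‖ ^ 2| ≤ 1 := by
    rw [abs_div, abs_mul, abs_of_pos (pow_pos hk0 2), div_le_one (pow_pos hk0 2), sq]
    exact mul_le_mul (e2 μ) (e2 ν) (abs_nonneg _) hk0.le
  have e4 : |(if μ = ν then (1 : ℝ) else 0) - k μ * k ν / ‖k‖ ^ 2| ≤ 2 := by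
    refine (abs_sub _ _).trans ?_
    have : |if μ = ν then (1 : ℝ) else 0| ≤ 1 := by split_ifs <;> simp
    linarith
  have e5 := c.rpow_bound (-(1 / 2)) k hk
  have e6 : 0 ≤ (2 * Real.pi) ^ (-(3 / 2) : ℝ) := by positivity
  refine pow_le_pow_left₀ (norm_nonneg _) ?_ 2
  show ‖_ * Complex.exp (-Complex.I * (⟪k, (0 : R3)⟫_ℝ : ℂ))‖ ≤ _
  rw [inner_zero_right, Complex.ofReal_zero, mul_zero, Complex.exp_zero, mul_one,
    Complex.norm_real, Real.norm_eq_abs, abs_mul, abs_mul, abs_of_nonneg e6]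
  have e7 := (abs_nonneg _).trans e5
  exact mul_le_mul (mul_le_mul_of_nonneg_left e5 e6) e4 (abs_nonneg _) (mul_nonneg e6 e7)

theorem norm_photon_le {f : c.photonSpace} {C : ℝ} (hC : 0 ≤ C) (h : ∀ᵐ k ∂c.meas, ‖f.1 k‖ ≤ C) :
    ‖f‖ ≤ (measureUnivNNReal c.meas : ℝ) ^ ((2 : ℝ)⁻¹) * C := by
  have := Lp.norm_le_of_ae_bound (p := 2) (f := f.1) hC h
  simpa using this

theorem exists_norm_mode_le (μ : Fin 3) : ∃ B : ℝ, ∀ x, ‖c.mode x μ‖ ≤ B := by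
  obtain ⟨B, hB, h⟩ := c.exists_norm_modeFun_le μ
  refine ⟨_, fun x => c.norm_photon_le hB ?_⟩
  filter_upwards [c.coeFn_mode x μ, ae_restrict_mem c.measurableSet_shell] with k h1 hk
  rw [h1]
  exact h k hk x

theorem norm_exp_sub_exp_le (s t : ℝ) :
    ‖Complex.exp (-Complex.I * (s : ℂ)) - Complex.exp (-Complex.I * (t : ℂ))‖ ≤ |s - t| := by
  have h := Real.norm_exp_I_mul_ofReal_sub_one_le (x := t - s)
  have e : Complex.exp (-Complex.I * (s : ℂ)) - Complex.exp (-Complex.I * (t : ℂ)) =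
      Complex.exp (-Complex.I * (t : ℂ)) * (Complex.exp (Complex.I * ((t - s : ℝ) : ℂ)) - 1) := by
    rw [mul_sub, ← Complex.exp_add, mul_one]
    congr 2
    push_cast
    ring
  have e1 : ‖Complex.exp (-Complex.I * (t : ℂ))‖ = 1 := by
    rw [Complex.norm_exp]; simp
  rw [e, norm_mul, e1, one_mul, abs_sub_comm]
  exact h

/-- The ultraviolet cutoff bounds |k| by Λ, so the phase e^{-ik·x} is Lipschitz in x uniformly on
the shell; m_μ is bounded there and the shell has finite measure. -/
theorem continuous_mode (μ : Fin 3) : Continuous fun x => c.mode x μ := by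
  obtain ⟨B, hB, h⟩ := c.exists_norm_modeFun_le μ
  have hΛ : 0 ≤ c.Λ := zero_le_one.trans c.one_le_Λ
  refine (LipschitzWith.of_dist_le_mul (K := (measureUnivNNReal c.meas) ^ ((2 : ℝ)⁻¹) *
    Real.toNNReal (c.Λ * B)) fun x x' => ?_).continuous
  rw [dist_eq_norm, dist_eq_norm]
  refine (c.norm_photon_le (C := c.Λ * B * ‖x - x'‖) (by positivity) ?_).trans_eq ?_
  · filter_upwards [c.coeFn_mode x μ, c.coeFn_mode x' μ,
      Lp.coeFn_sub (c.mode x μ).1 (c.mode x' μ).1,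
      ae_restrict_mem c.measurableSet_shell] with k h1 h2 h3 hk
    have e : (c.mode x μ - c.mode x' μ).1 k = (c.mode x μ).1 k - (c.mode x' μ).1 k := h3
    rw [e, h1, h2, modeFun_eq_smul x, modeFun_eq_smul x', ← sub_smul, norm_smul]
    have h4 := norm_exp_sub_exp_le ⟪k, x⟫_ℝ ⟪k, x'⟫_ℝ
    rw [← inner_sub_right] at h4
    have h5 : |⟪k, x - x'⟫_ℝ| ≤ c.Λ * ‖x - x'‖ := (abs_real_inner_le_norm _ _).trans
      (mul_le_mul_of_nonneg_right hk.2.le (norm_nonneg _))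
    refine (mul_le_mul (h4.trans h5) (h k hk 0) (norm_nonneg _) (by positivity)).trans_eq ?_
    ring
  · rw [NNReal.coe_mul, NNReal.coe_rpow, Real.coe_toNNReal _ (mul_nonneg hΛ hB)]
    ring

/-- The amplitude of m_μ is real and even in k, and complex conjugation undoes the sign change in
the phase. -/
theorem J_mode (x : R3) (μ : Fin 3) : c.J (c.mode x μ) = c.mode x μ := by
  refine c.photon_ext ?_
  filter_upwards [c.coeFn_J (c.mode x μ), c.coeFn_mode x μ, c.ae_neg (c.coeFn_mode x μ)]
    with k h1 h2 h3
  rw [h1, h2, h3]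
  ext ν
  simp [conj3, modeFun, ← Complex.exp_conj]

/-- Since k · g(k) = 0, the projection term k_μ k_ν/|k|² drops out and a Fourier integral of the
component g_μ remains. -/
theorem inner_mode (x : R3) (μ : Fin 3) (g : c.photonSpace) :
    ⟪c.mode x μ, g⟫_ℂ = (((2 * Real.pi) ^ (-(3 / 2) : ℝ) : ℝ) : ℂ) *
      ∫ k, Complex.exp (Complex.I * (⟪k, x⟫_ℝ : ℂ)) * (c.absPow (-(1 / 2)) g).1 k μ ∂c.meas := by
  rw [c.inner_photon, ← integral_const_mul]
  refine integral_congr_ae ?_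
  have hg : ∀ᵐ k ∂c.meas, ∑ ν, (k ν : ℂ) * g.1 k ν = 0 := g.2
  filter_upwards [c.coeFn_mode x μ, c.coeFn_absPow (-(1 / 2)) g, hg] with k h1 h2 h3
  have e : ∀ ν, conj (modeFun x μ k ν) * g.1 k ν =
      (((2 * Real.pi) ^ (-(3 / 2) : ℝ) : ℝ) : ℂ) * ((‖k‖ ^ (-(1 / 2) : ℝ) : ℝ) : ℂ) *
        Complex.exp (Complex.I * (⟪k, x⟫_ℝ : ℂ)) * (if μ = ν then g.1 k ν else 0) -
      (((2 * Real.pi) ^ (-(3 / 2) : ℝ) : ℝ) : ℂ) * ((‖k‖ ^ (-(1 / 2) : ℝ) : ℝ) : ℂ) *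
        Complex.exp (Complex.I * (⟪k, x⟫_ℝ : ℂ)) * ((k μ / ‖k‖ ^ 2 : ℝ) : ℂ) *
        ((k ν : ℂ) * g.1 k ν) := fun ν => by
    simp only [modeFun, map_mul, ← Complex.exp_conj, map_neg, Complex.conj_I, Complex.conj_ofReal,
      neg_neg]
    push_cast
    split_ifs
    · rw [Complex.ofReal_one]; ring
    · rw [Complex.ofReal_zero]; ring
  rw [h1, h2, C3.inner_eq]
  simp only [e]
  rw [Finset.sum_sub_distrib, ← Finset.mul_sum, ← Finset.mul_sum, h3, Finset.sum_ite_eq]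
  simp only [Finset.mem_univ, if_true, PiLp.smul_apply, smul_eq_mul]
  ring

end Cutoff

/-! ### The convolution operator in position space -/

theorem C3.norm_le_sum (v : C3) : ‖v‖ ≤ ∑ μ, ‖v μ‖ := by
  rw [EuclideanSpace.norm_eq, Real.sqrt_le_left (Finset.sum_nonneg fun _ _ => norm_nonneg _),
    Fin.sum_univ_three, Fin.sum_univ_three]
  nlinarith [mul_nonneg (norm_nonneg (v 0)) (norm_nonneg (v 1)),
    mul_nonneg (norm_nonneg (v 0)) (norm_nonneg (v 2)),
    mul_nonneg (norm_nonneg (v 1)) (norm_nonneg (v 2))]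

namespace Cutoff

variable (c : Cutoff)

/-- The vector field `x ↦ (√α ⟨m_μ(x), g⟩)_μ`. -/
def photonField (α : ℝ) (g : c.photonSpace) (x : R3) : C3 :=
  WithLp.toLp 2 fun μ => (√α : ℂ) * ⟪c.mode x μ, g⟫_ℂ

theorem continuous_photonField (α : ℝ) (g : c.photonSpace) : Continuous (c.photonField α g) := by
  refine (PiLp.continuous_toLp 2 _).comp (continuous_pi fun μ => continuous_const.mul ?_)
  exact (c.continuous_mode μ).inner continuous_const

theorem exists_norm_photonField_le (α : ℝ) (g : c.photonSpace) :
    ∃ B : ℝ, ∀ x, ‖c.photonField α g x‖ ≤ B := by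
  choose B hB using c.exists_norm_mode_le
  refine ⟨∑ μ, √α * (B μ * ‖g‖), fun x => (C3.norm_le_sum _).trans
    (Finset.sum_le_sum fun μ _ => ?_)⟩
  show ‖(√α : ℂ) * ⟪c.mode x μ, g⟫_ℂ‖ ≤ _
  rw [norm_mul, Complex.norm_real, Real.norm_of_nonneg (Real.sqrt_nonneg _)]
  exact mul_le_mul_of_nonneg_left ((norm_inner_le_norm _ _).trans
    (mul_le_mul_of_nonneg_right (hB μ x) (norm_nonneg _))) (Real.sqrt_nonneg _)

theorem integrable_photon (f : c.photonSpace) : Integrable f.1 c.meas :=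
  (Lp.memLp f.1).integrable (by norm_num)

theorem norm_exp_I_mul (t : ℝ) : ‖Complex.exp (Complex.I * (t : ℂ))‖ = 1 := by
  rw [Complex.norm_exp]; simp

theorem integrable_exp_smul (f : c.photonSpace) (x : R3) :
    Integrable (fun k => Complex.exp (Complex.I * (⟪k, x⟫_ℝ : ℂ)) • f.1 k) c.meas := by
  refine (c.integrable_photon f).norm.mono' ?_ (Filter.Eventually.of_forall fun k => ?_)
  · have : Continuous fun k : R3 => Complex.exp (Complex.I * (⟪k, x⟫_ℝ : ℂ)) := by fun_prop
    exact this.aestronglyMeasurable.smul (c.integrable_photon f).1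
  · rw [norm_smul, norm_exp_I_mul, one_mul]

theorem photonField_eq_integral (α : ℝ) (g : c.photonSpace) (x : R3) :
    c.photonField α g x = ((√α * (2 * Real.pi) ^ (-(3 / 2) : ℝ) : ℝ) : ℂ) •
      ∫ k, Complex.exp (Complex.I * (⟪k, x⟫_ℝ : ℂ)) • (c.absPow (-(1 / 2)) g).1 k ∂c.meas := by
  ext μ
  have h := (EuclideanSpace.proj μ : C3 →L[ℂ] ℂ).integral_comp_comm
    (c.integrable_exp_smul (c.absPow (-(1 / 2)) g) x)
  rw [PiLp.smul_apply, smul_eq_mul, Complex.ofReal_mul, mul_assoc]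
  show (√α : ℂ) * ⟪c.mode x μ, g⟫_ℂ = _
  rw [c.inner_mode]
  congr 2

theorem memLp_smul_photonField (α : ℝ) {r : R3 → ℂ} {p : ℝ≥0∞} (hr : MemLp r p volume)
    (g : c.photonSpace) : MemLp (fun x => r x • c.photonField α g x) p volume := by
  obtain ⟨B, hB⟩ := c.exists_norm_photonField_le α g
  refine hr.of_le_mul (c := B) (hr.1.smul (c.continuous_photonField α g).aestronglyMeasurable)
    (Filter.Eventually.of_forall fun x => ?_)
  rw [norm_smul, mul_comm]
  exact mul_le_mul_of_nonneg_right (hB x) (norm_nonneg _)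

/-- For integrable r the transform of r is an absolutely convergent integral. Fubini exchanges the
x- and k-integrals, and e^{-ix·(p−k)} splits into the Fourier kernel and the phase of the field. -/
theorem convFun_ae_eq_of_integrable (α : ℝ) {r : R3 → ℂ} (h1 : Integrable r)
    (h2 : MemLp r 2 volume) (g : c.photonSpace) :
    c.convFun α (h2.toLp r) (c.absPow (-(1 / 2)) g) =ᵐ[volume]
      fhat ((c.memLp_smul_photonField α h2 g).toLp _) := by
  set G := c.absPow (-(1 / 2)) g
  have hu1 : Integrable (fun x => r x • c.photonField α g x) :=
    memLp_one_iff_integrable.1 (c.memLp_smul_photonField α (memLp_one_iff_integrable.2 h1) g)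
  filter_upwards [fhat_toLp_ae hu1 (c.memLp_smul_photonField α h2 g)] with p hp
  rw [hp, convFun]
  have e1 : ∀ᵐ k ∂c.meas, fhat (h2.toLp r) (p - k) • G.1 k =
      (((2 * Real.pi) ^ (-(3 / 2) : ℝ) : ℝ) : ℂ) •
        ∫ x, (Complex.exp (-Complex.I * (⟪x, p - k⟫_ℝ : ℂ)) • r x) • G.1 k := by
    have h3 := (Measure.measurePreserving_sub_left volume p).quasiMeasurePreserving.ae
      (fhat_toLp_ae h1 h2)
    filter_upwards [ae_restrict_of_ae h3] with k hk
    rw [hk, integral_smul_const, smul_assoc]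
  have e2 : ∀ x : R3, Complex.exp (-Complex.I * (⟪x, p⟫_ℝ : ℂ)) • r x • c.photonField α g x =
      ((√α * (2 * Real.pi) ^ (-(3 / 2) : ℝ) : ℝ) : ℂ) •
      ∫ k, (Complex.exp (-Complex.I * (⟪x, p - k⟫_ℝ : ℂ)) • r x) • G.1 k ∂c.meas := fun x => by
    rw [c.photonField_eq_integral, smul_smul, smul_comm, ← integral_smul]
    congr 1
    refine integral_congr_ae (Filter.Eventually.of_forall fun k => ?_)
    show _ • _ • G.1 k = _ • G.1 k
    rw [smul_smul]
    congr 1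
    rw [smul_eq_mul, mul_right_comm, ← Complex.exp_add, inner_sub_right, real_inner_comm k x]
    congr 2
    push_cast
    ring
  rw [integral_congr_ae e1, integral_smul]
  simp only [e2]
  rw [integral_smul, smul_comm]
  congr 2
  refine integral_integral_swap ?_
  have h4 := h1.smul_prod (c.integrable_photon G)
  refine (h4.swap.norm).mono' ?_ (Filter.Eventually.of_forall fun z => ?_)
  · have h5 : Continuous fun z : R3 × R3 =>
        Complex.exp (-Complex.I * (⟪z.2, p - z.1⟫_ℝ : ℂ)) := by fun_prop
    exact (h5.aestronglyMeasurable.smul h1.1.comp_snd).smul (c.integrable_photon G).1.comp_fst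
  · have h6 : ‖Complex.exp (-Complex.I * (⟪z.2, p - z.1⟫_ℝ : ℂ))‖ = 1 := by
      rw [Complex.norm_exp]; simp
    show ‖(Complex.exp (-Complex.I * (⟪z.2, p - z.1⟫_ℝ : ℂ)) • r z.2) • G.1 z.1‖ ≤
      ‖r z.2 • G.1 z.1‖
    rw [norm_smul, norm_smul, norm_smul, h6, one_mul]

theorem convFun_sub (α : ℝ) (r r' : Lp ℂ 2 (volume : Measure R3)) (f : c.photonSpace) (p : R3) :
    c.convFun α (r - r') f p = c.convFun α r f p - c.convFun α r' f p := by
  rw [convFun, convFun, convFun, ← smul_sub,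
    ← integral_sub (c.integrable_conv r f p) (c.integrable_conv r' f p)]
  congr 1
  refine integral_congr_ae ?_
  have h3 := (Measure.measurePreserving_sub_left volume p).quasiMeasurePreserving.ae
    (fhat_sub r r')
  filter_upwards [ae_restrict_of_ae h3] with k hk
  rw [hk, sub_smul]

/-- Cauchy–Schwarz in k gives continuity in r at every single p, which is needed to pass to the
limit from integrable r. -/
theorem norm_convFun_le (α : ℝ) (r : Lp ℂ 2 (volume : Measure R3)) (f : c.photonSpace) (p : R3) :
    ‖c.convFun α r f p‖ ≤
      ‖((√α * (2 * Real.pi) ^ (-(3 / 2) : ℝ) : ℝ) : ℂ)‖ * (‖r‖ * ‖f‖) := by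
  rw [convFun, norm_smul]
  refine mul_le_mul_of_nonneg_left ?_ (norm_nonneg _)
  have h1 : eLpNorm (fun k => fhat r (p - k)) 2 c.meas ≤ eLpNorm (fhat r) 2 volume := by
    refine (eLpNorm_restrict_le _ _ _ _).trans_eq ?_
    exact eLpNorm_comp_measurePreserving (memLp_fhat r).1
      (Measure.measurePreserving_sub_left volume p)
  have h2 := eLpNorm_smul_le_mul_eLpNorm (p := 2) (q := 2) (r := 1)
    (Lp.aestronglyMeasurable f.1) (c.aestronglyMeasurable_fhat_sub r p)
  have h3 : ‖r‖ = (eLpNorm (fhat r) 2 volume).toReal := by rw [← norm_fhat, Lp.norm_toLp]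
  have h4 : ‖f‖ = (eLpNorm f.1 2 c.meas).toReal := rfl
  rw [h3, h4, ← ENNReal.toReal_mul]
  refine (norm_integral_le_lintegral_norm _).trans (ENNReal.toReal_mono
    (ENNReal.mul_ne_top (memLp_fhat r).2.ne (Lp.memLp f.1).2.ne) ?_)
  refine le_trans ?_ (h2.trans (mul_le_mul_left h1 _))
  rw [eLpNorm_one_eq_lintegral_enorm]
  refine le_of_eq (lintegral_congr fun k => ?_)
  rw [ofReal_norm]
  rfl

theorem norm_toLp_smul_photonField_le (α : ℝ) (g : c.photonSpace) : ∃ B : ℝ, ∀ (r : R3 → ℂ)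
    (hr : MemLp r 2 volume),
    ‖(c.memLp_smul_photonField α hr g).toLp _‖ ≤ B * ‖hr.toLp r‖ := by
  obtain ⟨B, hB⟩ := c.exists_norm_photonField_le α g
  refine ⟨B, fun r hr => Lp.norm_le_mul_norm_of_ae_le_mul ?_⟩
  filter_upwards [(c.memLp_smul_photonField α hr g).coeFn_toLp, hr.coeFn_toLp] with x h1 h2
  rw [h1, h2, norm_smul, mul_comm]
  exact mul_le_mul_of_nonneg_right (hB x) (norm_nonneg _)

/-- `Φ_{r,α} |k|^{-1/2} g` is the Fourier transform of `r` times the field of `g`. -/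
theorem convFun_ae_eq (α : ℝ) {r : R3 → ℂ} (h2 : MemLp r 2 volume) (g : c.photonSpace) :
    c.convFun α (h2.toLp r) (c.absPow (-(1 / 2)) g) =ᵐ[volume]
      fhat ((c.memLp_smul_photonField α h2 g).toLp _) := by
  obtain ⟨s, hs⟩ := exists_schwartz_seq (h2.toLp r)
  let M : ∀ n, MemLp (s n) 2 volume := fun n => (s n).memLp 2 volume
  let U : ℕ → Lp C3 2 (volume : Measure R3) := fun n => (c.memLp_smul_photonField α (M n) g).toLp _
  let U0 : Lp C3 2 (volume : Measure R3) := (c.memLp_smul_photonField α h2 g).toLp _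
  obtain ⟨B, hB⟩ := c.norm_toLp_smul_photonField_le α g
  have hs0 : Filter.Tendsto (fun n => ‖(M n).toLp (s n) - h2.toLp r‖) Filter.atTop (nhds 0) :=
    tendsto_iff_norm_sub_tendsto_zero.1 hs
  have hU : Filter.Tendsto (fun n => ((memLp_fhat (U n)).toLp (fhat (U n)))) Filter.atTop
      (nhds ((memLp_fhat U0).toLp (fhat U0))) := by
    rw [tendsto_iff_norm_sub_tendsto_zero]
    refine squeeze_zero (fun n => norm_nonneg _) (fun n => ?_)
      (by simpa using hs0.const_mul B)
    have e1 : (memLp_fhat (U n)).toLp (fhat (U n)) - (memLp_fhat U0).toLp (fhat U0) =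
        (memLp_fhat (U n - U0)).toLp (fhat (U n - U0)) := by
      rw [← MemLp.toLp_sub]
      exact MemLp.toLp_congr _ _ (fhat_sub _ _).symm
    have e2 : U n - U0 = (c.memLp_smul_photonField α ((M n).sub h2) g).toLp _ := by
      rw [← MemLp.toLp_sub]
      refine MemLp.toLp_congr _ _ (Filter.Eventually.of_forall fun x => ?_)
      show s n x • c.photonField α g x - r x • c.photonField α g x =
        (s n x - r x) • c.photonField α g x
      rw [sub_smul]
    rw [e1, norm_fhat, e2]
    refine (hB _ ((M n).sub h2)).trans_eq ?_
    rw [MemLp.toLp_sub]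
  -- On the Fourier side convergence holds only in L², hence almost everywhere along a subsequence;
  -- on the convolution side it holds at every p, and the limits are compared along that
  -- subsequence.
  obtain ⟨ns, hns, hlim⟩ := (tendstoInMeasure_of_tendsto_Lp hU).exists_seq_tendsto_ae
  have h3 : ∀ᵐ p, ∀ n, (memLp_fhat (U n)).toLp (fhat (U n)) p =
      c.convFun α ((M n).toLp (s n)) (c.absPow (-(1 / 2)) g) p := ae_all_iff.2 fun n => by
    filter_upwards [(memLp_fhat (U n)).coeFn_toLp,
      c.convFun_ae_eq_of_integrable α (s n).integrable (M n) g] with p h4 h5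
    rw [h4, h5]
  filter_upwards [hlim, h3, (memLp_fhat U0).coeFn_toLp] with p h4 h5 h6
  rw [h6] at h4
  simp only [h5] at h4
  refine tendsto_nhds_unique ?_ h4
  have h8 : ∀ A : ℝ, Filter.Tendsto (fun n => A * (‖(M n).toLp (s n) - h2.toLp r‖ *
      ‖c.absPow (-(1 / 2)) g‖)) Filter.atTop (nhds 0) := fun A => by
    have := (hs0.mul_const (‖c.absPow (-(1 / 2)) g‖)).const_mul A
    rwa [zero_mul, mul_zero] at this
  have h7 : Filter.Tendsto (fun n => c.convFun α ((M n).toLp (s n)) (c.absPow (-(1 / 2)) g) p)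
      Filter.atTop (nhds (c.convFun α (h2.toLp r) (c.absPow (-(1 / 2)) g) p)) := by
    rw [tendsto_iff_norm_sub_tendsto_zero]
    refine squeeze_zero (fun n => norm_nonneg _) (fun n => ?_)
      (h8 (‖((√α * (2 * Real.pi) ^ (-(3 / 2) : ℝ) : ℝ) : ℂ)‖))
    rw [← c.convFun_sub]
    exact c.norm_convFun_le α _ _ p
  exact h7.comp hns.tendsto_atTop

theorem Phi_absPow (α : ℝ) {r : R3 → ℂ} (h2 : MemLp r 2 volume) (g : c.photonSpace) :
    c.Phi α (h2.toLp r) (c.absPow (-(1 / 2)) g) =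
      (memLp_fhat ((c.memLp_smul_photonField α h2 g).toLp _)).toLp _ :=
  MemLp.toLp_congr (c.memLp_convFun α (h2.toLp r) _) (memLp_fhat _) (c.convFun_ae_eq α h2 g)

/-- The vector `√α r(x) m_μ(x)`. -/
def kernelVec (α : ℝ) (r : R3 → ℝ) (z : R3 × Fin 3) : c.photonSpace :=
  ((√α * r z.1 : ℝ) : ℂ) • c.mode z.1 z.2

theorem conj_inner_mode (x : R3) (μ : Fin 3) (f : c.photonSpace) :
    conj ⟪c.mode x μ, f⟫_ℂ = ⟪f, c.mode x μ⟫_ℂ := inner_conj_symm (𝕜 := ℂ) f (c.mode x μ)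

theorem inner_kernelVec_left (α : ℝ) (r : R3 → ℝ) (x : R3) (μ : Fin 3) (g : c.photonSpace) :
    ⟪c.kernelVec α r (x, μ), g⟫_ℂ = ((√α * r x : ℝ) : ℂ) * ⟪c.mode x μ, g⟫_ℂ := by
  refine (inner_smul_left (𝕜 := ℂ) (c.mode x μ) g _).trans ?_
  rw [Complex.conj_ofReal]

theorem inner_kernelVec_right (α : ℝ) (r : R3 → ℝ) (x : R3) (μ : Fin 3) (g : c.photonSpace) :
    ⟪g, c.kernelVec α r (x, μ)⟫_ℂ = ((√α * r x : ℝ) : ℂ) * ⟪g, c.mode x μ⟫_ℂ :=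
  inner_smul_right (𝕜 := ℂ) g (c.mode x μ) _

/-- By Plancherel ⟨Φ|k|^{-1/2} f, Φ|k|^{-1/2} g⟩ is an integral over x, which displays |k|^{-1/2} Θ
|k|^{-1/2} as ∫ Σ_μ |v⟩⟨v| dx. -/
theorem inner_absPow_Theta (α : ℝ) {r : R3 → ℝ} (h2 : MemLp (fun x => (r x : ℂ)) 2 volume)
    (f g : c.photonSpace) :
    ⟪f, c.absPow (-(1 / 2)) (c.Theta α (h2.toLp _) (c.absPow (-(1 / 2)) g))⟫_ℂ =
      ∫ x, ∑ μ, ⟪f, c.kernelVec α r (x, μ)⟫_ℂ * ⟪c.kernelVec α r (x, μ), g⟫_ℂ := by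
  rw [← c.inner_absPow_left, Theta, ContinuousLinearMap.comp_apply,
    ContinuousLinearMap.adjoint_inner_right, c.Phi_absPow, c.Phi_absPow, inner_fhat, L2.inner_def]
  refine integral_congr_ae ?_
  filter_upwards [(c.memLp_smul_photonField α h2 f).coeFn_toLp,
    (c.memLp_smul_photonField α h2 g).coeFn_toLp] with x h3 h4
  rw [h3, h4, C3.inner_eq]
  refine Finset.sum_congr rfl fun μ _ => ?_
  show conj ((r x : ℂ) * ((√α : ℂ) * ⟪c.mode x μ, f⟫_ℂ)) *
    ((r x : ℂ) * ((√α : ℂ) * ⟪c.mode x μ, g⟫_ℂ)) = _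
  rw [inner_kernelVec_left, inner_kernelVec_right, map_mul, map_mul, c.conj_inner_mode,
    Complex.conj_ofReal, Complex.conj_ofReal]
  push_cast
  ring

theorem inner_yVec (α : ℝ) {r : R3 → ℝ} (h2 : MemLp (fun x => (r x : ℂ)) 2 volume)
    {w : R3 → C3} (hw : MemLp w 2 volume) (f : c.photonSpace) :
    ⟪f, c.yVec α (h2.toLp _) (hw.toLp w)⟫_ℂ =
      ∫ x, ∑ μ, ⟪f, c.kernelVec α r (x, μ)⟫_ℂ * w x μ := by
  rw [yVec, ← c.inner_absPow_left, ContinuousLinearMap.adjoint_inner_right, c.Phi_absPow,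
    inner_fhat, L2.inner_def]
  refine integral_congr_ae ?_
  filter_upwards [(c.memLp_smul_photonField α h2 f).coeFn_toLp, hw.coeFn_toLp] with x h3 h4
  rw [h3, h4, C3.inner_eq]
  refine Finset.sum_congr rfl fun μ _ => ?_
  show conj ((r x : ℂ) * ((√α : ℂ) * ⟪c.mode x μ, f⟫_ℂ)) * w x μ = _
  rw [inner_kernelVec_right, map_mul, map_mul, c.conj_inner_mode, Complex.conj_ofReal,
    Complex.conj_ofReal]
  push_cast
  ring

end Cutoff

/-! ### The operator T as an integral of rank-one operators -/

/-- The measure on `ℝ³ × {0, 1, 2}` whose integral is `F ↦ ∫ ∑_μ F(x, μ) dx`. -/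
def compMeasure : Measure (R3 × Fin 3) :=
  ∑ μ : Fin 3, Measure.map (fun x : R3 => (x, μ)) volume

theorem aestronglyMeasurable_compMeasure {E : Type*} [NormedAddCommGroup E] {F : R3 × Fin 3 → E}
    (h : ∀ μ, AEStronglyMeasurable (fun x => F (x, μ)) volume) :
    AEStronglyMeasurable F compMeasure := by
  rw [compMeasure, ← Measure.sum_fintype, aestronglyMeasurable_sum_measure_iff]
  intro μ
  exact ((measurableEmbedding_prod_mk_right μ).aestronglyMeasurable_map_iff).2 (h μ)

theorem integrable_compMeasure {E : Type*} [NormedAddCommGroup E] {F : R3 × Fin 3 → E}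
    (h : ∀ μ, Integrable fun x => F (x, μ)) : Integrable F compMeasure :=
  integrable_finsetSum_measure.2 fun μ _ =>
    ((measurableEmbedding_prod_mk_right μ).integrable_map_iff).2 (h μ)

theorem integral_compMeasure {E : Type*} [NormedAddCommGroup E] [NormedSpace ℝ E]
    {F : R3 × Fin 3 → E} (h : ∀ μ, Integrable fun x => F (x, μ)) :
    ∫ z, F z ∂compMeasure = ∫ x, ∑ μ, F (x, μ) := by
  rw [compMeasure, integral_finsetSum_measure fun μ _ =>
    ((measurableEmbedding_prod_mk_right μ).integrable_map_iff).2 (h μ),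
    integral_finsetSum _ fun μ _ => h μ]
  exact Finset.sum_congr rfl fun μ _ => (measurableEmbedding_prod_mk_right μ).integral_map F

theorem memLp_two_compMeasure {w : R3 × Fin 3 → ℝ}
    (h : ∀ μ, MemLp (fun x => w (x, μ)) 2 volume) : MemLp w 2 compMeasure :=
  (memLp_two_iff_integrable_sq (aestronglyMeasurable_compMeasure fun μ => (h μ).1)).2
    (integrable_compMeasure fun μ => (h μ).integrable_sq)

/-- Θ fills all four blocks, so it sees only the sums of the two components, while P sees only the
first ones. -/
theorem inner_blockOp {H : Type*} [NormedAddCommGroup H] [InnerProductSpace ℂ H]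
    (a P Θ : H →L[ℂ] H) (F G : WithLp 2 (H × H)) :
    ⟪F, (blockOp a 0 0 a ∘L blockOp (P + Θ) Θ Θ Θ ∘L blockOp a 0 0 a) G⟫_ℂ =
      ⟪F.fst, a (P (a G.fst))⟫_ℂ + ⟪F.fst + F.snd, a (Θ (a (G.fst + G.snd)))⟫_ℂ := by
  have e : ∀ (A B C D : H →L[ℂ] H) (K : WithLp 2 (H × H)),
      (blockOp A B C D K).fst = A K.fst + B K.snd ∧ (blockOp A B C D K).snd = C K.fst + D K.snd :=
    fun A B C D K => ⟨rfl, rfl⟩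
  rw [ContinuousLinearMap.comp_apply, ContinuousLinearMap.comp_apply, WithLp.inner_prod]
  simp only [e, zero_apply, zero_add, add_zero, add_apply, map_add, inner_add_left,
    inner_add_right]
  ring

theorem inner_qMap_right {H : Type*} [NormedAddCommGroup H] [InnerProductSpace ℂ H] {J : H → H}
    {v : H} (hv : J v = v) (F : WithLp 2 (H × H)) :
    ⟪F, qMap J v⟫_ℂ = ⟪F.fst + F.snd, v⟫_ℂ := by
  rw [WithLp.inner_prod, inner_add_left]
  show _ + ⟪F.snd, J v⟫_ℂ = _
  rw [hv]
  rfl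

theorem inner_qMap_left {H : Type*} [NormedAddCommGroup H] [InnerProductSpace ℂ H] {J : H → H}
    {v : H} (hv : J v = v) (F : WithLp 2 (H × H)) :
    ⟪qMap J v, F⟫_ℂ = ⟪v, F.fst + F.snd⟫_ℂ := by
  rw [← inner_conj_symm, inner_qMap_right hv, inner_conj_symm]

namespace Cutoff

variable (c : Cutoff)

theorem aestronglyMeasurable_kernelVec (α : ℝ) {r : R3 → ℝ} (hr : MemLp r 2 volume) (μ : Fin 3) :
    AEStronglyMeasurable (fun x => c.kernelVec α r (x, μ)) volume :=
  (Complex.continuous_ofReal.comp_aestronglyMeasurable (hr.1.const_mul √α)).smul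
    (c.continuous_mode μ).aestronglyMeasurable

theorem norm_kernelVec (α : ℝ) (r : R3 → ℝ) (x : R3) (μ : Fin 3) :
    ‖c.kernelVec α r (x, μ)‖ = √α * |r x| * ‖c.mode x μ‖ := by
  rw [kernelVec, norm_smul, Complex.norm_real, norm_mul, Real.norm_of_nonneg (Real.sqrt_nonneg _),
    Real.norm_eq_abs]

theorem integrable_norm_kernelVec_sq (α : ℝ) {r : R3 → ℝ} (hr : MemLp r 2 volume) (μ : Fin 3) :
    Integrable fun x => ‖c.kernelVec α r (x, μ)‖ ^ 2 := by
  obtain ⟨B, hB⟩ := c.exists_norm_mode_le μ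
  refine (hr.integrable_sq.const_mul (√α ^ 2 * B ^ 2)).mono'
    ((c.aestronglyMeasurable_kernelVec α hr μ).norm.pow 2)
    (Filter.Eventually.of_forall fun x => ?_)
  rw [Real.norm_of_nonneg (sq_nonneg _), norm_kernelVec, mul_pow, mul_pow, sq_abs]
  have := pow_le_pow_left₀ (norm_nonneg _) (hB x) 2
  calc √α ^ 2 * r x ^ 2 * ‖c.mode x μ‖ ^ 2 ≤ √α ^ 2 * r x ^ 2 * B ^ 2 := by gcongr
    _ = _ := by ring

theorem integrable_inner_kernelVec (α : ℝ) {r : R3 → ℝ} (hr : MemLp r 2 volume)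
    (f g : c.photonSpace) (μ : Fin 3) :
    Integrable fun x => ⟪f, c.kernelVec α r (x, μ)⟫_ℂ * ⟪c.kernelVec α r (x, μ), g⟫_ℂ := by
  have hm := c.aestronglyMeasurable_kernelVec α hr μ
  refine ((c.integrable_norm_kernelVec_sq α hr μ).const_mul (‖f‖ * ‖g‖)).mono'
    ((aestronglyMeasurable_const.inner hm).mul (hm.inner aestronglyMeasurable_const))
    (Filter.Eventually.of_forall fun x => ?_)
  exact norm_inner_mul_inner_le f g _

theorem integrable_inner_kernelVec_mul (α : ℝ) {r : R3 → ℝ} (hr : MemLp r 2 volume)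
    (f : c.photonSpace) {w : R3 → ℝ} (hw : MemLp w 2 volume) (μ : Fin 3) :
    Integrable fun x => ⟪f, c.kernelVec α r (x, μ)⟫_ℂ * (w x : ℂ) := by
  have hm := c.aestronglyMeasurable_kernelVec α hr μ
  have h1 : MemLp (fun x => ⟪f, c.kernelVec α r (x, μ)⟫_ℂ) 2 volume := by
    refine (memLp_two_iff_integrable_sq_norm (aestronglyMeasurable_const.inner hm)).2 ?_
    refine ((c.integrable_norm_kernelVec_sq α hr μ).const_mul (‖f‖ ^ 2)).mono'
      ((aestronglyMeasurable_const.inner hm).norm.pow 2) (Filter.Eventually.of_forall fun x => ?_)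
    rw [Real.norm_of_nonneg (sq_nonneg _), ← mul_pow]
    exact pow_le_pow_left₀ (norm_nonneg _)
      (norm_inner_le_norm (𝕜 := ℂ) f (c.kernelVec α r (x, μ))) 2
  exact h1.integrable_mul hw.ofReal

theorem J_kernelVec (α : ℝ) (r : R3 → ℝ) (z : R3 × Fin 3) :
    c.J (c.kernelVec α r z) = c.kernelVec α r z := by
  rw [kernelVec, c.isAntiunitaryInvolution_J.map_smul, Complex.conj_ofReal, c.J_mode]

theorem inner_T (α : ℝ) (R : Lp ℂ 2 (volume : Measure R3))
    (F G : WithLp 2 (c.photonSpace × c.photonSpace)) :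
    ⟪F, c.T α R G⟫_ℂ = ⟪F.fst, ((2 : ℂ) • c.absPow 1) G.fst⟫_ℂ +
      ⟪F.fst + F.snd,
        c.absPow (-(1 / 2)) (c.Theta α R (c.absPow (-(1 / 2)) (G.fst + G.snd)))⟫_ℂ := by
  have e2 : c.absPow (-(1 / 2)) (((2 : ℂ) • c.absPow 2) (c.absPow (-(1 / 2)) G.fst)) =
      ((2 : ℂ) • c.absPow 1) G.fst := by
    rw [smul_apply, smul_apply, map_smul, c.absPow_absPow, c.absPow_absPow]
    norm_num
  rw [← e2]
  exact inner_blockOp _ _ _ F G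

/-- Two facts combine: |k|^{-1/2} · 2|k|² · |k|^{-1/2} = 2|k|, and, for real v, pairing with q(v)
depends only on the sum of the two components, which matches the block structure of Θ. -/
theorem isFormKernel (α : ℝ) {r : R3 → ℝ} (hr : MemLp r 2 volume) :
    IsFormKernel compMeasure c.J ((2 : ℂ) • c.absPow 1) (c.kernelVec α r)
      (c.T α ((hr.ofReal (K := ℂ)).toLp _)) where
  involution := c.isAntiunitaryInvolution_J
  real := c.J_kernelVec α r
  aestronglyMeasurable :=
    aestronglyMeasurable_compMeasure (c.aestronglyMeasurable_kernelVec α hr)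
  integrable_sq := integrable_compMeasure (c.integrable_norm_kernelVec_sq α hr)
  symm f g := by
    rw [smul_apply, smul_apply, inner_smul_left,
      inner_smul_right, Complex.conj_ofNat, c.inner_absPow_left]
  inner_map F G := by
    have e1 := fun z => inner_qMap_right (c.J_kernelVec α r z) F
    have e2 := fun z => inner_qMap_left (c.J_kernelVec α r z) G
    simp only [e1, e2]
    rw [c.inner_T, integral_compMeasure
      (F := fun z => ⟪F.fst + F.snd, c.kernelVec α r z⟫_ℂ * ⟪c.kernelVec α r z, G.fst + G.snd⟫_ℂ)
      (c.integrable_inner_kernelVec α hr _ _)]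
    congr 1
    exact c.inner_absPow_Theta α (hr.ofReal (K := ℂ)) _ _

theorem le_inner_two_absPow (f : c.photonSpace) :
    2 * c.σ * ‖f‖ ^ 2 ≤ (⟪f, ((2 : ℂ) • c.absPow 1) f⟫_ℂ).re := by
  have h := c.le_inner_absPow_one f
  rw [smul_apply, inner_smul_right, show (2 : ℂ) = ((2 : ℝ) : ℂ) by norm_num,
    Complex.re_ofReal_mul]
  linarith

theorem two_absPow_J (f : c.photonSpace) :
    ((2 : ℂ) • c.absPow 1) (c.J f) = c.J (((2 : ℂ) • c.absPow 1) f) := by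
  rw [smul_apply, smul_apply,
    c.isAntiunitaryInvolution_J.map_smul, Complex.conj_ofNat, c.absPow_J]

theorem inner_yVec_eq (α : ℝ) {r : R3 → ℝ} (hr : MemLp r 2 volume) {w : R3 → C3}
    (hw : MemLp w 2 volume) {t : R3 × Fin 3 → ℝ} (hwt : ∀ x μ, w x μ = (t (x, μ) : ℂ))
    (ht : ∀ μ, MemLp (fun x => t (x, μ)) 2 volume) (f : c.photonSpace) :
    ⟪f, c.yVec α ((hr.ofReal (K := ℂ)).toLp _) (hw.toLp w)⟫_ℂ =
      ∫ z, ⟪f, c.kernelVec α r z⟫_ℂ * (t z : ℂ) ∂compMeasure := by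
  rw [integral_compMeasure (F := fun z => ⟪f, c.kernelVec α r z⟫_ℂ * (t z : ℂ))
    fun μ => c.integrable_inner_kernelVec_mul α hr f (ht μ) μ]
  simp only [← hwt]
  exact c.inner_yVec α (hr.ofReal (K := ℂ)) hw f

/-- Orthonormal vectors have mutual distance √2, so balls of radius ½ around them are disjoint in a
separable space. -/
theorem countable_of_hilbertBasis {ι : Type*} (b : HilbertBasis ι ℂ c.photonSpace) :
    Countable ι := by
  have : Fact ((2 : ℝ≥0∞) ≠ ⊤) := ⟨ENNReal.ofNat_ne_top⟩
  have : SecondCountableTopology (Lp C3 2 c.meas) := inferInstance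
  refine Pairwise.countable_of_isOpen_disjoint (s := fun i => Metric.ball (b i) (1 / 2))
    (fun i j hij => Metric.ball_disjoint_ball ?_) (fun i => Metric.isOpen_ball)
    (fun i => ⟨b i, Metric.mem_ball_self (by norm_num)⟩)
  have h1 : ‖b i - b j‖ ^ 2 = 2 := by
    rw [@norm_sub_sq ℂ, b.orthonormal.1 i, b.orthonormal.1 j, b.orthonormal.2 hij]
    norm_num
  rw [dist_eq_norm]
  nlinarith [norm_nonneg (b i - b j)]

end Cutoff

/-! ### Mollification and the chain rule for Sobolev functions -/

open Filter Topology in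
/-- Dominated convergence with a convergent sequence of dominating functions. -/
theorem tendsto_integral_of_tendsto_dominating {X E : Type*} [MeasurableSpace X] {ν : Measure X}
    [NormedAddCommGroup E] [NormedSpace ℝ E] {F : ℕ → X → E} {f : X → E} {B : ℕ → X → ℝ}
    {B' : X → ℝ} (hF : ∀ n, AEStronglyMeasurable (F n) ν) (hB : ∀ n, Integrable (B n) ν)
    (hB' : Integrable B' ν) (hFB : ∀ n, ∀ᵐ x ∂ν, ‖F n x‖ ≤ B n x)
    (hlim : ∀ᵐ x ∂ν, Tendsto (fun n => F n x) atTop (𝓝 (f x)))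
    (hBlim : ∀ᵐ x ∂ν, Tendsto (fun n => B n x) atTop (𝓝 (B' x)))
    (hBint : Tendsto (fun n => ∫ x, B n x ∂ν) atTop (𝓝 (∫ x, B' x ∂ν))) :
    Tendsto (fun n => ∫ x, F n x ∂ν) atTop (𝓝 (∫ x, f x ∂ν)) := by
  have hFB' : ∀ᵐ x ∂ν, ∀ n, ‖F n x‖ ≤ B n x := ae_all_iff.2 hFB
  have hB0 : ∀ᵐ x ∂ν, 0 ≤ B' x := by
    filter_upwards [hFB', hBlim] with x h1 h2
    exact ge_of_tendsto' h2 fun n => (norm_nonneg _).trans (h1 n)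
  have hfB : ∀ᵐ x ∂ν, ‖f x‖ ≤ B' x := by
    filter_upwards [hFB', hlim, hBlim] with x h1 h2 h3
    exact le_of_tendsto_of_tendsto' h2.norm h3 h1
  have hfm : AEStronglyMeasurable f ν := aestronglyMeasurable_of_tendsto_ae atTop hF hlim
  have hfi : Integrable f ν := hB'.mono' hfm hfB
  have hFi : ∀ n, Integrable (F n) ν := fun n => (hB n).mono' (hF n) (hFB n)
  have h1 : Tendsto (fun n => ∫ x, min ‖F n x - f x‖ (2 * B' x) ∂ν) atTop (𝓝 (∫ x, 0 ∂ν)) := by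
    refine tendsto_integral_of_dominated_convergence (fun x => 2 * B' x)
      (fun n => ((hF n).sub hfm).norm.inf (hB'.1.const_mul 2)) (hB'.const_mul 2) (fun n => ?_) ?_
    · filter_upwards [hB0] with x hx
      rw [Real.norm_of_nonneg (le_min (norm_nonneg _) (by linarith))]
      exact min_le_right _ _
    · filter_upwards [hlim, hB0] with x hx h0
      have := ((hx.sub_const (f x)).norm).min (tendsto_const_nhds (x := 2 * B' x))
      rwa [sub_self, norm_zero, min_eq_left (by linarith)] at this
  have h2 : Tendsto (fun n => ∫ x, min (B n x) (B' x) ∂ν) atTop (𝓝 (∫ x, B' x ∂ν)) := by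
    refine tendsto_integral_of_dominated_convergence B'
      (fun n => (hB n).1.inf hB'.1) hB' (fun n => ?_) ?_
    · filter_upwards [hB0, hFB'] with x hx h
      rw [Real.norm_of_nonneg (le_min ((norm_nonneg _).trans (h n)) hx)]
      exact min_le_right _ _
    · filter_upwards [hBlim] with x hx
      simpa using hx.min (tendsto_const_nhds (x := B' x))
  have h3 := h1.add (hBint.sub h2)
  -- From ‖F n − f‖ ≤ B n + B' it follows that ‖F n − f‖ ≤ min(‖F n − f‖, 2B') + (B n − min(B n,
  -- B')). The first term is dominated by 2B' and the second has integral tending to zero.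
  rw [sub_self, integral_zero, add_zero] at h3
  rw [tendsto_iff_norm_sub_tendsto_zero]
  refine squeeze_zero (fun n => norm_nonneg _) (fun n => ?_) h3
  rw [← integral_sub (hFi n) hfi]
  refine (norm_integral_le_integral_norm _).trans ?_
  have i1 : Integrable (fun x => min ‖F n x - f x‖ (2 * B' x)) ν :=
    ((hFi n).sub hfi).norm.inf (hB'.const_mul 2)
  have i2 : Integrable (fun x => min (B n x) (B' x)) ν := (hB n).inf hB'
  rw [← integral_sub (hB n) i2,
    ← integral_add (f := fun x => min ‖F n x - f x‖ (2 * B' x))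
      (g := fun x => B n x - min (B n x) (B' x)) i1 ((hB n).sub i2)]
  refine integral_mono_ae ((hFi n).sub hfi).norm (i1.add ((hB n).sub i2)) ?_
  filter_upwards [hFB', hfB] with x h5 h6
  have h7 := norm_sub_le (F n x) (f x)
  have h8 := h5 n
  rcases min_cases ‖F n x - f x‖ (2 * B' x) with h | h <;>
    rcases min_cases (B n x) (B' x) with h' | h' <;> linarith

/-- A sequence of bump functions on `ℝ³` that concentrates at the origin. -/
def bump (n : ℕ) : ContDiffBump (0 : R3) where
  rIn := 1 / (n + 2)
  rOut := 2 / (n + 2)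
  rIn_pos := by positivity
  rIn_lt_rOut := by gcongr; norm_num

open Filter Topology in
theorem tendsto_rOut_bump : Tendsto (fun n => (bump n).rOut) atTop (𝓝 0) := by
  have h : Tendsto (fun n : ℕ => (n : ℝ) + 2) atTop atTop :=
    tendsto_atTop_add_const_right _ _ tendsto_natCast_atTop_atTop
  exact h.const_div_atTop 2

theorem rOut_bump_le (n : ℕ) : (bump n).rOut ≤ 1 :=
  (div_le_one (by positivity)).2 (by linarith [Nat.cast_nonneg (α := ℝ) n])

variable {F : Type*} [NormedAddCommGroup F] [NormedSpace ℝ F]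

/-- The mollification `x ↦ ∫ η_n(x - t) f(t) dt` of `f`. -/
def mollify (n : ℕ) (f : R3 → F) : R3 → F :=
  convolution ((bump n).normed volume) f (ContinuousLinearMap.lsmul ℝ ℝ) volume

theorem mollify_apply (n : ℕ) (f : R3 → F) (x : R3) :
    mollify n f x = ∫ t, (bump n).normed volume (x - t) • f t :=
  convolution_lsmul_swap

open Filter Topology in
theorem ae_tendsto_mollify [CompleteSpace F] {f : R3 → F} (hf : LocallyIntegrable f volume) :
    ∀ᵐ x, Tendsto (fun n => mollify n f x) atTop (𝓝 (f x)) :=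
  ContDiffBump.ae_convolution_tendsto_right_of_locallyIntegrable (K := 2) tendsto_rOut_bump
    (Eventually.of_forall fun n => by
      show 2 / ((n : ℝ) + 2) ≤ 2 * (1 / (n + 2)); exact le_of_eq (by ring)) hf

theorem integrable_mollify {f : R3 → F} (hf : Integrable f) (n : ℕ) : Integrable (mollify n f) :=
  (bump n).integrable_normed.integrable_convolution _ hf

theorem integral_mollify [CompleteSpace F] {f : R3 → F} (hf : Integrable f) (n : ℕ) :
    ∫ x, mollify n f x = ∫ x, f x := by
  have h := integral_convolution (ContinuousLinearMap.lsmul ℝ ℝ : ℝ →L[ℝ] F →L[ℝ] F)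
    ((bump n).integrable_normed (μ := volume)) hf
  rw [(bump n).integral_normed] at h
  exact h.trans (one_smul ℝ _)

theorem norm_mollify_le (n : ℕ) (f : R3 → F) (x : R3) :
    ‖mollify n f x‖ ≤ mollify n (fun t => ‖f t‖) x := by
  rw [mollify_apply, mollify_apply]
  refine (norm_integral_le_integral_norm _).trans (le_of_eq ?_)
  congr 1
  funext t
  rw [norm_smul, Real.norm_of_nonneg ((bump n).nonneg_normed _), smul_eq_mul]

theorem mollify_congr {f g : R3 → F} {x : R3} (n : ℕ)
    (h : ∀ t ∈ Metric.ball x 1, f t = g t) : mollify n f x = mollify n g x := by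
  rw [mollify_apply, mollify_apply]
  congr 1
  funext t
  by_cases ht : t ∈ Metric.ball x 1
  · rw [h t ht]
  · have : (bump n).normed volume (x - t) = 0 := by
      refine Function.notMem_support.1 fun h' => ht ?_
      rw [ContDiffBump.support_normed_eq, mem_ball_zero_iff, ← dist_eq_norm, dist_comm] at h'
      exact h'.trans_le (rOut_bump_le n)
    rw [this, zero_smul, zero_smul]

theorem contDiff_mollify {f : R3 → ℂ} (hf : LocallyIntegrable f volume) (n : ℕ) :
    ContDiff ℝ 1 (mollify n f) :=
  (bump n).hasCompactSupport_normed.contDiff_convolution_left (n := 1) _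
    (bump n).contDiff_normed hf

/-- The derivative falls on the bump function, and t ↦ η_n(x − t) is an admissible test function;
the minus sign from its inner derivative cancels the one in the weak gradient. -/
theorem IsWeakGradient.fderiv_mollify {φ : R3 → ℂ} {g : R3 → C3} (h : IsWeakGradient φ g)
    (hφ : LocallyIntegrable φ volume) (n : ℕ) (x : R3) (μ : Fin 3) :
    fderiv ℝ (mollify n φ) x (EuclideanSpace.single μ 1) = mollify n (fun t => g t μ) x := by
  set η := (bump n).normed (volume : Measure R3) with hη
  have hc : ContDiff ℝ (⊤ : ℕ∞) η := (bump n).contDiff_normed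
  have hs : HasCompactSupport η := (bump n).hasCompactSupport_normed
  have h1 := (hs.hasFDerivAt_convolution_right
    (ContinuousLinearMap.lsmul ℝ ℝ : ℝ →L[ℝ] ℂ →L[ℝ] ℂ).flip hφ (hc.of_le (by norm_cast)) x).fderiv
  rw [convolution_flip] at h1
  rw [mollify, h1, convolution_precompR_apply _ hφ (hs.fderiv (𝕜 := ℝ))
    (hc.continuous_fderiv (by norm_num)), mollify_apply]
  have h2 := h (fun t => η (x - t)) (hc.comp (contDiff_const.sub contDiff_id))
    (hs.comp_homeomorph (Homeomorph.subLeft x)) μ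
  have h3 : ∀ t, fderiv ℝ (fun t => η (x - t)) t = -fderiv ℝ η (x - t) := fun t => by
    have := ((hc.differentiable (by norm_num)) (x - t)).hasFDerivAt.comp t
      ((hasFDerivAt_id t).const_sub x)
    refine this.fderiv.trans ?_
    ext v; simp
  simp only [h3, neg_apply, Complex.ofReal_neg, neg_mul, integral_neg, neg_neg] at h2
  simp only [Complex.real_smul]
  rw [h2]
  rfl

open Filter Topology in
-- The mollifications of an integrable function converge almost everywhere and keep their integral,
-- so they serve as varying dominating functions.
theorem tendsto_integral_of_le_mollify {f : R3 → ℂ} (hf : LocallyIntegrable f volume)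
    {F : ℕ → R3 → ℝ} {G a : R3 → ℝ} {C R : ℝ} (hC : 0 ≤ C) (ha : Integrable a)
    (hF : ∀ n, AEStronglyMeasurable (F n) volume) (ha0 : ∀ x, 0 ≤ a x)
    (hle : ∀ n x, ‖F n x‖ ≤ a x + C * ‖mollify n f x‖)
    (hsupp : ∀ n x, x ∉ Metric.closedBall (0 : R3) R → F n x = 0)
    (hlim : ∀ᵐ x, Tendsto (fun n => F n x) atTop (𝓝 (G x))) :
    Tendsto (fun n => ∫ x, F n x) atTop (𝓝 (∫ x, G x)) := by
  -- f is only locally integrable. The bump functions live in the unit ball, so cutting f off at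
  -- radius R + 1 leaves its mollifications on the ball of radius R unchanged.
  set S := Metric.closedBall (0 : R3) (R + 1) with hS
  set p : R3 → ℝ := fun x => ‖S.indicator f x‖ with hp
  have hpi : Integrable p := ((integrable_indicator_iff measurableSet_closedBall).2
    (hf.integrableOn_isCompact (isCompact_closedBall _ _))).norm
  have hmi : ∀ n, Integrable fun x => C * mollify n p x := fun n =>
    (integrable_mollify hpi n).const_mul C
  have hm0 : ∀ n x, 0 ≤ mollify n p x := fun n x => (norm_nonneg (mollify n (S.indicator f) x)).trans (norm_mollify_le n _ x)
  refine tendsto_integral_of_tendsto_dominating (B := fun n x => a x + C * mollify n p x)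
    (B' := fun x => a x + C * p x) hF (fun n => ha.add (hmi n)) (ha.add (hpi.const_mul C))
    (fun n => Eventually.of_forall fun x => ?_) hlim ?_ ?_
  · by_cases hx : x ∈ Metric.closedBall (0 : R3) R
    · have e : mollify n f x = mollify n (S.indicator f) x := by
        refine mollify_congr n fun t ht => (Set.indicator_of_mem ?_ f).symm
        rw [hS, mem_closedBall_zero_iff]
        have h1 := mem_closedBall_zero_iff.1 hx
        have h2 := Metric.mem_ball.1 ht
        rw [dist_eq_norm] at h2
        linarith [norm_le_norm_add_norm_sub' t x]
      refine (hle n x).trans ?_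
      rw [e]
      gcongr
      exact norm_mollify_le n _ x
    · rw [hsupp n x hx, norm_zero]
      exact add_nonneg (ha0 x) (mul_nonneg hC (hm0 n x))
  · filter_upwards [ae_tendsto_mollify hpi.locallyIntegrable] with x hx
    exact (hx.const_mul C).const_add (a x)
  · refine tendsto_const_nhds.congr fun n => ?_
    rw [integral_add ha (hmi n), integral_add ha (hpi.const_mul C), integral_const_mul,
      integral_const_mul, integral_mollify hpi]

open Filter Topology in
/-- The chain rule for the composition of a Sobolev function with a `C¹` function with bounded
derivative. -/
theorem IsWeakGradient.integral_comp {φ : R3 → ℂ} {g : R3 → C3} (h : IsWeakGradient φ g)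
    (hφ : LocallyIntegrable φ volume) (μ : Fin 3)
    (hg : LocallyIntegrable (fun x => g x μ) volume) {Φ : ℂ → ℝ} (hΦ : ContDiff ℝ 1 Φ)
    (hb : ∀ z, ‖fderiv ℝ Φ z‖ ≤ 1) {u : R3 → ℝ} (hu : ContDiff ℝ (⊤ : ℕ∞) u)
    (hs : HasCompactSupport u) :
    ∫ x, u x * fderiv ℝ Φ (φ x) (g x μ) =
      -∫ x, fderiv ℝ u x (EuclideanSpace.single μ 1) * Φ (φ x) := by
  set v : R3 := EuclideanSpace.single μ 1 with hv
  have hu1 : ContDiff ℝ 1 u := hu.of_le (by norm_cast)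
  have hΦd := hΦ.differentiable one_ne_zero
  have hφc : ∀ n, ContDiff ℝ 1 (mollify n φ) := contDiff_mollify hφ
  have hgc : ∀ n, Continuous (mollify n fun x => g x μ) := fun n => (contDiff_mollify hg n).continuous
  have hΦc : Continuous (fderiv ℝ Φ) := hΦ.continuous_fderiv one_ne_zero
  have hdu : Continuous fun x => fderiv ℝ u x v :=
    (hu1.continuous_fderiv one_ne_zero).clm_apply continuous_const
  have hds : HasCompactSupport fun x => fderiv ℝ u x v := hs.fderiv_apply (𝕜 := ℝ) v
  have hF1 : ∀ n, Continuous fun x =>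
      u x * fderiv ℝ Φ (mollify n φ x) (mollify n (fun t => g t μ) x) := fun n =>
    hu.continuous.mul ((hΦc.comp (hφc n).continuous).clm_apply (hgc n))
  have hF2 : ∀ n, Continuous fun x => fderiv ℝ u x v * Φ (mollify n φ x) := fun n =>
    hdu.mul (hΦ.continuous.comp (hφc n).continuous)
  -- For the mollified function the classical chain rule and integration by parts hold; the rest of
  -- the argument removes the mollification on both sides.
  have hparts : ∀ n, ∫ x, u x * fderiv ℝ Φ (mollify n φ x) (mollify n (fun t => g t μ) x) =
      -∫ x, fderiv ℝ u x v * Φ (mollify n φ x) := by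
    intro n
    have e : ∀ x, fderiv ℝ (Φ ∘ mollify n φ) x v =
        fderiv ℝ Φ (mollify n φ x) (mollify n (fun t => g t μ) x) := fun x => by
      rw [fderiv_comp x (hΦd _) ((hφc n).differentiable one_ne_zero x)]
      show fderiv ℝ Φ _ (fderiv ℝ (mollify n φ) x v) = _
      rw [h.fderiv_mollify hφ]
    have := integral_mul_fderiv_eq_neg_fderiv_mul_of_integrable (μ := volume) (f := u)
      (g := Φ ∘ mollify n φ) (v := v)
      ((hF2 n).integrable_of_hasCompactSupport hds.mul_right)
      (by simp only [e]; exact (hF1 n).integrable_of_hasCompactSupport hs.mul_right)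
      ((hu.continuous.mul (hΦ.continuous.comp (hφc n).continuous)).integrable_of_hasCompactSupport
        hs.mul_right)
      (fun x _ => hu1.differentiable one_ne_zero x)
      (fun x _ => (hΦ.comp (hφc n)).differentiable one_ne_zero x)
    simpa only [e, Function.comp_apply] using this
  obtain ⟨R, hR⟩ := hs.isCompact.isBounded.subset_closedBall (0 : R3)
  obtain ⟨R', hR'⟩ := hds.isCompact.isBounded.subset_closedBall (0 : R3)
  obtain ⟨C, hC⟩ := hu.continuous.bounded_above_of_compact_support hs
  obtain ⟨C', hC'⟩ := hdu.bounded_above_of_compact_support hds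
  have hC0 := (norm_nonneg _).trans (hC 0)
  have hC0' := (norm_nonneg _).trans (hC' 0)
  have h1 : Tendsto (fun n => ∫ x, u x * fderiv ℝ Φ (mollify n φ x)
      (mollify n (fun t => g t μ) x)) atTop (𝓝 (∫ x, u x * fderiv ℝ Φ (φ x) (g x μ))) := by
    refine tendsto_integral_of_le_mollify hg (a := 0) hC0 (integrable_zero _ _ _) (R := R)
      (fun n => (hF1 n).aestronglyMeasurable) (fun x => le_rfl) (fun n x => ?_) (fun n x hx => ?_) ?_
    · rw [norm_mul, Pi.zero_apply, zero_add]
      refine mul_le_mul (hC x) ?_ (norm_nonneg _) hC0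
      exact (ContinuousLinearMap.le_opNorm _ _).trans
        (mul_le_of_le_one_left (norm_nonneg _) (hb _))
    · rw [image_eq_zero_of_notMem_tsupport fun hx' => hx (hR hx'), zero_mul]
    · filter_upwards [ae_tendsto_mollify hφ, ae_tendsto_mollify hg] with x h1 h2
      have h3 : Tendsto (fun n => fderiv ℝ Φ (mollify n φ x)) atTop (𝓝 (fderiv ℝ Φ (φ x))) :=
        (hΦc.tendsto _).comp h1
      have h4 := ((isBoundedBilinearMap_apply (𝕜 := ℝ) (E := ℂ) (F := ℝ)).continuous.tendsto
        (fderiv ℝ Φ (φ x), g x μ)).comp (h3.prodMk_nhds h2)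
      exact h4.const_mul _
  have h2 : Tendsto (fun n => ∫ x, fderiv ℝ u x v * Φ (mollify n φ x)) atTop
      (𝓝 (∫ x, fderiv ℝ u x v * Φ (φ x))) := by
    have hai : Integrable fun x => ‖fderiv ℝ u x v‖ * |Φ 0| :=
      (hdu.integrable_of_hasCompactSupport hds).norm.mul_const _
    refine tendsto_integral_of_le_mollify hφ hC0' hai (R := R')
      (fun n => (hF2 n).aestronglyMeasurable) (fun x => by positivity)
      (fun n x => ?_) (fun n x hx => ?_) ?_
    · have h3 : |Φ (mollify n φ x)| ≤ |Φ 0| + ‖mollify n φ x‖ := by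
        have h4 := Convex.norm_image_sub_le_of_norm_fderiv_le (𝕜 := ℝ) (f := Φ) (s := Set.univ)
          (x := 0) (y := mollify n φ x) (C := 1) (fun z _ => hΦd z) (fun z _ => hb z)
          convex_univ trivial trivial
        rw [one_mul, sub_zero, Real.norm_eq_abs] at h4
        linarith [abs_sub_abs_le_abs_sub (Φ (mollify n φ x)) (Φ 0)]
      rw [norm_mul, Real.norm_eq_abs (Φ _)]
      calc _ ≤ ‖fderiv ℝ u x v‖ * (|Φ 0| + ‖mollify n φ x‖) := by gcongr
        _ ≤ _ := by
          rw [mul_add]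
          gcongr
          exact hC' x
    · rw [image_eq_zero_of_notMem_tsupport fun hx' => hx (hR' hx'), zero_mul]
    · filter_upwards [ae_tendsto_mollify hφ] with x h1
      exact ((hΦ.continuous.tendsto _).comp h1).const_mul _
  exact tendsto_nhds_unique (h1.congr hparts) h2.neg

/-! ### The weak gradient of |φ| -/

/-- The regularization `√(|z|² + ε²)` of the absolute value. -/
def smoothAbs (ε : ℝ) (z : ℂ) : ℝ := √(‖z‖ ^ 2 + ε ^ 2)

theorem hasFDerivAt_smoothAbs {ε : ℝ} (hε : 0 < ε) (z : ℂ) :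
    HasFDerivAt (smoothAbs ε) ((smoothAbs ε z)⁻¹ • innerSL ℝ z) z := by
  have h1 : HasFDerivAt (fun z : ℂ => ‖z‖ ^ 2 + ε ^ 2) (2 • innerSL ℝ z) z :=
    (hasStrictFDerivAt_norm_sq z).hasFDerivAt.add_const _
  have h2 := h1.sqrt (by positivity : ‖z‖ ^ 2 + ε ^ 2 ≠ 0)
  refine h2.congr_fderiv ?_
  ext w
  simp only [smul_apply, smul_eq_mul, nsmul_eq_mul, smoothAbs]
  have : 0 < √(‖z‖ ^ 2 + ε ^ 2) := by positivity
  field_simp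
  simp

theorem contDiff_smoothAbs {ε : ℝ} (hε : 0 < ε) : ContDiff ℝ 1 (smoothAbs ε) :=
  ((contDiff_norm_sq ℝ).add contDiff_const).sqrt fun z => by positivity

theorem norm_le_smoothAbs (ε : ℝ) (z : ℂ) : ‖z‖ ≤ smoothAbs ε z :=
  Real.le_sqrt_of_sq_le (by nlinarith [sq_nonneg ε])

theorem smoothAbs_le {ε : ℝ} (hε : 0 ≤ ε) (z : ℂ) : smoothAbs ε z ≤ ‖z‖ + ε :=
  Real.sqrt_le_iff.2 ⟨by positivity, by nlinarith [mul_nonneg (norm_nonneg z) hε]⟩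

theorem norm_fderiv_smoothAbs_le {ε : ℝ} (hε : 0 < ε) (z : ℂ) :
    ‖fderiv ℝ (smoothAbs ε) z‖ ≤ 1 := by
  have h0 : 0 < smoothAbs ε z := Real.sqrt_pos.2 (by positivity)
  rw [(hasFDerivAt_smoothAbs hε z).fderiv, norm_smul, innerSL_apply_norm, norm_inv,
    Real.norm_of_nonneg h0.le, inv_mul_le_iff₀ h0, mul_one]
  exact norm_le_smoothAbs ε z

theorem abs_re_conj_mul_div_le (z w : ℂ) : |(conj z * w).re / ‖z‖| ≤ ‖w‖ := by
  rw [abs_div, abs_norm]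
  refine div_le_of_le_mul₀ (norm_nonneg _) (norm_nonneg _) ((Complex.abs_re_le_norm _).trans ?_)
  rw [norm_mul, RCLike.norm_conj, mul_comm]

theorem im_conj_mul (z w : ℂ) : (conj z * w).im = (conj z * (-Complex.I * w)).re := by
  simp; ring

theorem memLp_re_conj_mul_div {φ g : R3 → ℂ} (hφ : AEStronglyMeasurable φ volume)
    (hg : MemLp g 2 volume) : MemLp (fun x => (conj (φ x) * g x).re / ‖φ x‖) 2 volume := by
  refine hg.mono ?_ (Filter.Eventually.of_forall fun x => abs_re_conj_mul_div_le _ _)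
  have h1 := (Complex.continuous_re.comp_aestronglyMeasurable
    ((Complex.continuous_conj.comp_aestronglyMeasurable hφ).mul hg.1)).aemeasurable
  exact (h1.div hφ.norm.aemeasurable).aestronglyMeasurable

theorem memLp_im_conj_mul_div {φ g : R3 → ℂ} (hφ : AEStronglyMeasurable φ volume)
    (hg : MemLp g 2 volume) : MemLp (fun x => (conj (φ x) * g x).im / ‖φ x‖) 2 volume := by
  simp only [im_conj_mul]
  exact memLp_re_conj_mul_div hφ (hg.const_mul (-Complex.I))

theorem _root_.MeasureTheory.MemLp.locallyIntegrable_two {E : Type*} [NormedAddCommGroup E]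
    {f : R3 → E} (hf : MemLp f 2 volume) : LocallyIntegrable f volume :=
  hf.locallyIntegrable (by norm_num)

open Filter Topology in
theorem tendsto_smoothAbs (z : ℂ) {ε : ℕ → ℝ} (hε : Tendsto ε atTop (𝓝 0)) :
    Tendsto (fun n => smoothAbs (ε n) z) atTop (𝓝 ‖z‖) := by
  have h : Continuous fun e : ℝ => smoothAbs e z := by unfold smoothAbs; fun_prop
  have := (h.tendsto 0).comp hε
  simpa [smoothAbs, Function.comp_def, Real.sqrt_sq (norm_nonneg z)] using this

open Filter Topology in
/-- The weak gradient of `|φ|` is `Re(conj φ ∇φ) / |φ|`. -/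
theorem IsWeakGradient.absFn {φ : R3 → ℂ} {g : R3 → C3} (h : IsWeakGradient φ g)
    (hφ : LocallyIntegrable φ volume) (hg : ∀ μ, LocallyIntegrable (fun x => g x μ) volume) :
    IsWeakGradient (absFn φ) fun x => WithLp.toLp 2 fun μ =>
      (((conj (φ x) * g x μ).re / ‖φ x‖ : ℝ) : ℂ) := by
  intro u hu hs μ
  set v : R3 := EuclideanSpace.single μ 1 with hv
  set ε : ℕ → ℝ := fun n => 1 / ((n : ℝ) + 1) with hε
  have hε0 : ∀ n, 0 < ε n := fun n => by positivity
  have hε1 : ∀ n, ε n ≤ 1 := fun n =>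
    (div_le_one (by positivity)).2 (by linarith [Nat.cast_nonneg (α := ℝ) n])
  have hεt : Tendsto ε atTop (𝓝 0) := tendsto_one_div_add_atTop_nhds_zero_nat
  have hu1 : ContDiff ℝ 1 u := hu.of_le (by norm_cast)
  have hdu : Continuous fun x => fderiv ℝ u x v :=
    (hu1.continuous_fderiv one_ne_zero).clm_apply continuous_const
  have hds : HasCompactSupport fun x => fderiv ℝ u x v := hs.fderiv_apply (𝕜 := ℝ) v
  have hΦc : ∀ n, Continuous (smoothAbs (ε n)) := fun n => (contDiff_smoothAbs (hε0 n)).continuous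
  have hΦf : ∀ n z w, fderiv ℝ (smoothAbs (ε n)) z w = (conj z * w).re / smoothAbs (ε n) z := by
    intro n z w
    rw [(hasFDerivAt_smoothAbs (hε0 n) z).fderiv, smul_apply, innerSL_apply_apply, Complex.inner,
      smul_eq_mul, inv_mul_eq_div, mul_comm w]
  have hparts := fun n => h.integral_comp hφ μ (hg μ) (contDiff_smoothAbs (hε0 n))
    (norm_fderiv_smoothAbs_le (hε0 n)) hu hs
  have h1 : Tendsto (fun n => ∫ x, u x * fderiv ℝ (smoothAbs (ε n)) (φ x) (g x μ)) atTop
      (𝓝 (∫ x, u x * ((conj (φ x) * g x μ).re / ‖φ x‖))) := by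
    have hb : Integrable fun x => ‖u x‖ * ‖g x μ‖ := by
      simpa only [norm_smul] using
        ((hg μ).integrable_smul_left_of_hasCompactSupport hu.continuous hs).norm
    refine tendsto_integral_of_dominated_convergence _ (fun n => ?_) hb (fun n => ?_) ?_
    · have h3 : Continuous (fderiv ℝ (smoothAbs (ε n))) :=
        (contDiff_smoothAbs (hε0 n)).continuous_fderiv one_ne_zero
      exact hu.continuous.aestronglyMeasurable.mul
        ((isBoundedBilinearMap_apply (𝕜 := ℝ) (E := ℂ) (F := ℝ)).continuous.comp_aestronglyMeasurable
          ((h3.comp_aestronglyMeasurable hφ.aestronglyMeasurable).prodMk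
            (hg μ).aestronglyMeasurable))
    · refine Eventually.of_forall fun x => ?_
      rw [norm_mul]
      gcongr
      exact (ContinuousLinearMap.le_opNorm _ _).trans
        (mul_le_of_le_one_left (norm_nonneg _) (norm_fderiv_smoothAbs_le (hε0 n) _))
    · refine Eventually.of_forall fun x => ?_
      simp only [hΦf]
      -- At zeros of φ the derivative of each regularization vanishes, and the claimed gradient is 0
      -- there because division by zero gives 0. It is therefore not necessary to know that ∇φ = 0
      -- almost everywhere on {φ = 0}.
      by_cases h0 : φ x = 0
      · simp [h0]
      · exact (tendsto_const_nhds.div (tendsto_smoothAbs (φ x) hεt) (norm_ne_zero_iff.2 h0)).const_mul _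
  have h2 : Tendsto (fun n => ∫ x, fderiv ℝ u x v * smoothAbs (ε n) (φ x)) atTop
      (𝓝 (∫ x, fderiv ℝ u x v * ‖φ x‖)) := by
    have hb : Integrable fun x => ‖fderiv ℝ u x v‖ * ‖φ x‖ + ‖fderiv ℝ u x v‖ := by
      refine Integrable.add ?_ (hdu.integrable_of_hasCompactSupport hds).norm
      simpa only [norm_smul] using
        (hφ.integrable_smul_left_of_hasCompactSupport hdu hds).norm
    refine tendsto_integral_of_dominated_convergence _ (fun n => ?_) hb (fun n => ?_) ?_
    · exact hdu.aestronglyMeasurable.mul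
        ((hΦc n).comp_aestronglyMeasurable hφ.aestronglyMeasurable)
    · refine Eventually.of_forall fun x => ?_
      rw [norm_mul, Real.norm_of_nonneg ((norm_nonneg _).trans (norm_le_smoothAbs (ε n) (φ x)))]
      have h5 := (smoothAbs_le (hε0 n).le (φ x)).trans (add_le_add_right (hε1 n) _)
      calc _ ≤ ‖fderiv ℝ u x v‖ * (‖φ x‖ + 1) := by gcongr
        _ = _ := by ring
    · exact Eventually.of_forall fun x => (tendsto_smoothAbs (φ x) hεt).const_mul _
  have h3 := tendsto_nhds_unique (h1.congr hparts) h2.neg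
  have h4 := congrArg (fun t : ℝ => (t : ℂ)) h3
  simp only [Complex.ofReal_neg, ← integral_complex_ofReal, Complex.ofReal_mul] at h4
  exact h4

/-- Each component is determined by its integrals against smooth compactly supported functions. -/
theorem IsWeakGradient.ae_eq {φ : R3 → ℂ} {g g' : R3 → C3} (h : IsWeakGradient φ g)
    (h' : IsWeakGradient φ g') (hg : MemLp g 2 volume) (hg' : MemLp g' 2 volume) :
    g =ᵐ[volume] g' := by
  have h1 : ∀ μ, ∀ᵐ x, g x μ = g' x μ := fun μ =>
    ae_eq_of_integral_contDiff_smul_eq (hg.eval_piLp μ).locallyIntegrable_two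
      (hg'.eval_piLp μ).locallyIntegrable_two fun u hu hs => by
        simp only [Complex.real_smul]
        rw [h u hu hs μ, h' u hu hs μ]
  filter_upwards [ae_all_iff.2 h1] with x hx
  ext μ
  exact hx μ

variable {φ : R3 → ℂ}

theorem MemH1.memLp_weakGrad (h : MemH1 φ) : MemLp (weakGrad φ) 2 volume := by
  rw [weakGrad, dif_pos h.2]
  exact h.2.choose_spec.1

theorem MemH1.isWeakGradient_weakGrad (h : MemH1 φ) : IsWeakGradient φ (weakGrad φ) := by
  rw [weakGrad, dif_pos h.2]
  exact h.2.choose_spec.2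

/-- The vector field `Re(conj φ ∇φ) / |φ|`, set to zero where `φ = 0`. -/
def absGrad (φ : R3 → ℂ) : R3 → C3 := fun x =>
  WithLp.toLp 2 fun μ => (((conj (φ x) * weakGrad φ x μ).re / ‖φ x‖ : ℝ) : ℂ)

theorem MemH1.memLp_absGrad (h : MemH1 φ) : MemLp (absGrad φ) 2 volume :=
  MemLp.of_eval_piLp fun μ =>
    (memLp_re_conj_mul_div h.1.1 (h.memLp_weakGrad.eval_piLp μ)).ofReal (K := ℂ)

theorem MemH1.memLp_phaseGrad (h : MemH1 φ) : MemLp (phaseGrad φ) 2 volume :=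
  MemLp.of_eval_piLp fun μ =>
    (memLp_im_conj_mul_div h.1.1 (h.memLp_weakGrad.eval_piLp μ)).ofReal (K := ℂ)

theorem MemH1.isWeakGradient_absGrad (h : MemH1 φ) : IsWeakGradient (absFn φ) (absGrad φ) :=
  h.isWeakGradient_weakGrad.absFn h.1.locallyIntegrable_two
    fun μ => (h.memLp_weakGrad.eval_piLp μ).locallyIntegrable_two

/-- If `φ ∈ H¹`, then `|φ| ∈ H¹`. -/
theorem MemH1.absFn (h : MemH1 φ) : MemH1 (absFn φ) :=
  ⟨h.1.norm.ofReal (K := ℂ), absGrad φ, h.memLp_absGrad, h.isWeakGradient_absGrad⟩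

theorem MemH1.weakGrad_absFn (h : MemH1 φ) : weakGrad (LiebLoss.absFn φ) =ᵐ[volume] absGrad φ :=
  h.absFn.isWeakGradient_weakGrad.ae_eq h.isWeakGradient_absGrad h.absFn.memLp_weakGrad
    h.memLp_absGrad

/-! ### Completing the square in the fields -/

section FormKernel

variable {ι : Type*} {H : Type*} [NormedAddCommGroup H] [InnerProductSpace ℂ H]
  {X : Type*} [MeasurableSpace X] {ν : Measure X} {J : H → H} {D : H →L[ℂ] H} {v : X → H}
  {T : WithLp 2 (H × H) →L[ℂ] WithLp 2 (H × H)}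

theorem field_neg_left (b : HilbertBasis ι ℂ H) (f : H) (ψ : numDom ι) :
    field b (-f) ψ = -field b f ψ := by
  have h := field_real_smul_left b (-1) f ψ
  rwa [Complex.ofReal_neg, Complex.ofReal_one, neg_one_smul, neg_one_smul] at h

theorem inner_field_eq_re (b : HilbertBasis ι ℂ H) (f : H) (ψ : numDom ι) :
    ⟪ψ.1, field b f ψ⟫_ℂ = ((⟪ψ.1, field b f ψ⟫_ℂ).re : ℂ) := by
  refine (Complex.conj_eq_iff_re.1 ?_).symm
  rw [inner_conj_symm, inner_field_left]

theorem norm_sub_real_smul_sq (b : HilbertBasis ι ℂ H) (f : H) (ψ : numDom ι) (t : ℝ) :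
    ‖field b f ψ - (t : ℂ) • ψ.1‖ ^ 2 = ‖field b f ψ‖ ^ 2 -
      2 * (t * (⟪ψ.1, field b f ψ⟫_ℂ).re) + t ^ 2 * ‖ψ.1‖ ^ 2 := by
  rw [@norm_sub_sq ℂ, inner_smul_right, inner_field_left, norm_smul, Complex.norm_real, mul_pow,
    Real.norm_eq_abs, sq_abs]
  show _ - 2 * ((t : ℂ) * _).re + _ = _
  rw [Complex.re_ofReal_mul]

theorem IsFormKernel.memLp_re_inner_field (h : IsFormKernel ν J D v T) (b : HilbertBasis ι ℂ H)
    (ψ : numDom ι) : MemLp (fun x => (⟪ψ.1, field b (v x) ψ⟫_ℂ).re) 2 ν := by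
  have hm : AEStronglyMeasurable (fun x => field b (v x) ψ) ν :=
    (continuous_field b ψ).comp_aestronglyMeasurable h.aestronglyMeasurable
  have hm' : AEStronglyMeasurable (fun x => (⟪ψ.1, field b (v x) ψ⟫_ℂ).re) ν :=
    Complex.continuous_re.comp_aestronglyMeasurable (aestronglyMeasurable_const.inner hm)
  refine (memLp_two_iff_integrable_sq hm').2
    (((h.integrable_norm_field_sq b ψ).const_mul (‖ψ.1‖ ^ 2)).mono' (hm'.pow 2)
      (Filter.Eventually.of_forall fun x => ?_))
  rw [Real.norm_of_nonneg (sq_nonneg _), ← mul_pow, ← sq_abs]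
  exact pow_le_pow_left₀ (abs_nonneg _) ((Complex.abs_re_le_norm _).trans
    (norm_inner_le_norm (𝕜 := ℂ) ψ.1 (field b (v x) ψ))) 2

theorem IsFormKernel.integrable_inner_mul (h : IsFormKernel ν J D v T) (f : H) {w : X → ℝ}
    (hw : MemLp w 2 ν) : Integrable (fun x => ⟪f, v x⟫_ℂ * w x) ν := by
  have hm : AEStronglyMeasurable (fun x => ⟪f, v x⟫_ℂ) ν :=
    aestronglyMeasurable_const.inner h.aestronglyMeasurable
  have h1 : MemLp (fun x => ⟪f, v x⟫_ℂ) 2 ν := by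
    refine (memLp_two_iff_integrable_sq_norm hm).2 ((h.integrable_sq.const_mul (‖f‖ ^ 2)).mono'
      (hm.norm.pow 2) (Filter.Eventually.of_forall fun x => ?_))
    rw [Real.norm_of_nonneg (sq_nonneg _), ← mul_pow]
    exact pow_le_pow_left₀ (norm_nonneg _) (norm_inner_le_norm (𝕜 := ℂ) f (v x)) 2
  exact h1.integrable_mul hw.ofReal

/-- y is a superposition of the real vectors v_x with real weights w. -/
theorem IsFormKernel.involution_eq_self (h : IsFormKernel ν J D v T) {w : X → ℝ} {y : H}
    (hy : ∀ f, ⟪f, y⟫_ℂ = ∫ x, ⟪f, v x⟫_ℂ * w x ∂ν) : J y = y := by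
  refine ext_inner_left ℂ fun f => ?_
  rw [h.involution.inner_right, hy, hy, ← integral_conj]
  refine integral_congr_ae (Filter.Eventually.of_forall fun x => ?_)
  show conj (⟪J f, v x⟫_ℂ * w x) = _
  rw [map_mul, Complex.conj_ofReal, inner_conj_symm, ← h.real x, h.involution.inner_map_map]

theorem IsFormKernel.re_inner_field_eq_integral [CompleteSpace H] (h : IsFormKernel ν J D v T)
    (b : HilbertBasis ι ℂ H) {w : X → ℝ} {y : H}
    (hy : ∀ f, ⟪f, y⟫_ℂ = ∫ x, ⟪f, v x⟫_ℂ * w x ∂ν)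
    (hw : MemLp w 2 ν) (ψ : numDom ι) :
    (⟪ψ.1, field b y ψ⟫_ℂ).re = ∫ x, w x * (⟪ψ.1, field b (v x) ψ⟫_ℂ).re ∂ν := by
  obtain ⟨g, hg⟩ := exists_riesz_annihilate b ψ ψ.1
  simp only [re_inner_field b ψ hg]
  have h1 : ∫ x, (⟪g, v x⟫_ℂ * w x).re ∂ν = (∫ x, ⟪g, v x⟫_ℂ * w x ∂ν).re :=
    integral_re (h.integrable_inner_mul g hw)
  rw [hy, ← h1, ← integral_const_mul]
  refine integral_congr_ae (Filter.Eventually.of_forall fun x => ?_)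
  simp only [Complex.re_mul_ofReal]
  ring

/-- Completing the square in `dΓ_J[T, -y]`. -/
theorem IsFormKernel.dGammaForm_neg [Countable ι] [CompleteSpace H] (h : IsFormKernel ν J D v T)
    (b : HilbertBasis ι ℂ H) {w : X → ℝ} (hw : MemLp w 2 ν) {y : H}
    (hy : ∀ f, ⟪f, y⟫_ℂ = ∫ x, ⟪f, v x⟫_ℂ * w x ∂ν)
    (ψ : numDom ι) :
    dGammaForm b J T (-y) ψ + (∫ x, w x ^ 2 ∂ν) * ‖ψ.1‖ ^ 2 = (secForm b D ψ ψ).re +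
      ∫ x, ‖field b (v x) ψ - (w x : ℂ) • ψ.1‖ ^ 2 ∂ν := by
  have i1 := h.integrable_norm_field_sq b ψ
  have i2 : Integrable (fun x => 2 * (w x * (⟪ψ.1, field b (v x) ψ⟫_ℂ).re)) ν :=
    (hw.integrable_mul (h.memLp_re_inner_field b ψ)).const_mul 2
  have i3 : Integrable (fun x => w x ^ 2 * ‖ψ.1‖ ^ 2) ν := hw.integrable_sq.mul_const _
  rw [h.dGammaForm_eq, fieldForm_self_re, field_neg_left, inner_neg_right, Complex.neg_re,
    h.re_inner_field_eq_integral b hy hw]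
  simp only [norm_sub_real_smul_sq]
  rw [integral_add (f := fun x => ‖field b (v x) ψ‖ ^ 2 -
      2 * (w x * (⟪ψ.1, field b (v x) ψ⟫_ℂ).re)) (i1.sub i2) i3,
    integral_sub i1 i2, integral_const_mul, integral_mul_const]
  ring

/-- The vector iρψ is orthogonal, in the real part of the inner product, to (aA − t)ψ: the
expectation of the symmetric operator aA − t is real. -/
theorem norm_smul_add_real_smul_sq (b : HilbertBasis ι ℂ H) (f : H) (ψ : numDom ι) (ρ a t : ℝ) :
    ‖((Complex.I * (ρ + t * Complex.I)) • ψ.1 + (a : ℂ) • field b f ψ)‖ ^ 2 =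
      ρ ^ 2 * ‖ψ.1‖ ^ 2 + ‖(a : ℂ) • field b f ψ - (t : ℂ) • ψ.1‖ ^ 2 := by
  have e : (Complex.I * (ρ + t * Complex.I)) • ψ.1 + (a : ℂ) • field b f ψ =
      (ρ * Complex.I) • ψ.1 + ((a : ℂ) • field b f ψ - (t : ℂ) • ψ.1) := by
    have : Complex.I * (ρ + t * Complex.I) = ρ * Complex.I - t := by
      linear_combination (t : ℂ) * Complex.I_mul_I
    rw [this, sub_smul]
    abel
  have h0 : (⟪(ρ * Complex.I) • ψ.1, (a : ℂ) • field b f ψ - (t : ℂ) • ψ.1⟫_ℂ).re = 0 := by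
    rw [inner_smul_left, inner_sub_right, inner_smul_right, inner_smul_right,
      inner_field_eq_re, inner_self_ofReal, ← Complex.ofReal_mul, ← Complex.ofReal_mul,
      ← Complex.ofReal_sub, Complex.re_mul_ofReal]
    simp
  rw [e, @norm_add_sq ℂ]
  show _ + 2 * Complex.re _ + _ = _
  rw [h0, norm_smul, norm_mul, Complex.norm_I, Complex.norm_real, mul_one, mul_pow,
    Real.norm_eq_abs, sq_abs, mul_zero, add_zero]

/-- For z ≠ 0 multiplication by the phase conj z/|z| preserves the norm and decomposes g into real
and imaginary parts relative to z, so equality holds. For z = 0 the left side is zero. -/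
theorem le_norm_smul_add_smul_sq (b : HilbertBasis ι ℂ H) (f : H) (ψ : numDom ι) (z g : ℂ)
    (a : ℝ) :
    ((conj z * g).re / ‖z‖) ^ 2 * ‖ψ.1‖ ^ 2 + ‖((a * ‖z‖ : ℝ) : ℂ) • field b f ψ -
      (((conj z * g).im / ‖z‖ : ℝ) : ℂ) • ψ.1‖ ^ 2 ≤
    ‖(Complex.I * g) • ψ.1 + ((a : ℂ) * z) • field b f ψ‖ ^ 2 := by
  by_cases hz : z = 0
  · simp only [hz, map_zero, zero_mul, Complex.zero_re, Complex.zero_im, norm_zero, div_zero,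
      mul_zero, Complex.ofReal_zero, zero_smul, sub_zero, ne_eq, OfNat.ofNat_ne_zero,
      not_false_eq_true, zero_pow, add_zero]
    positivity
  · have hz' : (‖z‖ : ℂ) ≠ 0 := by exact_mod_cast norm_ne_zero_iff.2 hz
    rw [← norm_smul_add_real_smul_sq]
    have h1 : ((Complex.I * (((conj z * g).re / ‖z‖ : ℝ) + ((conj z * g).im / ‖z‖ : ℝ) *
        Complex.I)) • ψ.1 + ((a * ‖z‖ : ℝ) : ℂ) • field b f ψ) =
        (conj z / ‖z‖) • ((Complex.I * g) • ψ.1 + ((a : ℂ) * z) • field b f ψ) := by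
      rw [smul_add, smul_smul, smul_smul]
      congr 2
      · push_cast
        rw [div_mul_eq_mul_div, ← add_div, Complex.re_add_im]
        ring
      · push_cast
        rw [div_mul_eq_mul_div, eq_div_iff hz']
        linear_combination -(a : ℂ) * Complex.conj_mul' z
    have h2 : ‖conj z / (‖z‖ : ℂ)‖ = 1 := by
      rw [norm_div, RCLike.norm_conj, Complex.norm_real, norm_norm,
        div_self (norm_ne_zero_iff.2 hz)]
    rw [h1, norm_smul, h2, one_mul]

end FormKernel

/-! ### The Lieb–Loss energy as a second quantization -/

theorem secForm_smul_op {ι H : Type*} [NormedAddCommGroup H] [InnerProductSpace ℂ H]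
    (b : HilbertBasis ι ℂ H) (z : ℂ) (D : H →L[ℂ] H) (χ ψ : numDom ι) :
    secForm b (z • D) χ ψ = z * secForm b D χ ψ := by
  unfold secForm
  rw [← tsum_mul_left]
  exact tsum_congr fun n => by rw [smul_apply, inner_smul_right]

theorem toL2_eq {F : Type*} [NormedAddCommGroup F] {f : R3 → F} (hf : MemLp f 2 volume) :
    toL2 f = hf.toLp f := dif_pos hf

/-- The components of `phaseGrad φ` as a function on `ℝ³ × {0, 1, 2}`. -/
def phaseComp (φ : R3 → ℂ) (z : R3 × Fin 3) : ℝ :=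
  (conj (φ z.1) * weakGrad φ z.1 z.2).im / ‖φ z.1‖

/-- The components of `absGrad φ` as a function on `ℝ³ × {0, 1, 2}`. -/
def absComp (φ : R3 → ℂ) (z : R3 × Fin 3) : ℝ :=
  (conj (φ z.1) * weakGrad φ z.1 z.2).re / ‖φ z.1‖

theorem MemH1.memLp_phaseComp (h : MemH1 φ) (μ : Fin 3) :
    MemLp (fun x => phaseComp φ (x, μ)) 2 volume :=
  memLp_im_conj_mul_div h.1.1 (h.memLp_weakGrad.eval_piLp μ)

theorem MemH1.memLp_absComp (h : MemH1 φ) (μ : Fin 3) :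
    MemLp (fun x => absComp φ (x, μ)) 2 volume :=
  memLp_re_conj_mul_div h.1.1 (h.memLp_weakGrad.eval_piLp μ)

theorem norm_toLp_ofReal_sq (t : Fin 3 → ℝ) :
    ‖(WithLp.toLp 2 fun μ => (t μ : ℂ) : C3)‖ ^ 2 = ∑ μ, t μ ^ 2 := by
  rw [EuclideanSpace.norm_sq_eq]
  simp

theorem MemH1.integral_norm_phaseGrad_sq (h : MemH1 φ) :
    ∫ x, ‖phaseGrad φ x‖ ^ 2 = ∫ z, phaseComp φ z ^ 2 ∂compMeasure := by
  rw [integral_compMeasure fun μ => (h.memLp_phaseComp μ).integrable_sq]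
  exact integral_congr_ae (Filter.Eventually.of_forall fun x => norm_toLp_ofReal_sq _)

theorem MemH1.gradNormSq_absFn (h : MemH1 φ) :
    gradNormSq (LiebLoss.absFn φ) = ∫ x, ∑ μ, absComp φ (x, μ) ^ 2 := by
  refine integral_congr_ae ?_
  filter_upwards [h.weakGrad_absFn] with x hx
  rw [hx]
  exact norm_toLp_ofReal_sq _

namespace Cutoff

variable (c : Cutoff) {ι : Type*} (b : HilbertBasis ι ℂ c.photonSpace) (α : ℝ)

theorem isFormKernel_absFn (h : MemH1 φ) :
    IsFormKernel compMeasure c.J ((2 : ℂ) • c.absPow 1) (c.kernelVec α fun x => ‖φ x‖)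
      (c.T α (toL2 (absFn φ))) := by
  rw [toL2_eq h.absFn.1]
  exact c.isFormKernel α h.1.norm

theorem inner_yVec_phaseGrad (h : MemH1 φ) (f : c.photonSpace) :
    ⟪f, c.yVec α (toL2 (absFn φ)) (toL2 (phaseGrad φ))⟫_ℂ =
      ∫ z, ⟪f, c.kernelVec α (fun x => ‖φ x‖) z⟫_ℂ * (phaseComp φ z : ℂ) ∂compMeasure := by
  rw [toL2_eq h.absFn.1, toL2_eq h.memLp_phaseGrad]
  exact c.inner_yVec_eq α h.1.norm h.memLp_phaseGrad (fun x μ => rfl) h.memLp_phaseComp f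

theorem field_kernelVec (r : R3 → ℝ) (x : R3) (μ : Fin 3) (ψ : numDom ι) :
    field b (c.kernelVec α r (x, μ)) ψ = ((√α * r x : ℝ) : ℂ) • c.vecPot b x μ ψ :=
  field_real_smul_left b (√α * r x) (c.mode x μ) ψ

theorem secondQuantForm_absPow_one (ψ : numDom ι) :
    secondQuantForm b (c.absPow 1) ψ =
      (1 / 2) * (secForm b ((2 : ℂ) • c.absPow 1) ψ ψ).re := by
  rw [secondQuantForm_eq b (D := c.absPow 1) (fun f g => c.inner_absPow_left 1 f g)]
  rw [secForm_smul_op, show (2 : ℂ) = ((2 : ℝ) : ℂ) by norm_num, Complex.re_ofReal_mul]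
  ring

theorem integrable_norm_add_vecPot_sq (ψ : numDom ι) (μ : Fin 3) {g φ : R3 → ℂ}
    (hg : MemLp g 2 volume) (hφ : MemLp φ 2 volume) :
    Integrable fun x => ‖(Complex.I * g x) • ψ.1 +
      ((√α : ℂ) * φ x) • c.vecPot b x μ ψ‖ ^ 2 := by
  have hc : Continuous fun x => c.vecPot b x μ ψ :=
    (continuous_field b ψ).comp (c.continuous_mode μ)
  have h1 : MemLp (fun x => (Complex.I * g x) • ψ.1) 2 volume :=
    (memLp_top_const ψ.1).smul (hg.const_mul Complex.I)
  obtain ⟨K, hK⟩ := c.exists_norm_mode_le μ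
  have h2 : MemLp (fun x => c.vecPot b x μ ψ) ⊤ volume := by
    refine memLp_top_of_bound hc.aestronglyMeasurable (2 * √(graphSq ψ) * K)
      (Filter.Eventually.of_forall fun x => ?_)
    exact (norm_field_le b (c.mode x μ) ψ).trans
      (mul_le_mul_of_nonneg_left (hK x) (by positivity))
  have h3 : MemLp (fun x => ((√α : ℂ) * φ x) • c.vecPot b x μ ψ) 2 volume :=
    h2.smul (hφ.const_mul (√α : ℂ))
  exact (h1.add h3).integrable_norm_pow (by norm_num)

/-- The pointwise inequality is integrated over x and summed over μ. The phase gradient enters as √α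
r A − w, so completing the square produces the linear term −y and the constant ‖w‖². -/
theorem le_energy [Countable ι] (h : MemH1 φ) (hnorm : ∫ x, ‖φ x‖ ^ 2 = 1) (ψ : numDom ι) :
    (1 / 2) * gradNormSq (absFn φ) * ‖ψ.1‖ ^ 2 + (1 / 2) *
      (dGammaForm b c.J (c.T α (toL2 (absFn φ)))
        (-c.yVec α (toL2 (absFn φ)) (toL2 (phaseGrad φ))) ψ +
        (∫ x, ‖phaseGrad φ x‖ ^ 2) * ‖ψ.1‖ ^ 2) ≤ c.energy b α φ ψ := by
  have hk := c.isFormKernel_absFn α h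
  have hw := memLp_two_compMeasure h.memLp_phaseComp
  have i1 : ∀ μ, Integrable fun x => absComp φ (x, μ) ^ 2 * ‖ψ.1‖ ^ 2 := fun μ =>
    (h.memLp_absComp μ).integrable_sq.mul_const _
  have i2 : ∀ μ, Integrable fun x => ‖field b (c.kernelVec α (fun x => ‖φ x‖) (x, μ)) ψ -
      (phaseComp φ (x, μ) : ℂ) • ψ.1‖ ^ 2 := fun μ => by
    have := c.integrable_norm_add_vecPot_sq b α ψ μ
      (((h.memLp_phaseComp μ).ofReal (K := ℂ)).const_mul Complex.I) (h.1.norm.ofReal (K := ℂ))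
    refine this.congr (Filter.Eventually.of_forall fun x => ?_)
    have e : Complex.I * (Complex.I * (phaseComp φ (x, μ) : ℂ)) = -(phaseComp φ (x, μ) : ℂ) := by
      rw [← mul_assoc, Complex.I_mul_I, neg_one_mul]
    show ‖(Complex.I * (Complex.I * (phaseComp φ (x, μ) : ℂ))) • ψ.1 + _‖ ^ 2 = _
    beta_reduce
    rw [e, field_kernelVec, neg_smul, neg_add_eq_sub, Complex.ofReal_mul]
    rfl
  rw [h.integral_norm_phaseGrad_sq,
    hk.dGammaForm_neg b hw (c.inner_yVec_phaseGrad α h) ψ, integral_compMeasure i2,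
    h.gradNormSq_absFn, energy, hnorm, one_mul, secondQuantForm_absPow_one]
  have h1 : (∫ x, ∑ μ, absComp φ (x, μ) ^ 2) * ‖ψ.1‖ ^ 2 +
      ∫ x, ∑ μ, ‖field b (c.kernelVec α (fun x => ‖φ x‖) (x, μ)) ψ -
        (phaseComp φ (x, μ) : ℂ) • ψ.1‖ ^ 2 ≤
      ∫ x, ∑ μ, ‖(Complex.I * weakGrad φ x μ) • ψ.1 +
        ((√α : ℂ) * φ x) • c.vecPot b x μ ψ‖ ^ 2 := by
    rw [← integral_mul_const]
    simp only [Finset.sum_mul]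
    rw [← integral_add (integrable_finsetSum _ fun μ _ => i1 μ)
      (integrable_finsetSum _ fun μ _ => i2 μ)]
    refine integral_mono ((integrable_finsetSum _ fun μ _ => i1 μ).add
      (integrable_finsetSum _ fun μ _ => i2 μ)) (integrable_finsetSum _ fun μ _ =>
        c.integrable_norm_add_vecPot_sq b α ψ μ (h.memLp_weakGrad.eval_piLp μ) h.1) fun x => ?_
    simp only [← Finset.sum_add_distrib]
    refine Finset.sum_le_sum fun μ _ => ?_
    rw [field_kernelVec]
    exact le_norm_smul_add_smul_sq b (c.mode x μ) ψ (φ x) (weakGrad φ x μ) √α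
  linarith

/-- For the real function |φ| there is no phase gradient, and the pointwise orthogonality gives
equality, including at the zeros of φ. -/
theorem energy_absFn [Countable ι] (h : MemH1 φ) (hnorm : ∫ x, ‖φ x‖ ^ 2 = 1) (ψ : numDom ι) :
    c.energy b α (absFn φ) ψ = (1 / 2) * gradNormSq (absFn φ) * ‖ψ.1‖ ^ 2 +
      (1 / 2) * dGammaForm b c.J (c.T α (toL2 (absFn φ))) 0 ψ := by
  have hk := c.isFormKernel_absFn α h
  have i1 : ∀ μ, Integrable fun x => absComp φ (x, μ) ^ 2 * ‖ψ.1‖ ^ 2 := fun μ =>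
    (h.memLp_absComp μ).integrable_sq.mul_const _
  have i2 : ∀ μ, Integrable fun x =>
      ‖field b (c.kernelVec α (fun x => ‖φ x‖) (x, μ)) ψ‖ ^ 2 := fun μ => by
    refine (c.integrable_norm_add_vecPot_sq b α ψ μ (g := 0) MemLp.zero
      (h.1.norm.ofReal (K := ℂ))).congr (Filter.Eventually.of_forall fun x => ?_)
    show ‖(Complex.I * 0) • ψ.1 + _‖ ^ 2 = _
    beta_reduce
    rw [field_kernelVec, mul_zero, zero_smul, zero_add, Complex.ofReal_mul]
    rfl
  have hn : ∫ x, ‖absFn φ x‖ ^ 2 = 1 := by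
    rw [← hnorm]
    refine integral_congr_ae (Filter.Eventually.of_forall fun x => ?_)
    simp [absFn]
  have h1 : ∫ x, ∑ μ, ‖(Complex.I * weakGrad (absFn φ) x μ) • ψ.1 +
        ((√α : ℂ) * absFn φ x) • c.vecPot b x μ ψ‖ ^ 2 =
      (∫ x, ∑ μ, absComp φ (x, μ) ^ 2) * ‖ψ.1‖ ^ 2 +
      ∫ x, ∑ μ, ‖field b (c.kernelVec α (fun x => ‖φ x‖) (x, μ)) ψ‖ ^ 2 := by
    rw [← integral_mul_const]
    simp only [Finset.sum_mul]
    rw [← integral_add (integrable_finsetSum _ fun μ _ => i1 μ)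
      (integrable_finsetSum _ fun μ _ => i2 μ)]
    refine integral_congr_ae ?_
    filter_upwards [h.weakGrad_absFn] with x hx
    simp only [← Finset.sum_add_distrib]
    refine Finset.sum_congr rfl fun μ _ => ?_
    have := norm_smul_add_real_smul_sq b (c.mode x μ) ψ (absComp φ (x, μ)) (√α * ‖φ x‖) 0
    rw [Complex.ofReal_zero, zero_mul, add_zero, zero_smul, sub_zero] at this
    rw [field_kernelVec, hx]
    refine Eq.trans ?_ this
    rw [Complex.ofReal_mul]
    rfl
  rw [energy, hn, h1, one_mul, secondQuantForm_absPow_one, hk.dGammaForm_zero, IsFormKernel.fieldForm_self_re,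
    integral_compMeasure i2, h.gradNormSq_absFn]
  ring

end Cutoff

/-! ### The bottom of the spectrum -/

/-- The values of the quadratic form of `dΓ_J[T, 0]` at normalized vectors of `D(N^{1/2})`. -/
def formRange {ι H : Type*} [NormedAddCommGroup H] [InnerProductSpace ℂ H] (b : HilbertBasis ι ℂ H)
    (J : H → H) (T : WithLp 2 (H × H) →L[ℂ] WithLp 2 (H × H)) : Set ℝ :=
  {t | ∃ ψ : numDom ι, ‖ψ.1‖ = 1 ∧ t = dGammaForm b J T 0 ψ}

namespace IsFormKernel

variable {ι : Type*} {H : Type*} [NormedAddCommGroup H] [InnerProductSpace ℂ H]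
  {X : Type*} [MeasurableSpace X] {ν : Measure X} {J : H → H} {D : H →L[ℂ] H} {v : X → H}
  {T : WithLp 2 (H × H) →L[ℂ] WithLp 2 (H × H)}

theorem inner_neg (_ : IsFormKernel ν J D v T) {w : X → ℝ} {y : H}
    (hy : ∀ f, ⟪f, y⟫_ℂ = ∫ x, ⟪f, v x⟫_ℂ * w x ∂ν) (f : H) :
    ⟪f, -y⟫_ℂ = ∫ x, ⟪f, v x⟫_ℂ * ((-w) x : ℝ) ∂ν := by
  simp only [Pi.neg_apply, Complex.ofReal_neg, mul_neg]
  rw [inner_neg_right, hy, integral_neg]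

theorem dGammaForm_zero_nonneg [Countable ι] [CompleteSpace H] (h : IsFormKernel ν J D v T) (b : HilbertBasis ι ℂ H)
    (hD : ∀ f, 0 ≤ (⟪f, D f⟫_ℂ).re) (ψ : numDom ι) : 0 ≤ dGammaForm b J T 0 ψ := by
  rw [h.dGammaForm_zero, fieldForm_self_re]
  have := le_secForm b (m := 0) (fun f => by rw [zero_mul]; exact hD f) ψ
  rw [zero_mul] at this
  exact add_nonneg this (integral_nonneg fun x => sq_nonneg _)

theorem isGLB_formRange [Countable ι] [CompleteSpace H] (h : IsFormKernel ν J D v T) (b : HilbertBasis ι ℂ H)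
    (hD : ∀ f, 0 ≤ (⟪f, D f⟫_ℂ).re) :
    (formRange b J T).Nonempty ∧ IsGLB (formRange b J T) (sInf (formRange b J T)) := by
  classical
  have hne : (formRange b J T).Nonempty := ⟨_, numState 0, by
    show ‖(lp.single 2 (0 : ι →₀ ℕ) (1 : ℂ) : Fock ι)‖ = 1
    rw [lp.norm_single (by norm_num)]; simp, rfl⟩
  refine ⟨hne, isGLB_csInf hne ⟨0, ?_⟩⟩
  rintro _ ⟨ψ, -, rfl⟩
  exact h.dGammaForm_zero_nonneg b hD ψ

/-- The abstract spectral result applies because normalized vectors G x, with G = (N+1)^{-1/2}, are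
exactly the normalized vectors of D(N^{1/2}). The bound on the form for other vectors follows by
scaling. -/
theorem isSelfAdjoint_and_isLeast_spectrum [Countable ι] [CompleteSpace H]
    (h : IsFormKernel ν J D v T) (b : HilbertBasis ι ℂ H) {m : ℝ} (hm : 0 < m)
    (hD : ∀ f, m * ‖f‖ ^ 2 ≤ (⟪f, D f⟫_ℂ).re) :
    IsSelfAdjoint (dGamma b J T) ∧
      IsLeast {t : ℝ | (t : ℂ) ∈ opSpectrum (dGamma b J T)} (sInf (formRange b J T)) := by
  obtain ⟨B, hop, hB⟩ := h.exists_isFormOperator b hm hD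
  have hD0 : ∀ f, 0 ≤ (⟪f, D f⟫_ℂ).re := fun f =>
    (mul_nonneg hm.le (sq_nonneg ‖f‖)).trans (hD f)
  obtain ⟨hne, hglb⟩ := h.isGLB_formRange b hD0
  have hBf : ∀ x, (⟪x, B x⟫_ℂ).re = dGammaForm b J T 0 (toNumDom x) := fun x => by
    rw [hB, h.dGammaForm_zero]
  refine ⟨hop.isSelfAdjoint, hop.isLeast_spectrum (fun x => ?_) fun ε hε => ?_⟩
  · by_cases hx : ‖numWeight ι x‖ = 0
    · rw [hx, hBf]
      simpa using h.dGammaForm_zero_nonneg b hD0 (toNumDom x)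
    · set s := ‖numWeight ι x‖ with hs
      have hs0 : 0 < s := lt_of_le_of_ne (norm_nonneg _) (Ne.symm hx)
      have h1 : sInf (formRange b J T) ≤ (⟪((s⁻¹ : ℝ) : ℂ) • x, B (((s⁻¹ : ℝ) : ℂ) • x)⟫_ℂ).re := by
        rw [hBf]
        refine hglb.1 ⟨_, ?_, rfl⟩
        rw [coe_toNumDom, map_smul, norm_smul, Complex.norm_real, norm_inv, ← hs,
          Real.norm_of_nonneg hs0.le, inv_mul_cancel₀ hx]
      rw [map_smul, inner_smul_left, inner_smul_right, Complex.conj_ofReal, Complex.re_ofReal_mul,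
        Complex.re_ofReal_mul, ← mul_assoc, ← mul_inv, inv_mul_eq_div,
        le_div_iff₀ (by positivity)] at h1
      rwa [sq]
  · obtain ⟨_, ⟨ψ, hψ, rfl⟩, hlt⟩ := (isGLB_lt_iff hglb).1 (lt_add_of_pos_right _ hε)
    obtain ⟨x, rfl⟩ := toNumDom_surjective ψ
    exact ⟨x, hψ, by rwa [hBf]⟩

end IsFormKernel

end LiebLoss

end

/-! ### Assembly of the theorem -/

theorem mainTheorem2 (c : Cutoff) (α : ℝ) (hα : 0 < α) {ι : Type}
    (b : HilbertBasis ι ℂ c.photonSpace) (φ : R3 → ℂ) (hφ : MemH1 φ)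
    (hnorm : ∫ x, ‖φ x‖ ^ 2 = 1) :
    -- `|φ| ∈ H¹`, so that the energies of `|φ|` are defined
    MemH1 (absFn φ) ∧
    -- the minimized energy does not increase when `φ` is replaced by `|φ|`
    c.minEnergy b α (absFn φ) ≤ c.minEnergy b α φ ∧
    -- the minimized energy of `|φ|` in terms of the self-adjoint operator `dΓ_J[T_{|φ|,α}, 0]`
    (IsSelfAdjoint (dGamma b c.J (c.T α (toL2 (absFn φ)))) ∧
      {t : ℝ | (t : ℂ) ∈ opSpectrum (dGamma b c.J (c.T α (toL2 (absFn φ))))}.Nonempty ∧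
      BddBelow {t : ℝ | (t : ℂ) ∈ opSpectrum (dGamma b c.J (c.T α (toL2 (absFn φ))))} ∧
      c.minEnergy b α (absFn φ) = (1 / 2) * gradNormSq (absFn φ) + (1 / 2) *
        sInf {t : ℝ | (t : ℂ) ∈ opSpectrum (dGamma b c.J (c.T α (toL2 (absFn φ))))}) ∧
    -- a Weyl transformation that depends only on `φ` decreases the energy of every photon state
    (∃ (η : c.photonSpace) (W : Fock ι ≃ₗᵢ[ℂ] Fock ι) (hW : IsWeyl b η W),
      ∀ ψ : numDom ι, ‖ψ.1‖ = 1 →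
        c.energy b α (absFn φ) ⟨W ψ.1, hW.map_mem ψ.1 ψ.2⟩ ≤ c.energy b α φ ψ) ∧
    -- the explicit Weyl transformation that removes the linear term, and its cost
    (∃! η : c.photonSpace, c.J η = η ∧
      c.yVec α (toL2 (absFn φ)) (toL2 (phaseGrad φ)) =
        (1 / 2 : ℂ) • qStar c.J (c.T α (toL2 (absFn φ)) (qMap c.J η))) ∧
    (∀ η : c.photonSpace, c.J η = η →
      c.yVec α (toL2 (absFn φ)) (toL2 (phaseGrad φ)) =
        (1 / 2 : ℂ) • qStar c.J (c.T α (toL2 (absFn φ)) (qMap c.J η)) →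
      ∃ (W : Fock ι ≃ₗᵢ[ℂ] Fock ι) (hW : IsWeyl b η W), ∀ ψ : numDom ι,
        dGammaForm b c.J (c.T α (toL2 (absFn φ))) 0
            ⟨W.symm ψ.1, hW.symm_mem ψ.1 ψ.2⟩ -
          (∫ x, ‖phaseGrad φ x‖ ^ 2) * ‖ψ.1‖ ^ 2 ≤
        dGammaForm b c.J (c.T α (toL2 (absFn φ)))
          (c.yVec α (toL2 (absFn φ)) (toL2 (phaseGrad φ))) ψ) := by
  have hc := c.countable_of_hilbertBasis b
  have hk := c.isFormKernel_absFn α hφ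
  have hy := c.inner_yVec_phaseGrad α hφ
  have hw := memLp_two_compMeasure hφ.memLp_phaseComp
  have hσ : 0 < 2 * c.σ := by linarith [c.σ_pos]
  have hD := c.le_inner_two_absPow
  have hD0 : ∀ f : c.photonSpace, 0 ≤ (⟪f, ((2 : ℂ) • c.absPow 1) f⟫_ℂ).re := fun f =>
    (mul_nonneg hσ.le (sq_nonneg ‖f‖)).trans (hD f)
  have hJy := hk.involution_eq_self hy
  have hη := hk.existsUnique_shift hσ hD c.two_absPow_J hJy
  have hweyl : ∃ (η : c.photonSpace) (W : Fock ι ≃ₗᵢ[ℂ] Fock ι) (hW : IsWeyl b η W),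
      ∀ ψ : numDom ι, ‖ψ.1‖ = 1 →
        c.energy b α (absFn φ) ⟨W ψ.1, hW.map_mem ψ.1 ψ.2⟩ ≤ c.energy b α φ ψ := by
    -- The energy of φ carries the linear term −y, so the shift is solved for −y, that is, with −w
    -- in place of w. The resulting bound involves W^*, hence the transformation sought is W^* with
    -- parameter −η'. Its cost ∫ w² cancels the ‖w‖² from completing the square.
    obtain ⟨η', hη', -⟩ := hk.existsUnique_shift hσ hD c.two_absPow_J
      (hk.involution_eq_self (hk.inner_neg hy))
    obtain ⟨W, hW, hW', hle⟩ := hk.exists_isWeyl_dGammaForm_le b hD0 hw.neg hη'.1 hη'.2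
      (hk.inner_neg hy)
    refine ⟨-η', W.symm, hW', fun ψ hψ => ?_⟩
    have h1 := hle ψ
    have h2 := c.le_energy b α hφ hnorm ψ
    simp only [Pi.neg_apply, neg_sq] at h1
    rw [hφ.integral_norm_phaseGrad_sq, hψ] at h2
    rw [hψ] at h1
    rw [c.energy_absFn b α hφ hnorm, LinearIsometryEquiv.norm_map, hψ]
    linarith
  obtain ⟨hne, hglb⟩ := hk.isGLB_formRange b hD0
  have hset : {E | ∃ ψ : numDom ι, ‖ψ.1‖ = 1 ∧ E = c.energy b α (absFn φ) ψ} =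
      (fun t => (1 / 2) * gradNormSq (absFn φ) + (1 / 2) * t) ''
        formRange b c.J (c.T α (toL2 (absFn φ))) := by
    ext E
    constructor
    · rintro ⟨ψ, hψ, rfl⟩
      exact ⟨_, ⟨ψ, hψ, rfl⟩, by rw [c.energy_absFn b α hφ hnorm, hψ, one_pow, mul_one]⟩
    · rintro ⟨_, ⟨ψ, hψ, rfl⟩, rfl⟩
      exact ⟨ψ, hψ, by rw [c.energy_absFn b α hφ hnorm, hψ, one_pow, mul_one]⟩
  have hmin : IsGLB {E | ∃ ψ : numDom ι, ‖ψ.1‖ = 1 ∧ E = c.energy b α (absFn φ) ψ}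
      ((1 / 2) * gradNormSq (absFn φ) +
        (1 / 2) * sInf (formRange b c.J (c.T α (toL2 (absFn φ))))) := by
    rw [hset]
    refine ⟨?_, fun E hE => ?_⟩
    · rintro _ ⟨t, ht, rfl⟩
      have := hglb.1 ht
      show _ ≤ (1 / 2) * gradNormSq (absFn φ) + (1 / 2) * t
      linarith
    · have h1 : 2 * E - gradNormSq (absFn φ) ≤
          sInf (formRange b c.J (c.T α (toL2 (absFn φ)))) := hglb.2 fun t ht => by
        have h2 : E ≤ (1 / 2) * gradNormSq (absFn φ) + (1 / 2) * t := hE ⟨t, ht, rfl⟩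
        linarith
      linarith
  have hne' : {E | ∃ ψ : numDom ι, ‖ψ.1‖ = 1 ∧ E = c.energy b α (absFn φ) ψ}.Nonempty := by
    rw [hset]
    exact hne.image _
  obtain ⟨hsa, hleast⟩ := hk.isSelfAdjoint_and_isLeast_spectrum b hσ hD
  refine ⟨hφ.absFn, ?_, ⟨hsa, hleast.nonempty, hleast.bddBelow, ?_⟩, hweyl, hη,
    fun η h1 h2 => ?_⟩
  -- W preserves norms, so every trial state ψ for φ yields the trial state Wψ for |φ| with no
  -- larger energy.
  · obtain ⟨η, W, hW, hle⟩ := hweyl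
    obtain ⟨_, ψ₀, hψ₀, -⟩ := hne'
    refine le_csInf ⟨_, ψ₀, hψ₀, rfl⟩ ?_
    rintro _ ⟨ψ, hψ, rfl⟩
    exact (csInf_le ⟨_, hmin.1⟩ ⟨_, by rw [LinearIsometryEquiv.norm_map, hψ], rfl⟩).trans
      (hle ψ hψ)
  · rw [hleast.csInf_eq]
    exact hmin.csInf_eq hne'
  · obtain ⟨W, hW, -, hle⟩ := hk.exists_isWeyl_dGammaForm_le b hD0 hw h1 h2 hy
    exact ⟨W, hW, fun ψ => by rw [hφ.integral_norm_phaseGrad_sq]; exact hle ψ⟩
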